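/- Let $M$ be a smooth ($C^\infty$, Hausdorff, second countable) Riemannian manifold without boundary, of dimension $n\ge 1$. Let $\mathcal R\subseteq M$ be a closed set that is the closure of its interior (for example a Riemannian manifold with piecewise smooth boundary, as a domain in $M$), and let $\mathcal A$ be a relatively open subset of $\mathcal R$ (for example one with piecewise smooth boundary). Let $m>0$, let $V=C\,\mathbb 1_{\mathcal A}$ with $C\in\mathbb R$, and fix an energy $E>\max(0,C)$. Put $C_0=0$, $C_1=C$, $\mathcal A_1=\mathcal A$, $\mathcal A_0=\mathcal R\setminus\overline{\mathcal A}$ and $\mathcal B=\overline{\mathcal A}_0\sqcup\overline{\mathcal A}_1$ (disjoint union). A point $x\in\partial\overline{\mathcal A}_i$ is *regular* if near $x$ the set $\overline{\mathcal A}_i$ has the form $\{f\ge 0\}$ with $f$ smooth, $f(x)=0$ and $df_x\ne 0$, and if moreover $x$ is interior to $\mathcal R$ in case it lies in both $\overline{\mathcal A}_0$ and $\overline{\mathcal A}_1$. Then $\mathbf n_x$ denotes the unit normal pointing into $\overline{\mathcal A}_i$. Regular points that lie in both $\overline{\mathcal A}_0$ and $\overline{\mathcal A}_1$ form the refracting boundary,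 the others the reflecting boundary. The phase space $\mathcal V$ is the set of triples $(i,x,v)$ in which $x$ is a regular point of $\partial\overline{\mathcal A}_i$ and $v\in T_xM$ satisfies $\langle\mathbf n_x,v\rangle\ge 0$ and $\|v\|=\sqrt{2(E-C_i)/m}$; so each point of the refracting boundary occurs twice. The lensed billiard map $\mathcal T$ is defined as follows at $(i,x,v)\in\mathcal V$ with $\langle\mathbf n_x,v\rangle>0$. Let $\gamma$ be the geodesic with $\gamma(0)=x$, $\gamma'(0)=v$, let $t_0>0$ be the first time at which it hits $\partial\overline{\mathcal A}_i$, and let $y=\gamma(t_0)$, $\tilde v=\gamma'(t_0)$. Suppose that $t_0$ exists, that $y$ is a regular point of $\partial\overline{\mathcal A}_i$ with inward normal $\mathbf n$, and that $\tilde v_n=\langle\mathbf n,\tilde v\rangle\neq0$; write $\tilde v=\tilde v_\tau+\tilde v_n\mathbf n$. With $j=1-i$ and $b=\tilde v_n^2-\frac2m(C_j-C_i)$: - if $y$ is on the reflecting boundary, or if $b<0$, then $\mathcal T(i,x,v)=(i,y,\tilde v_\tau-\tilde v_n\mathbf n)$ (reflection); - if $y$ is on the refracting boundary and $b>0$, then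 $\mathcal T(i,x,v)=(j,y,\tilde v_\tau-\sqrt b\,\mathbf n)$ (refraction; $-\mathbf n$ is the normal that points into $\overline{\mathcal A}_j$). In all other cases (tangential contact, critical angle $b=0$ at the refracting boundary, non-regular $y$, no collision) $\mathcal T$ is undefined. Let $\nu$ be the Liouville measure on $\mathcal V$, i.e. the measure given by the volume form $|\omega^{n-1}|/(n-1)!$ restricted to $\mathcal V$, where $\omega=d\theta$, $\theta_{(x,v)}(\xi)=\langle v,d\pi(\xi)\rangle_x$, is the symplectic form of the tangent bundle $\pi:TM\to M$. As is usual for billiards, assume that the domain of $\mathcal T$ has full measure in $\mathcal V$. **Theorem.** The lensed billiard map preserves the Liouville measure: $\mathcal T$ (extended, say, by the identity to the null set where it is undefined) is measurable and $\nu(\mathcal T^{-1}(S))=\nu(S)$ for every Borel set $S$ of states. -/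

import Mathlib

open Set MeasureTheory Filter Topology
open scoped Manifold ContDiff ENNReal

/-- Borel structure on a tangent bundle. -/
noncomputable instance tangentBundleMeasurableSpace {E H M : Type*} [NormedAddCommGroup E] [NormedSpace ℝ E]
    [TopologicalSpace H] (I : ModelWithCorners ℝ E H) [TopologicalSpace M] [ChartedSpace H M]
    [IsManifold I 1 M] : MeasurableSpace (TangentBundle I M) := borel _

instance tangentBundleBorelSpace {E H M : Type*} [NormedAddCommGroup E] [NormedSpace ℝ E]
    [TopologicalSpace H] (I : ModelWithCorners ℝ E H) [TopologicalSpace M] [ChartedSpace H M]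
    [IsManifold I 1 M] : BorelSpace (TangentBundle I M) := ⟨rfl⟩

noncomputable section LensedBilliards

namespace LensedBilliard

/-- The model space of an `n`-dimensional manifold, with `n = d + 1`
(so that hypersurfaces have dimension `d`). -/
abbrev Model (d : ℕ) := EuclideanSpace ℝ (Fin (d + 1))

variable {d : ℕ} {M : Type*} [TopologicalSpace M] [ChartedSpace (Model d) M]
  [IsManifold (𝓡 (d + 1)) ∞ M]

/-- Smooth Riemannian metrics on the smooth manifold `M`. -/
abbrev Metric (d : ℕ) (M : Type*) [TopologicalSpace M] [ChartedSpace (Model d) M]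
    [IsManifold (𝓡 (d + 1)) ∞ M] :=
  Bundle.ContMDiffRiemannianMetric (𝓡 (d + 1)) ∞ (Model d)
    (fun x : M => TangentSpace (𝓡 (d + 1)) x)

/-! ### Geodesics -/

/-- The metric in the coordinates of the chart at `p`: the scalar product, at the point with
coordinates `z`, of the tangent vectors with coordinates `u` and `v`. -/
def metricInChart (g : Metric d M) (p : M) (z u v : Model d) : ℝ :=
  g.inner ((extChartAt (𝓡 (d + 1)) p).symm z)
    (mfderiv 𝓘(ℝ, Model d) (𝓡 (d + 1)) (extChartAt (𝓡 (d + 1)) p).symm z u)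
    (mfderiv 𝓘(ℝ, Model d) (𝓡 (d + 1)) (extChartAt (𝓡 (d + 1)) p).symm z v)

/-- Christoffel symbols of the first kind (`uⁱ vʲ wᵏ Γ_{k,ij}`) in the chart at `p`. -/
def christoffel (g : Metric d M) (p : M) (z u v w : Model d) : ℝ :=
  (fderiv ℝ (fun y => metricInChart g p y v w) z u
    + fderiv ℝ (fun y => metricInChart g p y u w) z v
    - fderiv ℝ (fun y => metricInChart g p y u v) z w) / 2

/-- `γ` is a geodesic on the open set of times `s`: it is of class `C²` and satisfies, in every
chart, the geodesic equation `g_{kl} c''ˡ + Γ_{k,ij} c'ⁱ c'ʲ = 0` for all `k`. -/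
def IsGeodesicOn (g : Metric d M) (γ : ℝ → M) (s : Set ℝ) : Prop :=
  ContMDiffOn 𝓘(ℝ, ℝ) (𝓡 (d + 1)) 2 γ s ∧
  ∀ t ∈ s, ∀ p : M, γ t ∈ (chartAt (Model d) p).source → ∀ w : Model d,
    let c : ℝ → Model d := fun r => extChartAt (𝓡 (d + 1)) p (γ r)
    metricInChart g p (c t) (deriv (deriv c) t) w
      + christoffel g p (c t) (deriv c t) (deriv c t) w = 0

/-- The state (position, velocity) of a moving point at time `t`. -/
def stateAt (γ : ℝ → M) (t : ℝ) : TangentBundle (𝓡 (d + 1)) M :=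
  ⟨γ t, mfderiv 𝓘(ℝ, ℝ) (𝓡 (d + 1)) γ t (1 : ℝ)⟩

/-- Free flight in the closed region `D`: the geodesic with initial state `z` runs in the interior
of `D` until it reaches the boundary of `D` for the first time at a time `t > 0`, with state `w`
there. -/
def Flight (g : Metric d M) (D : Set M) (z w : TangentBundle (𝓡 (d + 1)) M) : Prop :=
  ∃ (γ : ℝ → M) (t ε : ℝ), 0 < t ∧ 0 < ε ∧ IsGeodesicOn g γ (Ioo (-ε) (t + ε)) ∧
    stateAt γ 0 = z ∧ stateAt γ t = w ∧ (∀ r ∈ Ioo 0 t, γ r ∈ interior D) ∧ γ t ∈ frontier D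

/-! ### The billiard domain -/

/-- `x` lies on a smooth piece of the boundary of `D`, with `D` on one side of it, and `ν` is
the unit normal vector there that points into `D`: near `x` the set `D` is `{f ≥ 0}` with `f`
smooth, and `ν` is a positive multiple of the gradient of `f` at `x`, which does not vanish. -/
def IsInwardNormal (g : Metric d M) (D : Set M) (x : M) (ν : TangentSpace (𝓡 (d + 1)) x) : Prop :=
  g.inner x ν ν = 1 ∧
  ∃ (U : Set M) (f : M → ℝ) (c : ℝ), IsOpen U ∧ x ∈ U ∧
    ContMDiffOn (𝓡 (d + 1)) 𝓘(ℝ, ℝ) ∞ f U ∧ f x = 0 ∧ (∀ y ∈ U, y ∈ D ↔ 0 ≤ f y) ∧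
    0 < c ∧ ∀ w : TangentSpace (𝓡 (d + 1)) x,
      (mfderiv (𝓡 (d + 1)) 𝓘(ℝ, ℝ) f x w : ℝ) = c * g.inner x ν w

/-- The two components of the disjoint union `B`: `false` is the closure of `A₀ = R \ closure A`,
and `true` is the closure of `A₁ = A`. -/
def piece (R A : Set M) : Bool → Set M
  | false => closure (R \ closure A)
  | true => closure A

/-- The value of the potential `C · 1_A` on either component. -/
def potential (C : ℝ) : Bool → ℝ
  | false => 0
  | true => C

/-- `x` is a regular point of the boundary of component `i` of `B`, with inward unit normal `ν`.
It is a point of the refracting boundary if it lies in the other component too, and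
of the reflecting boundary otherwise. (A point where the refracting boundary meets the boundary
of `R` is not regular: a regular point of the refracting boundary is interior to `R`.) -/
def IsRegular (g : Metric d M) (R A : Set M) (i : Bool) (x : M)
    (ν : TangentSpace (𝓡 (d + 1)) x) : Prop :=
  IsInwardNormal g (piece R A i) x ν ∧ (x ∈ piece R A (!i) → x ∈ interior R)

/-- States: a component of `B`, a point and a velocity. -/
abbrev State (d : ℕ) (M : Type*) [TopologicalSpace M] [ChartedSpace (Model d) M]
    [IsManifold (𝓡 (d + 1)) ∞ M] := Bool × TangentBundle (𝓡 (d + 1)) M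

/-- The phase space at energy `E`: regular boundary points with a velocity that does not point
outwards, of the speed that the energy `E` prescribes. Each refracting boundary point
occurs twice, once for each component. -/
def phaseSpace (g : Metric d M) (R A : Set M) (m C E : ℝ) : Set (State d M) :=
  {z | ∃ ν, IsRegular g R A z.1 z.2.proj ν ∧ 0 ≤ g.inner z.2.proj ν z.2.snd ∧
    Real.sqrt (g.inner z.2.proj z.2.snd z.2.snd) = Real.sqrt (2 * (E - potential C z.1) / m)}

/-! ### The lensed billiard map -/

/-- The possible velocities after a collision: component `i`, point `y`, inward normal `ν` of
component `i` at `y`, incoming velocity `v`, so that `g(ν, v) < 0`. The result is the new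
component and the new velocity. (The inward normal of the other component is `-ν`.) -/
def Collision (g : Metric d M) (R A : Set M) (m C : ℝ) (i : Bool) (y : M)
    (ν v : TangentSpace (𝓡 (d + 1)) y) (z' : State d M) : Prop :=
  let a : ℝ := g.inner y ν v
  let b : ℝ := a ^ 2 - 2 / m * (potential C (!i) - potential C i)
  ((y ∉ piece R A (!i) ∨ b < 0) ∧
    z' = (i, (⟨y, v - (2 * a) • ν⟩ : TangentBundle (𝓡 (d + 1)) M))) ∨
  ((y ∈ piece R A (!i) ∧ 0 < b) ∧
    z' = (!i, (⟨y, (v - a • ν) + Real.sqrt b • (-ν)⟩ : TangentBundle (𝓡 (d + 1)) M)))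

/-- One step of the lensed billiard map takes `z` to `z'`. There is no step from `z` if `z` is
tangential, if the trajectory never reaches the boundary, or if it reaches the boundary
at a point that is not regular, tangentially, or at the critical angle. -/
def Step (g : Metric d M) (R A : Set M) (m C E : ℝ) (z z' : State d M) : Prop :=
  z ∈ phaseSpace g R A m C E ∧
  (∃ ν, IsRegular g R A z.1 z.2.proj ν ∧ 0 < g.inner z.2.proj ν z.2.snd) ∧
  ∃ w : TangentBundle (𝓡 (d + 1)) M, Flight g (piece R A z.1) z.2 w ∧
    ∃ ν, IsRegular g R A z.1 w.proj ν ∧ g.inner w.proj ν w.snd < 0 ∧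
      Collision g R A m C z.1 w.proj ν w.snd z'

/-- The domain of the lensed billiard map. -/
def billiardDomain (g : Metric d M) (R A : Set M) (m C E : ℝ) : Set (State d M) :=
  {z | ∃ z', Step g R A m C E z z'}

open Classical in
/-- The lensed billiard map, extended by the identity outside its domain. -/
def billiardMap (g : Metric d M) (R A : Set M) (m C E : ℝ) (z : State d M) : State d M :=
  if h : ∃ z', Step g R A m C E z z' then h.choose else z

/-! ### The Liouville measure -/

/-- Coordinates of the phase space, which has dimension `2 d = 2 (n - 1)`. -/
abbrev Coord (d : ℕ) := Fin d ⊕ Fin d → ℝ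

/-- For a map `ψ` into the tangent bundle, the component `a` of the pull-back `ψ^* θ` of the
canonical one-form `θ_{(x,v)}(ξ) = g_x(v, dπ ξ)` of the tangent bundle. -/
def pullbackForm (g : Metric d M) (ψ : Coord d → TangentBundle (𝓡 (d + 1)) M)
    (a : Fin d ⊕ Fin d) (u : Coord d) : ℝ :=
  g.inner (ψ u).proj (ψ u).snd
    (mfderiv 𝓘(ℝ, Coord d) (𝓡 (d + 1)) (fun u' => (ψ u').proj) u (Pi.single a 1))

/-- The matrix of the pull-back `ψ^* ω` of the symplectic form `ω = dθ`. -/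
def symplecticMatrix (g : Metric d M) (ψ : Coord d → TangentBundle (𝓡 (d + 1)) M)
    (u : Coord d) : Matrix (Fin d ⊕ Fin d) (Fin d ⊕ Fin d) ℝ :=
  Matrix.of fun a b => fderiv ℝ (pullbackForm g ψ b) u (Pi.single a 1)
    - fderiv ℝ (pullbackForm g ψ a) u (Pi.single b 1)

/-- The density of `|ψ^*(ω^d / d!)|` with respect to Lebesgue measure: the absolute value of the
Pfaffian of the antisymmetric matrix of `ψ^* ω`, which is the square root of its determinant. -/
def liouvilleDensity (g : Metric d M) (ψ : Coord d → TangentBundle (𝓡 (d + 1)) M)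
    (u : Coord d) : ℝ≥0∞ :=
  ENNReal.ofReal (Real.sqrt (symplecticMatrix g ψ u).det)

/-- Local parametrizations of the phase space: smooth injective maps from an open set of
coordinates into one component. -/
structure Parametrization (g : Metric d M) (R A : Set M) (m C E : ℝ) where
  /-- the component of `B` -/
  side : Bool
  /-- the coordinate domain -/
  dom : Set (Coord d)
  /-- the map -/
  toFun : Coord d → TangentBundle (𝓡 (d + 1)) M
  isOpen_dom : IsOpen dom
  smooth : ContMDiffOn 𝓘(ℝ, Coord d) (𝓡 (d + 1)).tangent ∞ toFun dom
  injOn : InjOn toFun dom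
  mem_phaseSpace : ∀ u ∈ dom, (side, toFun u) ∈ phaseSpace g R A m C E

/-- The Liouville measure in one parametrization. -/
def Parametrization.measure {g : Metric d M} {R A : Set M} {m C E : ℝ}
    (P : Parametrization g R A m C E) : Measure (State d M) :=
  (((volume : Measure (Coord d)).restrict P.dom).withDensity (liouvilleDensity g P.toFun)).map
    fun u => (P.side, P.toFun u)

/-- The Liouville measure of the phase space, i.e. the measure given by the volume form `ω^d / d!`
restricted to the phase space. The local measures agree on overlaps, so that the measure
glued from them is the least measure that dominates them all. -/
def liouvilleMeasure (g : Metric d M) (R A : Set M) (m C E : ℝ) : Measure (State d M) :=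
  ⨆ P : Parametrization g R A m C E, P.measure

end LensedBilliard

end LensedBilliards

/-! # The lensed billiard map preserves the Liouville measure

Outside a null set the billiard map is a composition `refract ∘ reflect ∘ flightReversal` of three
involutions of the transverse states, that is, of the states that point strictly into their piece
(`step_iff`):

* `flightReversal` is the free flight to the next collision followed by the reversal of the
  velocity. It is an involution since geodesics can be traversed backwards.
* `reflect` changes the sign of the tangential part of the velocity. Together with the reversal in
  `flightReversal` this makes up the usual reflection.
* `refract` moves a state over the refracting boundary to the other copy of that boundary, with the
  normal component of the velocity changed according to the law of refraction, if the new normal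
  component is real and nonzero. The laws for the two directions are inverse to each other.

Each of them is smooth on a relatively open set of transverse states, and preserves the Liouville
density, the square root of the determinant of `ω = dθ` in a parametrization. In fact it changes
the pull-back of `θ` by a sign and an exact form only, and the dimension `2 d` of the phase space is
even (`liouvilleDensity_eq`). For `reflect` and `refract` the reason is that `θ` evaluates the scalar
product of the velocity with vectors tangent to the boundary, so that it does not see the normal
part of the velocity (`liouvilleDensity_changeVelocity`). For `flightReversal` it is the first
variation formula (`GeodesicReaches.inner_variation`): in a family of geodesics of the same speed
`|v|`, the product of the velocity with the variation field is constant in time, so that a flight of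
duration `τ`, followed by the reversal, turns `θ` into `-(θ + |v|² dτ)`
(`pullbackForm_reverse_flow`), and `|v|²` is constant on each copy of the boundary.

The Liouville measure is the supremum of the measures given by single parametrizations. An
involution `h` as above maps a parametrization, after division into the two parts that it sends to
the two pieces, to parametrizations with the same density. So `ν ≤ h_* ν`, and applying `h_*` again
gives equality, since `h` is an involution
(`LiouvilleInvolution.measurePreserving`). No atlas of the phase space is needed.

The smoothness of `flightReversal` rests on the smoothness of the geodesic flow and of the hitting
time. The local flow of a smooth vector field is obtained from the implicit function theorem in the
Banach space of continuous curves (`exists_smooth_flow`), and the geodesic flow by continuation along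
a geodesic (`GeodesicReaches.eventually`). The hitting time is smooth by the implicit function
theorem, as the flight ends transversally (`BoundaryChart.exists_hittingTime`). That it remains the
time of the *first* collision for nearby states follows from transversality at both ends of the
flight and compactness in between (`exists_hittingTime_of_mem_flying`).
-/

set_option linter.unusedSectionVars false

noncomputable section

namespace LensedBilliard

/-! ### Smooth dependence of solutions of ordinary differential equations -/

section ImplicitFunction

variable {E₁ E₂ F : Type*} [NormedAddCommGroup E₁] [NormedSpace ℝ E₁] [CompleteSpace E₁]
  [NormedAddCommGroup E₂] [NormedSpace ℝ E₂] [CompleteSpace E₂]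
  [NormedAddCommGroup F] [NormedSpace ℝ F] [CompleteSpace F]

/-- A version of the implicit function theorem in which the implicit function is of class `C^∞` in
a whole neighbourhood. (`ContDiffAt ℝ ∞` at one point does not spread to a neighbourhood.) -/
theorem exists_smooth_implicitFunction {f : E₁ × E₂ → F} {u : E₁ × E₂}
    (hf : ∀ᶠ v in 𝓝 u, ContDiffAt ℝ ∞ f v)
    (hinv : (fderiv ℝ f u ∘L .inr ℝ E₁ E₂).IsInvertible) :
    ∃ ψ : E₁ → E₂, ψ u.1 = u.2 ∧ (∀ᶠ x in 𝓝 u.1, ContDiffAt ℝ ∞ ψ x) ∧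
      (∀ᶠ x in 𝓝 u.1, f (x, ψ x) = f u) ∧ ∀ᶠ v in 𝓝 u, f v = f u ↔ ψ v.1 = v.2 := by
  have hfu : ContDiffAt ℝ ∞ f u := hf.self_of_nhds
  have hn : (∞ : WithTop ℕ∞) ≠ 0 := by simp
  set ψ := hfu.implicitFunction hn hinv with hψ
  have hself : ψ u.1 = u.2 := hfu.implicitFunction_apply_self hn hinv
  have heq : ∀ᶠ x in 𝓝 u.1, f (x, ψ x) = f u := hfu.eventually_apply_implicitFunction hn hinv
  have hcd : ContDiffAt ℝ 1 ψ u.1 :=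
    (hfu.contDiffAt_implicitFunction hn hinv).of_le (by norm_cast)
  have hcont : ∀ᶠ x in 𝓝 u.1, ContinuousAt ψ x :=
    (hcd.eventually (by simp)).mono fun x hx => hx.continuousAt
  refine ⟨ψ, hself, ?_, heq, hfu.eventually_apply_eq_iff_implicitFunction hn hinv⟩
  have htend : Tendsto (fun x => (x, ψ x)) (𝓝 u.1) (𝓝 u) := by
    have h1 : ContinuousAt (fun x => (x, ψ x)) u.1 := continuousAt_id.prodMk hcd.continuousAt
    have h2 : (u.1, ψ u.1) = u := by rw [hself]
    simpa only [ContinuousAt, h2] using h1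
  have hopen : ∀ᶠ v in 𝓝 u, (fderiv ℝ f v ∘L .inr ℝ E₁ E₂).IsInvertible := by
    have hc : ContinuousAt (fun v => fderiv ℝ f v ∘L .inr ℝ E₁ E₂) u :=
      ((hfu.fderiv_right (m := 0) (by simp)).continuousAt).clm_comp
        continuousAt_const
    obtain ⟨e, he⟩ := hinv
    have := ContinuousLinearEquiv.nhds e
    rw [he] at this
    exact hc.eventually this
  filter_upwards [htend.eventually hf, htend.eventually hopen, heq, hcont,
    eventually_eventually_nhds.2 heq] with x hfx hix hex hcx hex'
  have huniq := hfx.eventually_apply_eq_iff_implicitFunction hn hix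
  have hx' : Tendsto (fun x' => (x', ψ x')) (𝓝 x) (𝓝 (x, ψ x)) :=
    continuousAt_id.prodMk hcx
  refine (hfx.contDiffAt_implicitFunction hn hix).congr_of_eventuallyEq ?_
  filter_upwards [hx'.eventually huniq, hex'] with x' h1 h2
  exact (h1.1 (by rw [h2, hex])).symm

end ImplicitFunction

section Superposition

variable {K : Type*} [TopologicalSpace K] [CompactSpace K]

/-- Pointwise application `(A, h) ↦ (s ↦ A s (h s))` on spaces of continuous functions. -/
def pointwiseApply (K : Type*) [TopologicalSpace K] [CompactSpace K] (E F : Type*)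
    [NormedAddCommGroup E] [NormedSpace ℝ E] [NormedAddCommGroup F] [NormedSpace ℝ F] :
    C(K, E →L[ℝ] F) →L[ℝ] C(K, E) →L[ℝ] C(K, F) :=
  LinearMap.mkContinuous₂
    (LinearMap.mk₂ ℝ (fun (A : C(K, E →L[ℝ] F)) (h : C(K, E)) =>
        (⟨fun s => A s (h s), by fun_prop⟩ : C(K, F)))
      (fun A B h => by ext; simp) (fun c A h => by ext; simp)
      (fun A h k => by ext; simp) (fun c A h => by ext; simp)) 1
    (fun A h => by
      rw [one_mul, ContinuousMap.norm_le _ (by positivity)]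
      intro s
      exact (ContinuousLinearMap.le_opNorm _ _).trans
        (mul_le_mul (A.norm_coe_le_norm s) (h.norm_coe_le_norm s) (norm_nonneg _)
          (norm_nonneg A)))

@[simp] theorem pointwiseApply_apply {E F : Type*}
    [NormedAddCommGroup E] [NormedSpace ℝ E] [NormedAddCommGroup F] [NormedSpace ℝ F]
    (A : C(K, E →L[ℝ] F)) (h : C(K, E)) (s : K) : pointwiseApply K E F A h s = A s (h s) := rfl

theorem hasFDerivAt_superposition {E F : Type*}
    [NormedAddCommGroup E] [NormedSpace ℝ E] [NormedAddCommGroup F] [NormedSpace ℝ F]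
    {f : C(E, F)} {f' : C(E, E →L[ℝ] F)} (hf : ∀ x, HasFDerivAt f (f' x) x) (y : C(K, E)) :
    HasFDerivAt (fun y : C(K, E) => f.comp y) (pointwiseApply K E F (f'.comp y)) y := by
  rw [hasFDerivAt_iff_isLittleO_nhds_zero, Asymptotics.isLittleO_iff]
  intro ε hε
  have hcpt : IsCompact (range y) := isCompact_range y.continuous
  have hu := hcpt.uniformContinuousAt_of_continuousAt f' (fun x _ => f'.continuous.continuousAt)
    (Metric.dist_mem_uniformity hε)
  obtain ⟨δ, hδ, hδ'⟩ := Metric.mem_uniformity_dist.1 hu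
  filter_upwards [Metric.ball_mem_nhds (0 : C(K, E)) hδ] with h hh
  rw [mem_ball_zero_iff] at hh
  rw [ContinuousMap.norm_le _ (by positivity)]
  intro s
  have hball : Convex ℝ (Metric.ball (y s) δ) := convex_ball _ _
  have hs : y s + h s ∈ Metric.ball (y s) δ := by
    rw [mem_ball_iff_norm, add_sub_cancel_left]
    exact (h.norm_coe_le_norm s).trans_lt hh
  have := hball.norm_image_sub_le_of_norm_hasFDerivWithin_le' (f := f) (f' := fun x => f' x)
    (φ := f' (y s)) (C := ε) (fun x _ => (hf x).hasFDerivWithinAt)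
    (fun x hx => by
      have h1 := @hδ' (y s) x (by rw [dist_comm]; exact hx) (mem_range_self s)
      have h2 : dist (f' (y s)) (f' x) < ε := h1
      rw [dist_comm, dist_eq_norm] at h2
      exact h2.le)
    (Metric.mem_ball_self hδ) hs
  rw [add_sub_cancel_left] at this
  simp only [ContinuousMap.sub_apply, ContinuousMap.comp_apply, ContinuousMap.add_apply,
    pointwiseApply_apply]
  exact this.trans (mul_le_mul_of_nonneg_left (h.norm_coe_le_norm s) hε.le)

universe u in
/-- The superposition operator `y ↦ f ∘ y` on continuous functions on a compact space is as
smooth as `f`: its derivative is pointwise application of the superposition operator of `Df`,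
which allows an induction on the order of differentiability. -/
theorem contDiff_superposition_nat (n : ℕ) : ∀ {E F : Type u}
    [NormedAddCommGroup E] [NormedSpace ℝ E] [NormedAddCommGroup F] [NormedSpace ℝ F]
    (f : C(E, F)), ContDiff ℝ n f → ContDiff ℝ n (fun y : C(K, E) => f.comp y) := by
  induction n with
  | zero =>
    intro E F _ _ _ _ f _
    exact contDiff_zero.2 (ContinuousMap.continuous_postcomp f)
  | succ n ih =>
    intro E F _ _ _ _ f hf
    obtain ⟨f', hf', hd⟩ := contDiff_succ_iff_hasFDerivAt.1 hf
    let g : C(E, E →L[ℝ] F) := ⟨f', hf'.continuous⟩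
    refine contDiff_succ_iff_hasFDerivAt.2 ⟨fun y => pointwiseApply K E F (g.comp y), ?_,
      hasFDerivAt_superposition (f' := g) hd⟩
    exact (pointwiseApply K E F).contDiff.comp (ih g hf')

theorem contDiff_superposition {E : Type*} [NormedAddCommGroup E] [NormedSpace ℝ E]
    (f : C(E, E)) (hf : ContDiff ℝ ∞ f) : ContDiff ℝ ∞ (fun y : C(K, E) => f.comp y) :=
  contDiff_infty.2 fun n => contDiff_superposition_nat n f (hf.of_le (by exact_mod_cast le_top))

end Superposition

section Flow

variable {E : Type*} [NormedAddCommGroup E] [NormedSpace ℝ E]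

/-- The Volterra operator `y ↦ (s ↦ ∫ r in 0..s, y r)` on continuous functions on `[0, 1]`. -/
def volterra (E : Type*) [NormedAddCommGroup E] [NormedSpace ℝ E] :
    C(Icc (0 : ℝ) 1, E) →L[ℝ] C(Icc (0 : ℝ) 1, E) :=
  LinearMap.mkContinuous
    { toFun := fun y => ⟨fun s => ∫ r in (0 : ℝ)..s, IccExtend zero_le_one y r, by
        have : Continuous (IccExtend (zero_le_one (α := ℝ)) y) := y.continuous.Icc_extend'
        exact (intervalIntegral.continuous_primitive (fun a b => this.intervalIntegrable a b) 0).comp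
          continuous_subtype_val⟩
      map_add' := fun y z => by
        have hy : Continuous (IccExtend (zero_le_one (α := ℝ)) y) := y.continuous.Icc_extend'
        have hz : Continuous (IccExtend (zero_le_one (α := ℝ)) z) := z.continuous.Icc_extend'
        ext s
        simp only [ContinuousMap.coe_mk, ContinuousMap.add_apply]
        rw [← intervalIntegral.integral_add (hy.intervalIntegrable _ _) (hz.intervalIntegrable _ _)]
        rfl
      map_smul' := fun c y => by
        ext s
        simp only [ContinuousMap.coe_mk, ContinuousMap.smul_apply, RingHom.id_apply]
        rw [← intervalIntegral.integral_smul]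
        rfl } 1
    (fun y => by
      rw [one_mul, ContinuousMap.norm_le _ (norm_nonneg _)]
      intro s
      have := intervalIntegral.norm_integral_le_of_norm_le_const (a := 0) (b := (s : ℝ))
        (f := IccExtend (zero_le_one (α := ℝ)) y) (C := ‖y‖)
        (fun x _ => y.norm_coe_le_norm _)
      refine this.trans ?_
      rw [sub_zero, abs_of_nonneg s.2.1]
      exact mul_le_of_le_one_right (norm_nonneg _) s.2.2)

theorem volterra_apply (y : C(Icc (0 : ℝ) 1, E)) (s : Icc (0 : ℝ) 1) :
    volterra E y s = ∫ r in (0 : ℝ)..s, IccExtend zero_le_one y r := rfl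

variable [CompleteSpace E]

/-- Solutions of `α' = f(α)` with a smooth right-hand side depend smoothly on time and on the
initial value. In the Banach space of continuous functions on `[0, 1]`, the rescaled solution
`s ↦ α (h * s)` with initial value `x` is the solution `y` of `y - x - h ∫ f(y) = 0`, an equation
to which the implicit function theorem applies at `h = 0`. -/
theorem exists_smooth_flow_of_contDiff {f : E → E} (hf : ContDiff ℝ ∞ f) (x₀ : E) :
    ∃ Φ : ℝ × E → E, (∀ᶠ p in 𝓝 ((0 : ℝ), x₀), ContDiffAt ℝ ∞ Φ p) ∧
      ∀ᶠ p in 𝓝 ((0 : ℝ), x₀), Φ (0, p.2) = p.2 ∧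
        HasDerivAt (fun t => Φ (t, p.2)) (f (Φ p)) p.1 := by
  let fc : C(E, E) := ⟨f, hf.continuous⟩
  let H : (ℝ × E) × C(Icc (0 : ℝ) 1, E) → C(Icc (0 : ℝ) 1, E) := fun v =>
    v.2 - ContinuousLinearMap.const ℝ (Icc (0 : ℝ) 1) v.1.2 - v.1.1 • volterra E (fc.comp v.2)
  have hH : ContDiff ℝ ∞ H := by
    have h1 : ContDiff ℝ ∞ fun v : (ℝ × E) × C(Icc (0 : ℝ) 1, E) => fc.comp v.2 :=
      (contDiff_superposition fc hf).comp contDiff_snd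
    have h2 : ContDiff ℝ ∞ fun v : (ℝ × E) × C(Icc (0 : ℝ) 1, E) => volterra E (fc.comp v.2) :=
      (volterra E).contDiff.comp h1
    have h3 : ContDiff ℝ ∞ fun v : (ℝ × E) × C(Icc (0 : ℝ) 1, E) =>
        ContinuousLinearMap.const ℝ (Icc (0 : ℝ) 1) v.1.2 :=
      (ContinuousLinearMap.const ℝ (Icc (0 : ℝ) 1) (M := E)).contDiff.comp
        (contDiff_snd.comp contDiff_fst)
    exact (contDiff_snd.sub h3).sub ((contDiff_fst.comp contDiff_fst).smul h2)
  let u : (ℝ × E) × C(Icc (0 : ℝ) 1, E) := ((0, x₀), ContinuousMap.const _ x₀)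
  have hHu : H u = 0 := by
    ext s
    simp [H, u]
  -- At `h = 0` the integral drops out, and the partial derivative is the identity.
  have hinv : (fderiv ℝ H u ∘L .inr ℝ (ℝ × E) C(Icc (0 : ℝ) 1, E)).IsInvertible := by
    have h1 : HasFDerivAt (fun y : C(Icc (0 : ℝ) 1, E) => H (u.1, y))
        (fderiv ℝ H u ∘L .inr ℝ (ℝ × E) C(Icc (0 : ℝ) 1, E)) u.2 :=
      ((hH.differentiable (by simp)) u).hasFDerivAt.comp u.2 (hasFDerivAt_prodMk_right u.1 u.2)
    have h2 : HasFDerivAt (fun y : C(Icc (0 : ℝ) 1, E) => H (u.1, y))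
        (ContinuousLinearMap.id ℝ _) u.2 := by
      have : (fun y : C(Icc (0 : ℝ) 1, E) => H (u.1, y)) =
          fun y => y - ContinuousLinearMap.const ℝ (Icc (0 : ℝ) 1) x₀ := by
        ext y s
        simp [H, u]
      rw [this]
      exact (hasFDerivAt_id u.2).sub_const _
    rw [h1.unique h2]
    exact ⟨ContinuousLinearEquiv.refl ℝ _, rfl⟩
  obtain ⟨ψ, -, hψ, -, huniq⟩ :=
    exists_smooth_implicitFunction (Eventually.of_forall fun v => hH.contDiffAt) hinv
  -- A continuous local flow, whose rescaled integral curves solve the equation `H = 0`.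
  obtain ⟨ε, hε, a, r, L, K, hr, hpl⟩ := IsPicardLindelof.of_contDiffAt_one
    (hf.contDiffAt.of_le (by exact_mod_cast le_top) : ContDiffAt ℝ 1 f x₀)
  obtain ⟨α, hα, hαc⟩ := (hpl 0).exists_forall_mem_closedBall_eq_hasDerivWithinAt_continuousOn
  simp only [zero_sub, zero_add] at hα hαc
  have hr' : (0 : ℝ) < r := hr
  have hα0 : ContinuousAt α (x₀, 0) := by
    refine hαc.continuousAt (prod_mem_nhds (Metric.closedBall_mem_nhds _ hr')
      (Icc_mem_nhds (by linarith) hε))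
  have hα00 : α (x₀, 0) = x₀ := (hα x₀ (Metric.mem_closedBall_self hr'.le)).1
  -- The rescaled integral curves converge to the constant curve.
  have hnear : ∀ᶠ p in 𝓝 ((0 : ℝ), x₀), |p.1| < ε ∧ p.2 ∈ Metric.closedBall x₀ r ∧
      ∃ y : C(Icc (0 : ℝ) 1, E), (∀ s, y s = α (p.2, p.1 * s)) ∧
        (H (p, y) = H u ↔ ψ p = y) := by
    obtain ⟨U, hU, V, hV, hUV⟩ := mem_nhds_prod_iff.1 huniq
    obtain ⟨η, hη, hηV⟩ := Metric.mem_nhds_iff.1 hV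
    obtain ⟨ρ, hρ, hρα⟩ := Metric.continuousAt_iff.1 hα0 (η / 2) (by positivity)
    rw [hα00] at hρα
    filter_upwards [hU, prod_mem_nhds (Metric.ball_mem_nhds (0 : ℝ) (lt_min hρ hε))
      (Metric.ball_mem_nhds x₀ (lt_min hρ hr'))] with p hpU hp
    obtain ⟨hp1, hp2⟩ := hp
    rw [mem_ball_zero_iff, Real.norm_eq_abs] at hp1
    rw [Metric.mem_ball] at hp2
    have hpr : p.2 ∈ Metric.closedBall x₀ r := (hp2.trans_le (min_le_right _ _)).le
    have hps : ∀ s : Icc (0 : ℝ) 1, |p.1 * s| ≤ |p.1| := fun s => by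
      rw [abs_mul, abs_of_nonneg s.2.1]
      exact mul_le_of_le_one_right (abs_nonneg _) s.2.2
    have hcont : Continuous fun s : Icc (0 : ℝ) 1 => α (p.2, p.1 * s) := by
      refine hαc.comp_continuous (by fun_prop) fun s => ⟨hpr, ?_⟩
      exact abs_le.1 ((hps s).trans (hp1.trans_le (min_le_right _ _)).le)
    refine ⟨hp1.trans_le (min_le_right _ _), hpr, ⟨_, hcont⟩, fun s => rfl, ?_⟩
    refine @hUV (p, ⟨_, hcont⟩) ⟨hpU, hηV ?_⟩
    rw [Metric.mem_ball]
    refine lt_of_le_of_lt ((ContinuousMap.dist_le (by positivity)).2 fun s => ?_)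
      (half_lt_self hη)
    refine (hρα ?_).le
    rw [Prod.dist_eq]
    refine max_lt (hp2.trans_le (min_le_left _ _)) ?_
    rw [Real.dist_eq, sub_zero]
    exact (hps s).trans_lt (hp1.trans_le (min_le_left _ _))
  let one : Icc (0 : ℝ) 1 := ⟨1, by simp⟩
  have hαψ : ∀ᶠ p in 𝓝 ((0 : ℝ), x₀), α (p.2, p.1) = ψ p one := by
    filter_upwards [hnear] with p hp
    obtain ⟨hp1, hpr, y, hy, hiff⟩ := hp
    have hHy : H (p, y) = H u := by
      rw [hHu]
      ext s
      obtain ⟨hα1, hα2⟩ := hα p.2 hpr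
      have hint : ∫ τ in (0 : ℝ)..s, p.1 • f (α (p.2, p.1 * τ)) =
          α (p.2, p.1 * s) - α (p.2, p.1 * 0) := by
        have hin : ∀ τ ∈ uIcc (0 : ℝ) s, p.1 * τ ∈ Ioo (-ε) ε := fun τ hτ => by
          rw [uIcc_of_le s.2.1] at hτ
          refine abs_lt.1 (lt_of_le_of_lt ?_ hp1)
          rw [abs_mul, abs_of_nonneg hτ.1]
          exact mul_le_of_le_one_right (abs_nonneg _) (hτ.2.trans s.2.2)
        refine intervalIntegral.integral_eq_sub_of_hasDerivAt
          (f := fun τ => α (p.2, p.1 * τ)) (fun τ hτ => ?_) ?_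
        · have h1 := (hα2 (p.1 * τ) (Ioo_subset_Icc_self (hin τ hτ))).hasDerivAt
            (Icc_mem_nhds (hin τ hτ).1 (hin τ hτ).2)
          have h2 : HasDerivAt (fun τ : ℝ => p.1 * τ) p.1 τ := by
            simpa using (hasDerivAt_id τ).const_mul p.1
          exact HasDerivAt.scomp τ h1 h2
        · refine ContinuousOn.intervalIntegrable ?_
          refine continuousOn_const.smul (hf.continuous.comp_continuousOn ?_)
          exact hαc.comp (by fun_prop) fun τ hτ => ⟨hpr, Ioo_subset_Icc_self (hin τ hτ)⟩
      rw [mul_zero] at hint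
      have hvol : p.1 • volterra E (fc.comp y) s = α (p.2, p.1 * s) - p.2 := by
        rw [volterra_apply, ← intervalIntegral.integral_smul]
        rw [hα1] at hint
        rw [← hint]
        refine intervalIntegral.integral_congr fun τ hτ => ?_
        rw [uIcc_of_le s.2.1] at hτ
        have hτ' : τ ∈ Icc (0 : ℝ) 1 := ⟨hτ.1, hτ.2.trans s.2.2⟩
        simp only [IccExtend_of_mem _ _ hτ', ContinuousMap.comp_apply, hy]
        rfl
      have hconst : ContinuousLinearMap.const ℝ (Icc (0 : ℝ) 1) p.2 s = p.2 := rfl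
      simp only [H, ContinuousMap.sub_apply, ContinuousMap.smul_apply, hvol, hy, hconst,
        ContinuousMap.zero_apply]
      abel
    rw [hiff.1 hHy, hy]
    simp [one]
  refine ⟨fun p => ψ p one, ?_, ?_⟩
  · filter_upwards [hψ] with p hp
    exact (ContinuousMap.evalCLM ℝ one).contDiff.contDiffAt.comp p hp
  · have hslice : Tendsto (fun p : ℝ × E => ((0 : ℝ), p.2)) (𝓝 (0, x₀)) (𝓝 (0, x₀)) := by
      have : Continuous (fun p : ℝ × E => ((0 : ℝ), p.2)) := by fun_prop
      exact this.tendsto' _ _ rfl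
    filter_upwards [hnear, hαψ, eventually_eventually_nhds.2 hαψ, hslice.eventually hαψ]
      with p hp hp1 hp2 hp3
    obtain ⟨hpε, hpr, -⟩ := hp
    obtain ⟨hα1, hα2⟩ := hα p.2 hpr
    refine ⟨hp3.symm.trans hα1, ?_⟩
    have hpε' := abs_lt.1 hpε
    have h1 := (hα2 p.1 ⟨hpε'.1.le, hpε'.2.le⟩).hasDerivAt (Icc_mem_nhds hpε'.1 hpε'.2)
    rw [← hp1]
    refine h1.congr_of_eventuallyEq ?_
    have hc : Tendsto (fun t : ℝ => (t, p.2)) (𝓝 p.1) (𝓝 p) :=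
      (by fun_prop : Continuous fun t : ℝ => (t, p.2)).tendsto' _ _ rfl
    filter_upwards [hc.eventually hp2] with t ht
    exact ht.symm

/-- Solutions of `α' = f(α)` depend smoothly on time and on the initial value, for `f` smooth near
the initial value. -/
theorem exists_smooth_flow [FiniteDimensional ℝ E] {f : E → E} {x₀ : E}
    (hf : ∀ᶠ x in 𝓝 x₀, ContDiffAt ℝ ∞ f x) :
    ∃ Φ : ℝ × E → E, (∀ᶠ p in 𝓝 ((0 : ℝ), x₀), ContDiffAt ℝ ∞ Φ p) ∧ Φ (0, x₀) = x₀ ∧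
      ∀ᶠ p in 𝓝 ((0 : ℝ), x₀), Φ (0, p.2) = p.2 ∧
        HasDerivAt (fun t => Φ (t, p.2)) (f (Φ p)) p.1 := by
  -- A cut-off makes the vector field smooth everywhere, without changing it near `x₀`.
  obtain ⟨ρ, hρ, hρf⟩ := Metric.eventually_nhds_iff_ball.1 hf
  let χ : ContDiffBump x₀ := ⟨ρ / 4, ρ / 2, by positivity, by linarith⟩
  have hχf : ContDiff ℝ ∞ fun x => χ x • f x := by
    rw [contDiff_iff_contDiffAt]
    intro x
    by_cases hx : x ∈ Metric.ball x₀ ρ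
    · exact χ.contDiff.contDiffAt.smul (hρf x hx)
    · have hx' : x ∉ tsupport χ := by
        rw [χ.tsupport_eq]
        intro h
        exact hx (Metric.closedBall_subset_ball (half_lt_self hρ) h)
      have : (fun x => χ x • f x) =ᶠ[𝓝 x] fun _ => 0 := by
        filter_upwards [notMem_tsupport_iff_eventuallyEq.1 hx'] with z hz
        simp [hz]
      exact contDiffAt_const.congr_of_eventuallyEq this
  obtain ⟨Φ, hΦ, hΦ'⟩ := exists_smooth_flow_of_contDiff hχf x₀
  have h0 : Φ (0, x₀) = x₀ := hΦ'.self_of_nhds.1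
  refine ⟨Φ, hΦ, h0, ?_⟩
  have hc : Tendsto Φ (𝓝 ((0 : ℝ), x₀)) (𝓝 x₀) := by
    have := hΦ.self_of_nhds.continuousAt.tendsto
    rwa [h0] at this
  filter_upwards [hΦ', hc.eventually χ.eventuallyEq_one] with p hp hp1
  refine ⟨hp.1, ?_⟩
  have h2 := hp.2
  simp only [hp1, Pi.one_apply, one_smul] at h2
  exact h2

end Flow

variable {d : ℕ} {M : Type*} [TopologicalSpace M] [ChartedSpace (Model d) M]
  [IsManifold (𝓡 (d + 1)) ∞ M]

/-! ### Coordinates on the tangent bundle -/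

/-- The state with coordinates `q = (position, velocity)` in the chart at `p`. -/
def chartState (p : M) (q : Model d × Model d) : TangentBundle (𝓡 (d + 1)) M :=
  ⟨(extChartAt (𝓡 (d + 1)) p).symm q.1,
    mfderiv 𝓘(ℝ, Model d) (𝓡 (d + 1)) (extChartAt (𝓡 (d + 1)) p).symm q.1 q.2⟩

/-- The coordinates (position, velocity) of a state in the chart at `p`. -/
def stateCoord (p : M) (ζ : TangentBundle (𝓡 (d + 1)) M) : Model d × Model d :=
  (extChartAt (𝓡 (d + 1)) p ζ.proj,
    mfderiv (𝓡 (d + 1)) 𝓘(ℝ, Model d) (extChartAt (𝓡 (d + 1)) p) ζ.proj ζ.snd)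

@[simp] theorem stateCoord_fst (p : M) (ζ : TangentBundle (𝓡 (d + 1)) M) :
    (stateCoord p ζ).1 = extChartAt (𝓡 (d + 1)) p ζ.proj := rfl

theorem mdifferentiableAt_extChartAt_symm {p : M} {z : Model d}
    (hz : z ∈ (extChartAt (𝓡 (d + 1)) p).target) :
    MDifferentiableAt 𝓘(ℝ, Model d) (𝓡 (d + 1)) (extChartAt (𝓡 (d + 1)) p).symm z := by
  have := mdifferentiableWithinAt_extChartAt_symm (I := 𝓡 (d + 1)) hz
  rwa [ModelWithCorners.range_eq_univ, mdifferentiableWithinAt_univ] at this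

theorem mfderiv_extChartAt_mfderiv_symm {p : M} {z : Model d}
    (hz : z ∈ (extChartAt (𝓡 (d + 1)) p).target) (v : Model d) :
    mfderiv (𝓡 (d + 1)) 𝓘(ℝ, Model d) (extChartAt (𝓡 (d + 1)) p)
      ((extChartAt (𝓡 (d + 1)) p).symm z)
      (mfderiv 𝓘(ℝ, Model d) (𝓡 (d + 1)) (extChartAt (𝓡 (d + 1)) p).symm z v) = v := by
  have := mfderiv_extChartAt_comp_mfderivWithin_extChartAt_symm (I := 𝓡 (d + 1)) hz
  rw [ModelWithCorners.range_eq_univ, mfderivWithin_univ] at this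
  exact congrArg (fun A => A v) this

theorem mfderiv_symm_mfderiv_extChartAt {p x : M}
    (hx : x ∈ (extChartAt (𝓡 (d + 1)) p).source) (v : TangentSpace (𝓡 (d + 1)) x) :
    mfderiv 𝓘(ℝ, Model d) (𝓡 (d + 1)) (extChartAt (𝓡 (d + 1)) p).symm
      (extChartAt (𝓡 (d + 1)) p x)
      (mfderiv (𝓡 (d + 1)) 𝓘(ℝ, Model d) (extChartAt (𝓡 (d + 1)) p) x v) = v := by
  have := mfderivWithin_extChartAt_symm_comp_mfderiv_extChartAt' (I := 𝓡 (d + 1)) hx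
  rw [ModelWithCorners.range_eq_univ, mfderivWithin_univ] at this
  exact congrArg (fun A => A v) this

theorem stateCoord_chartState {p : M} {q : Model d × Model d}
    (hq : q.1 ∈ (extChartAt (𝓡 (d + 1)) p).target) : stateCoord p (chartState p q) = q :=
  Prod.ext ((extChartAt (𝓡 (d + 1)) p).right_inv hq) (mfderiv_extChartAt_mfderiv_symm hq q.2)

theorem trivializationAt_symm_eq_chartState {p : M} {q : Model d × Model d}
    (hq : q.1 ∈ (extChartAt (𝓡 (d + 1)) p).target) :
    (trivializationAt (Model d) (TangentSpace (𝓡 (d + 1)) : M → Type _) p).toOpenPartialHomeomorph.symm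
      ((extChartAt (𝓡 (d + 1)) p).symm q.1, q.2) = chartState p q := by
  have hs : (extChartAt (𝓡 (d + 1)) p).symm q.1 ∈ (chartAt (Model d) p).source := by
    rw [← extChartAt_source (𝓡 (d + 1))]
    exact (extChartAt (𝓡 (d + 1)) p).map_target hq
  have h1 := TangentBundle.symmL_trivializationAt (I := 𝓡 (d + 1)) hs
  rw [ModelWithCorners.range_eq_univ, mfderivWithin_univ,
    (extChartAt (𝓡 (d + 1)) p).right_inv hq] at h1
  have h2 := Bundle.Trivialization.symmL_apply (R := ℝ)
    (trivializationAt (Model d) (TangentSpace (𝓡 (d + 1)) : M → Type _) p) hs q.2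
  have h3 := (trivializationAt (Model d) (TangentSpace (𝓡 (d + 1)) : M → Type _) p).mk_symm hs q.2
  exact h3.symm.trans (congrArg (Bundle.TotalSpace.mk ((extChartAt (𝓡 (d + 1)) p).symm q.1))
    (h2.symm.trans (congrArg (fun A => A q.2) h1)))

theorem trivializationAt_apply_eq_stateCoord {p : M} {ζ : TangentBundle (𝓡 (d + 1)) M}
    (hζ : ζ.proj ∈ (extChartAt (𝓡 (d + 1)) p).source) :
    (trivializationAt (Model d) (TangentSpace (𝓡 (d + 1)) : M → Type _) p) ζ =
      (ζ.proj, (stateCoord p ζ).2) := by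
  have hs : ζ.proj ∈ (chartAt (Model d) p).source := by
    rwa [← extChartAt_source (𝓡 (d + 1))]
  have h1 := TangentBundle.continuousLinearMapAt_trivializationAt (I := 𝓡 (d + 1)) hs
  rw [stateCoord, ← h1]
  refine Prod.ext rfl ?_
  exact (Bundle.Trivialization.continuousLinearMapAt_apply_of_mem (R := ℝ)
    (trivializationAt (Model d) (TangentSpace (𝓡 (d + 1)) : M → Type _) p) hs ζ.snd).symm

theorem chartState_stateCoord {p : M} {ζ : TangentBundle (𝓡 (d + 1)) M}
    (hζ : ζ.proj ∈ (extChartAt (𝓡 (d + 1)) p).source) : chartState p (stateCoord p ζ) = ζ := by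
  rw [← trivializationAt_symm_eq_chartState ((extChartAt (𝓡 (d + 1)) p).map_source hζ),
    stateCoord_fst, (extChartAt (𝓡 (d + 1)) p).left_inv hζ,
    ← trivializationAt_apply_eq_stateCoord hζ]
  refine (trivializationAt (Model d) (TangentSpace (𝓡 (d + 1)) : M → Type _)
    p).toOpenPartialHomeomorph.left_inv ?_
  rwa [TangentBundle.trivializationAt_source, mem_preimage, ← extChartAt_source (𝓡 (d + 1))]

theorem contMDiffAt_chartState {p : M} {q : Model d × Model d}
    (hq : q.1 ∈ (extChartAt (𝓡 (d + 1)) p).target) :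
    ContMDiffAt 𝓘(ℝ, Model d × Model d) (𝓡 (d + 1)).tangent ∞ (chartState p) q := by
  set e := trivializationAt (Model d) (TangentSpace (𝓡 (d + 1)) : M → Type _) p
  have hopen := (isOpen_extChartAt_target (I := 𝓡 (d + 1)) p).preimage
    (continuous_fst : Continuous (Prod.fst : Model d × Model d → Model d))
  have hs : (extChartAt (𝓡 (d + 1)) p).symm q.1 ∈ (chartAt (Model d) p).source := by
    rw [← extChartAt_source (𝓡 (d + 1))]
    exact (extChartAt (𝓡 (d + 1)) p).map_target hq
  have h1 : ContMDiffAt 𝓘(ℝ, Model d × Model d) ((𝓡 (d + 1)).prod 𝓘(ℝ, Model d)) ∞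
      (fun q : Model d × Model d => ((extChartAt (𝓡 (d + 1)) p).symm q.1, q.2)) q := by
    refine ContMDiffAt.prodMk ?_ contDiff_snd.contMDiff.contMDiffAt
    exact ((contMDiffOn_extChartAt_symm p).contMDiffAt
      ((isOpen_extChartAt_target (I := 𝓡 (d + 1)) p).mem_nhds hq)).comp q
      contDiff_fst.contMDiff.contMDiffAt
  have h2 := (Bundle.Trivialization.contMDiffOn_symm (IB := 𝓡 (d + 1)) (n := ∞) e).contMDiffAt
    (e.open_target.mem_nhds (e.mem_target.2 hs : ((extChartAt (𝓡 (d + 1)) p).symm q.1, q.2) ∈ _))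
  refine (h2.comp q h1).congr_of_eventuallyEq ?_
  filter_upwards [hopen.mem_nhds hq] with q' hq'
  exact (trivializationAt_symm_eq_chartState hq').symm

theorem isOpen_proj_preimage_source (p : M) :
    IsOpen {ζ : TangentBundle (𝓡 (d + 1)) M | ζ.proj ∈ (extChartAt (𝓡 (d + 1)) p).source} :=
  (isOpen_extChartAt_source p).preimage (FiberBundle.continuous_proj (Model d) _)

theorem contMDiffAt_stateCoord {p : M} {ζ : TangentBundle (𝓡 (d + 1)) M}
    (hζ : ζ.proj ∈ (extChartAt (𝓡 (d + 1)) p).source) :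
    ContMDiffAt (𝓡 (d + 1)).tangent 𝓘(ℝ, Model d × Model d) ∞ (stateCoord p) ζ := by
  set e := trivializationAt (Model d) (TangentSpace (𝓡 (d + 1)) : M → Type _) p
  have hs : ζ.proj ∈ (chartAt (Model d) p).source := by
    rwa [← extChartAt_source (𝓡 (d + 1))]
  have h2 := (Bundle.Trivialization.contMDiffOn (IB := 𝓡 (d + 1)) (n := ∞) e).contMDiffAt
    (e.open_source.mem_nhds (e.mem_source.2 hs))
  have h3 : ContMDiffAt (𝓡 (d + 1)).tangent 𝓘(ℝ, Model d × Model d) ∞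
      (fun ζ : TangentBundle (𝓡 (d + 1)) M =>
        (extChartAt (𝓡 (d + 1)) p (e ζ).1, (e ζ).2)) ζ := by
    refine ContMDiffAt.prodMk_space ?_ (contMDiffAt_snd.comp ζ h2)
    refine ContMDiffAt.comp ζ (contMDiffAt_extChartAt' ?_) (contMDiffAt_fst.comp ζ h2)
    exact hs
  refine h3.congr_of_eventuallyEq ?_
  filter_upwards [(isOpen_proj_preimage_source p).mem_nhds hζ] with ζ' hζ'
  have := trivializationAt_apply_eq_stateCoord hζ'
  simp only [e, this]
  rfl

/-! ### The metric and the geodesic equation in a chart -/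

theorem contMDiffAt_inner (g : Metric d M) {EN HN N : Type*} [NormedAddCommGroup EN]
    [NormedSpace ℝ EN] [TopologicalSpace HN] {J : ModelWithCorners ℝ EN HN} [TopologicalSpace N]
    [ChartedSpace HN N] {b : N → M} {v w : ∀ n, TangentSpace (𝓡 (d + 1)) (b n)} {x : N}
    (hv : ContMDiffAt J (𝓡 (d + 1)).tangent ∞
      (fun n => (⟨b n, v n⟩ : TangentBundle (𝓡 (d + 1)) M)) x)
    (hw : ContMDiffAt J (𝓡 (d + 1)).tangent ∞
      (fun n => (⟨b n, w n⟩ : TangentBundle (𝓡 (d + 1)) M)) x) :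
    ContMDiffAt J 𝓘(ℝ, ℝ) ∞ (fun n => g.inner (b n) (v n) (w n)) x := by
  have hb : ContMDiffAt J (𝓡 (d + 1)) ∞ b x := ((Bundle.contMDiffAt_totalSpace).1 hv).1
  have : ContMDiffAt J ((𝓡 (d + 1)).prod 𝓘(ℝ)) ∞
      (fun m ↦ Bundle.TotalSpace.mk' ℝ (E := Bundle.Trivial M ℝ) (b m)
        (g.inner (b m) (v m) (w m))) x := by
    apply ContMDiffAt.clm_bundle_apply₂ (F₁ := Model d) (F₂ := Model d)
    · exact g.contMDiff.contMDiffAt.comp x hb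
    · exact hv
    · exact hw
  exact ((Bundle.contMDiffAt_totalSpace).1 this).2

/-- Transport of scalar products along equalities of base points, in a form that avoids casts
between tangent spaces. -/
theorem inner_congr_of_mk_eq (g : Metric d M) {x y : M} {v w : TangentSpace (𝓡 (d + 1)) x}
    {v' w' : TangentSpace (𝓡 (d + 1)) y}
    (hv : (⟨x, v⟩ : TangentBundle (𝓡 (d + 1)) M) = ⟨y, v'⟩)
    (hw : (⟨x, w⟩ : TangentBundle (𝓡 (d + 1)) M) = ⟨y, w'⟩) :
    g.inner x v w = g.inner y v' w' := by
  cases hv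
  cases hw
  rfl

/-- Velocity vectors with given coordinates in the chart at `p`. -/
def chartVector (p : M) (z : Model d) :
    Model d →L[ℝ] TangentSpace (𝓡 (d + 1)) ((extChartAt (𝓡 (d + 1)) p).symm z) :=
  mfderiv 𝓘(ℝ, Model d) (𝓡 (d + 1)) (extChartAt (𝓡 (d + 1)) p).symm z

/-- Coordinates of tangent vectors in the chart at `p`. -/
def vectorCoord (p x : M) : TangentSpace (𝓡 (d + 1)) x →L[ℝ] Model d :=
  mfderiv (𝓡 (d + 1)) 𝓘(ℝ, Model d) (extChartAt (𝓡 (d + 1)) p) x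

theorem stateCoord_eq (p : M) (x : M) (v : TangentSpace (𝓡 (d + 1)) x) :
    stateCoord p ⟨x, v⟩ = (extChartAt (𝓡 (d + 1)) p x, vectorCoord p x v) := rfl

/-- The metric in the chart at `p`, as a field of bilinear forms. -/
def metricForm (g : Metric d M) (p : M) (z : Model d) : Model d →L[ℝ] Model d →L[ℝ] ℝ :=
  (ContinuousLinearMap.precomp ℝ (chartVector p z)).comp
    ((g.inner ((extChartAt (𝓡 (d + 1)) p).symm z)).comp (chartVector p z))

theorem metricForm_apply (g : Metric d M) (p : M) (z u v : Model d) :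
    metricForm g p z u v = metricInChart g p z u v := rfl

theorem metricForm_vectorCoord (g : Metric d M) {p x : M}
    (hx : x ∈ (extChartAt (𝓡 (d + 1)) p).source) (v w : TangentSpace (𝓡 (d + 1)) x) :
    metricForm g p (extChartAt (𝓡 (d + 1)) p x) (vectorCoord p x v) (vectorCoord p x w) =
      g.inner x v w :=
  inner_congr_of_mk_eq g (chartState_stateCoord (ζ := ⟨x, v⟩) hx)
    (chartState_stateCoord (ζ := ⟨x, w⟩) hx)

theorem metricForm_symm (g : Metric d M) (p : M) (z u v : Model d) :
    metricForm g p z u v = metricForm g p z v u := g.symm _ _ _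

theorem chartVector_injective {p : M} {z : Model d} (hz : z ∈ (extChartAt (𝓡 (d + 1)) p).target) :
    Function.Injective (chartVector p z) :=
  Function.LeftInverse.injective (g := vectorCoord p ((extChartAt (𝓡 (d + 1)) p).symm z))
    fun v => mfderiv_extChartAt_mfderiv_symm hz v

theorem metricForm_pos (g : Metric d M) {p : M} {z : Model d}
    (hz : z ∈ (extChartAt (𝓡 (d + 1)) p).target) {u : Model d} (hu : u ≠ 0) :
    0 < metricForm g p z u u := by
  refine g.pos _ _ fun h => hu (chartVector_injective hz ?_)
  rw [map_zero]
  exact h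

theorem metricForm_isInvertible (g : Metric d M) {p : M} {z : Model d}
    (hz : z ∈ (extChartAt (𝓡 (d + 1)) p).target) : (metricForm g p z).IsInvertible := by
  have hinj : Function.Injective (metricForm g p z).toLinearMap := by
    rw [← LinearMap.ker_eq_bot, LinearMap.ker_eq_bot']
    intro u hu
    by_contra h
    have h1 := metricForm_pos g hz h
    have h2 : metricForm g p z u = 0 := hu
    rw [h2] at h1
    exact lt_irrefl _ h1
  have hrank : Module.finrank ℝ (Model d) = Module.finrank ℝ (Model d →L[ℝ] ℝ) := by
    rw [← (LinearMap.toContinuousLinearMap (𝕜 := ℝ) (E := Model d) (F' := ℝ)).finrank_eq]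
    exact (Subspace.dual_finrank_eq).symm
  refine ⟨((metricForm g p z).toLinearMap.linearEquivOfInjective hinj
    hrank).toContinuousLinearEquiv, ?_⟩
  ext u v
  rfl

theorem contDiffAt_metricForm (g : Metric d M) {p : M} {z : Model d}
    (hz : z ∈ (extChartAt (𝓡 (d + 1)) p).target) : ContDiffAt ℝ ∞ (metricForm g p) z := by
  have hopen := isOpen_extChartAt_target (I := 𝓡 (d + 1)) p
  suffices h : ContDiffOn ℝ ∞ (metricForm g p) (extChartAt (𝓡 (d + 1)) p).target from
    h.contDiffAt (hopen.mem_nhds hz)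
  rw [contDiffOn_clm_apply]
  intro u
  rw [contDiffOn_clm_apply]
  intro v y hy
  refine ContDiffAt.contDiffWithinAt (contMDiffAt_iff_contDiffAt.1 ?_)
  have hs : ∀ u : Model d, ContMDiffAt 𝓘(ℝ, Model d) (𝓡 (d + 1)).tangent ∞
      (fun z : Model d => chartState p (z, u)) y := fun u => by
    have h1 : ContMDiffAt 𝓘(ℝ, Model d) 𝓘(ℝ, Model d × Model d) ∞
        (fun z : Model d => (z, u)) y := by
      rw [contMDiffAt_iff_contDiffAt]
      fun_prop
    exact (contMDiffAt_chartState (q := (y, u)) hy).comp y h1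
  exact contMDiffAt_inner g (hs u) (hs v)

theorem fderiv_metricInChart (g : Metric d M) {p : M} {z : Model d}
    (hz : z ∈ (extChartAt (𝓡 (d + 1)) p).target) (u v w : Model d) :
    fderiv ℝ (fun y => metricInChart g p y v w) z u = fderiv ℝ (metricForm g p) z u v w := by
  have h := ((contDiffAt_metricForm g hz).differentiableAt (by simp)).hasFDerivAt
  have h1 := (h.clm_apply (hasFDerivAt_const v z)).clm_apply (hasFDerivAt_const w z)
  have h2 : HasFDerivAt (fun y => metricInChart g p y v w) _ z := h1
  rw [h2.fderiv]
  simp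

theorem christoffel_eq (g : Metric d M) {p : M} {z : Model d}
    (hz : z ∈ (extChartAt (𝓡 (d + 1)) p).target) (u v w : Model d) :
    christoffel g p z u v w = (fderiv ℝ (metricForm g p) z u v w
      + fderiv ℝ (metricForm g p) z v u w - fderiv ℝ (metricForm g p) z w u v) / 2 := by
  simp only [christoffel, fderiv_metricInChart g hz]

/-- The covector `w ↦ Γ(v, v, w)` of Christoffel symbols. -/
def christoffelForm (g : Metric d M) (p : M) (q : Model d × Model d) : Model d →L[ℝ] ℝ :=
  fderiv ℝ (metricForm g p) q.1 q.2 q.2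
    - (1 / 2 : ℝ) • ((fderiv ℝ (metricForm g p) q.1).flip q.2).flip q.2

theorem christoffelForm_apply (g : Metric d M) {p : M} {z : Model d}
    (hz : z ∈ (extChartAt (𝓡 (d + 1)) p).target) (v w : Model d) :
    christoffelForm g p (z, v) w = christoffel g p z v v w := by
  rw [christoffel_eq g hz]
  simp only [christoffelForm, sub_apply, smul_apply,
    ContinuousLinearMap.flip_apply, smul_eq_mul]
  ring

set_option maxSynthPendingDepth 4 in
theorem contDiffAt_fderiv_bilin {E : Type*} [NormedAddCommGroup E] [NormedSpace ℝ E]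
    {G : E → E →L[ℝ] E →L[ℝ] ℝ} {q : E × E} (hG : ContDiffAt ℝ ∞ G q.1) (w : E) :
    ContDiffAt ℝ ∞ (fun q : E × E =>
      fderiv ℝ G q.1 q.2 q.2 w - (1 / 2 : ℝ) * fderiv ℝ G q.1 w q.2 q.2) q := by
  have h1 : ContDiffAt ℝ ∞ (fun q : E × E => fderiv ℝ G q.1) q :=
    (hG.fderiv_right (m := ∞) (by simp)).comp q contDiffAt_fst
  refine ContDiffAt.sub ?_ (contDiffAt_const.mul ?_)
  · exact ((h1.clm_apply contDiffAt_snd).clm_apply contDiffAt_snd).clm_apply contDiffAt_const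
  · exact ((h1.clm_apply contDiffAt_const).clm_apply contDiffAt_snd).clm_apply contDiffAt_snd

theorem contDiffAt_christoffelForm (g : Metric d M) {p : M} {q : Model d × Model d}
    (hq : q.1 ∈ (extChartAt (𝓡 (d + 1)) p).target) : ContDiffAt ℝ ∞ (christoffelForm g p) q := by
  have hopen : IsOpen ((extChartAt (𝓡 (d + 1)) p).target ×ˢ (univ : Set (Model d))) :=
    (isOpen_extChartAt_target (I := 𝓡 (d + 1)) p).prod isOpen_univ
  suffices h : ContDiffOn ℝ ∞ (christoffelForm g p)
      ((extChartAt (𝓡 (d + 1)) p).target ×ˢ (univ : Set (Model d))) from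
    h.contDiffAt (hopen.mem_nhds ⟨hq, mem_univ _⟩)
  rw [contDiffOn_clm_apply]
  intro w q hq
  exact (contDiffAt_fderiv_bilin (contDiffAt_metricForm g hq.1) w).contDiffWithinAt

/-- The acceleration of geodesics in the chart at `p`, as a function of position and velocity. -/
def geodesicAccel (g : Metric d M) (p : M) (q : Model d × Model d) : Model d :=
  (metricForm g p q.1).inverse (-christoffelForm g p q)

theorem contDiffAt_inverse_metricForm (g : Metric d M) {p : M} {z : Model d}
    (hz : z ∈ (extChartAt (𝓡 (d + 1)) p).target) :
    ContDiffAt ℝ ∞ (fun z => (metricForm g p z).inverse) z := by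
  obtain ⟨e, he⟩ := metricForm_isInvertible g hz
  have h := contDiffAt_map_inverse (n := ∞) e
  rw [he] at h
  exact h.comp z (contDiffAt_metricForm g hz)

theorem contDiffAt_geodesicAccel (g : Metric d M) {p : M} {q : Model d × Model d}
    (hq : q.1 ∈ (extChartAt (𝓡 (d + 1)) p).target) : ContDiffAt ℝ ∞ (geodesicAccel g p) q := by
  have h1 : ContDiffAt ℝ ∞ (fun q : Model d × Model d => (metricForm g p q.1).inverse) q :=
    (contDiffAt_inverse_metricForm g hq).comp q contDiffAt_fst
  exact h1.clm_apply (contDiffAt_christoffelForm g hq).neg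

theorem metricForm_inverse_apply (g : Metric d M) {p : M} {z : Model d}
    (hz : z ∈ (extChartAt (𝓡 (d + 1)) p).target) (l : Model d →L[ℝ] ℝ) :
    metricForm g p z ((metricForm g p z).inverse l) = l := by
  obtain ⟨e, he⟩ := metricForm_isInvertible g hz
  rw [← he, ContinuousLinearMap.inverse_equiv]
  exact e.apply_symm_apply l

/-- The geodesic equation for the curve `c` of coordinates in the chart at `p`, at time `t`. -/
def GeodesicEqAt (g : Metric d M) (p : M) (c : ℝ → Model d) (t : ℝ) : Prop :=
  ∀ w : Model d, metricInChart g p (c t) (deriv (deriv c) t) w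
    + christoffel g p (c t) (deriv c t) (deriv c t) w = 0

theorem geodesicEqAt_iff (g : Metric d M) {p : M} {c : ℝ → Model d} {t : ℝ}
    (hz : c t ∈ (extChartAt (𝓡 (d + 1)) p).target) :
    GeodesicEqAt g p c t ↔ deriv (deriv c) t = geodesicAccel g p (c t, deriv c t) := by
  have hinj : Function.Injective (metricForm g p (c t)) := by
    obtain ⟨e, he⟩ := metricForm_isInvertible g hz
    rw [← he]
    exact e.injective
  rw [← hinj.eq_iff]
  simp only [geodesicAccel]
  rw [metricForm_inverse_apply g hz, ContinuousLinearMap.ext_iff]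
  refine forall_congr' fun w => ?_
  rw [neg_apply, christoffelForm_apply g hz, metricForm_apply,
    add_eq_zero_iff_eq_neg]

section Transition

variable {E : Type*} [NormedAddCommGroup E] [NormedSpace ℝ E]

/-- The derivative of a metric pulled back by `h`. -/
theorem fderiv_pullback_bilin {G G' : E → E →L[ℝ] E →L[ℝ] ℝ} {h : E → E} {z : E}
    (hG' : ∀ᶠ y in 𝓝 z, ∀ v w, G' y v w = G (h y) (fderiv ℝ h y v) (fderiv ℝ h y w))
    (hdG' : DifferentiableAt ℝ G' z) (hdG : DifferentiableAt ℝ G (h z))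
    (hh : ContDiffAt ℝ 2 h z) (u v w : E) :
    fderiv ℝ G' z u v w = fderiv ℝ G (h z) (fderiv ℝ h z u) (fderiv ℝ h z v) (fderiv ℝ h z w)
      + G (h z) (fderiv ℝ (fderiv ℝ h) z u v) (fderiv ℝ h z w)
      + G (h z) (fderiv ℝ h z v) (fderiv ℝ (fderiv ℝ h) z u w) := by
  have h1 : HasFDerivAt (fderiv ℝ h) (fderiv ℝ (fderiv ℝ h) z) z :=
    ((hh.fderiv_right (m := 1) (by norm_num)).differentiableAt (by simp)).hasFDerivAt
  have h2 : HasFDerivAt h (fderiv ℝ h z) z := (hh.differentiableAt (by simp)).hasFDerivAt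
  have h3 : HasFDerivAt (G ∘ h) (fderiv ℝ G (h z) ∘L fderiv ℝ h z) z :=
    HasFDerivAt.comp (g := G) z hdG.hasFDerivAt h2
  have h4 := (h3.clm_apply (h1.clm_apply (hasFDerivAt_const v z))).clm_apply
    (h1.clm_apply (hasFDerivAt_const w z))
  have h5 := (hdG'.hasFDerivAt.clm_apply (hasFDerivAt_const v z)).clm_apply (hasFDerivAt_const w z)
  have h6 : (fun y => G' y v w) =ᶠ[𝓝 z] fun y =>
      (G ∘ h) y (fderiv ℝ h y v) (fderiv ℝ h y w) := hG'.mono fun y hy => hy v w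
  have h7 := h5.unique (h4.congr_of_eventuallyEq h6)
  have h8 := congrArg (fun A => A u) h7
  simp only [add_apply, ContinuousLinearMap.comp_apply,
    ContinuousLinearMap.flip_apply, zero_apply, map_zero, zero_add,
    Function.comp_apply] at h8
  rw [h8]
  ring

end Transition

/-- The change of coordinates from the chart at `p` to the chart at `q`. -/
def transition (p q : M) : Model d → Model d :=
  extChartAt (𝓡 (d + 1)) q ∘ (extChartAt (𝓡 (d + 1)) p).symm

theorem contDiffAt_transition {p q : M} {z : Model d}
    (hz : z ∈ (extChartAt (𝓡 (d + 1)) p).target)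
    (hz' : (extChartAt (𝓡 (d + 1)) p).symm z ∈ (extChartAt (𝓡 (d + 1)) q).source) :
    ContDiffAt ℝ ∞ (transition p q) z := by
  rw [← contMDiffAt_iff_contDiffAt]
  have h1 := (contMDiffOn_extChartAt_symm (I := 𝓡 (d + 1)) (n := ∞) p).contMDiffAt
    ((isOpen_extChartAt_target (I := 𝓡 (d + 1)) p).mem_nhds hz)
  have h2 : ContMDiffAt (𝓡 (d + 1)) 𝓘(ℝ, Model d) ∞ (extChartAt (𝓡 (d + 1)) q)
      ((extChartAt (𝓡 (d + 1)) p).symm z) :=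
    contMDiffAt_extChartAt' (by rwa [extChartAt_source] at hz')
  exact h2.comp z h1

theorem vectorCoord_chartVector {p q : M} {z : Model d}
    (hz : z ∈ (extChartAt (𝓡 (d + 1)) p).target)
    (hz' : (extChartAt (𝓡 (d + 1)) p).symm z ∈ (extChartAt (𝓡 (d + 1)) q).source) (u : Model d) :
    vectorCoord q ((extChartAt (𝓡 (d + 1)) p).symm z) (chartVector p z u) =
      fderiv ℝ (transition p q) z u := by
  have h1 : MDifferentiableAt (𝓡 (d + 1)) 𝓘(ℝ, Model d) (extChartAt (𝓡 (d + 1)) q)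
      ((extChartAt (𝓡 (d + 1)) p).symm z) :=
    mdifferentiableAt_extChartAt (by rwa [extChartAt_source] at hz')
  have h2 := mfderiv_comp z h1 (mdifferentiableAt_extChartAt_symm hz)
  have h3 := congrArg (fun A => A u) h2
  rw [← mfderiv_eq_fderiv]
  exact h3.symm

theorem eventually_mem_transition {p q : M} {z : Model d}
    (hz : z ∈ (extChartAt (𝓡 (d + 1)) p).target)
    (hz' : (extChartAt (𝓡 (d + 1)) p).symm z ∈ (extChartAt (𝓡 (d + 1)) q).source) :
    ∀ᶠ y in 𝓝 z, y ∈ (extChartAt (𝓡 (d + 1)) p).target ∧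
      (extChartAt (𝓡 (d + 1)) p).symm y ∈ (extChartAt (𝓡 (d + 1)) q).source := by
  have hc : ContinuousAt (extChartAt (𝓡 (d + 1)) p).symm z :=
    (continuousOn_extChartAt_symm p).continuousAt
      ((isOpen_extChartAt_target (I := 𝓡 (d + 1)) p).mem_nhds hz)
  filter_upwards [(isOpen_extChartAt_target (I := 𝓡 (d + 1)) p).mem_nhds hz,
    hc.eventually ((isOpen_extChartAt_source (I := 𝓡 (d + 1)) q).mem_nhds hz')] with y h1 h2
  exact ⟨h1, h2⟩

theorem metricForm_transition (g : Metric d M) {p q : M} {z : Model d}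
    (hz : z ∈ (extChartAt (𝓡 (d + 1)) p).target)
    (hz' : (extChartAt (𝓡 (d + 1)) p).symm z ∈ (extChartAt (𝓡 (d + 1)) q).source)
    (v w : Model d) :
    metricForm g p z v w = metricForm g q (transition p q z) (fderiv ℝ (transition p q) z v)
      (fderiv ℝ (transition p q) z w) := by
  rw [← vectorCoord_chartVector hz hz', ← vectorCoord_chartVector hz hz']
  exact (metricForm_vectorCoord g hz' _ _).symm

/-- The geodesic equation is invariant under changes of coordinates. -/
theorem GeodesicEqAt.comp_transition {g : Metric d M} {p q : M} {c : ℝ → Model d} {t : ℝ}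
    (hc : ContDiffAt ℝ 2 c t) (hz : c t ∈ (extChartAt (𝓡 (d + 1)) p).target)
    (hz' : (extChartAt (𝓡 (d + 1)) p).symm (c t) ∈ (extChartAt (𝓡 (d + 1)) q).source)
    (hgeo : GeodesicEqAt g p c t) :
    GeodesicEqAt g q (transition p q ∘ c) t := by
  set h : Model d → Model d := transition p q with hh
  set z := c t with hzdef
  have hhz : h z ∈ (extChartAt (𝓡 (d + 1)) q).target := (extChartAt (𝓡 (d + 1)) q).map_source hz'
  have hcd : ContDiffAt ℝ ∞ h z := contDiffAt_transition hz hz'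
  have hcd2 : ContDiffAt ℝ 2 h z := hcd.of_le ENat.LEInfty.out
  -- The derivative of the transition map is onto, so that all test vectors are of the form `Dh w`.
  have hsurj : ∀ w' : Model d, ∃ w, fderiv ℝ h z w = w' := fun w' => by
    have h2 : HasFDerivAt h (fderiv ℝ h z) z := (hcd.differentiableAt (by simp)).hasFDerivAt
    have hinj : Function.Injective (fderiv ℝ h z) := by
      rw [injective_iff_map_eq_zero]
      intro u hu
      by_contra hne
      have h3 := metricForm_pos g hz hne
      rw [metricForm_transition g hz hz', ← hh, hu] at h3
      simp at h3
    exact (LinearMap.injective_iff_surjective (f := (fderiv ℝ h z).toLinearMap)).1 hinj w'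
  have hc1 : ∀ᶠ r in 𝓝 t, DifferentiableAt ℝ c r :=
    (hc.eventually (by simp)).mono fun r hr => hr.differentiableAt (by simp)
  have hcz : ContinuousAt c t := hc.continuousAt
  have hh1 : ∀ᶠ y in 𝓝 z, DifferentiableAt ℝ h y :=
    (hcd2.eventually (by simp)).mono fun y hy => hy.differentiableAt (by simp)
  have hderiv : deriv (h ∘ c) =ᶠ[𝓝 t] fun r => fderiv ℝ h (c r) (deriv c r) := by
    filter_upwards [hc1, hcz.eventually hh1] with r h1 h2
    exact (h2.hasFDerivAt.comp_hasDerivAt r h1.hasDerivAt).deriv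
  have hd1 : deriv (h ∘ c) t = fderiv ℝ h z (deriv c t) := hderiv.self_of_nhds
  have hdc : HasDerivAt c (deriv c t) t := hc1.self_of_nhds.hasDerivAt
  have hddc : HasDerivAt (deriv c) (deriv (deriv c) t) t := by
    have h1 : ContDiffAt ℝ 1 (deriv c) t := by
      have : ContDiffAt ℝ 1 (fderiv ℝ c) t := hc.fderiv_right (by norm_num)
      exact this.clm_apply contDiffAt_const
    exact (h1.differentiableAt (by simp)).hasDerivAt
  have hdd : HasFDerivAt (fderiv ℝ h) (fderiv ℝ (fderiv ℝ h) z) z :=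
    ((hcd2.fderiv_right (m := 1) (by norm_num)).differentiableAt (by simp)).hasFDerivAt
  have hd2 : deriv (deriv (h ∘ c)) t =
      fderiv ℝ (fderiv ℝ h) z (deriv c t) (deriv c t) + fderiv ℝ h z (deriv (deriv c) t) := by
    rw [hderiv.deriv_eq]
    exact ((hdd.comp_hasDerivAt t hdc).clm_apply hddc).deriv
  have hpull := fderiv_pullback_bilin (G := metricForm g q) (G' := metricForm g p) (h := h) (z := z)
    ((eventually_mem_transition hz hz').mono fun y hy v w => metricForm_transition g hy.1 hy.2 v w)
    ((contDiffAt_metricForm g hz).differentiableAt (by simp))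
    ((contDiffAt_metricForm g hhz).differentiableAt (by simp)) hcd2
  have hsymm : ∀ u v, fderiv ℝ (fderiv ℝ h) z u v = fderiv ℝ (fderiv ℝ h) z v u := fun u v =>
    (hcd2.isSymmSndFDerivAt (by simp)).eq u v
  intro w'
  obtain ⟨w, rfl⟩ := hsurj w'
  have h0 := hgeo w
  rw [← metricForm_apply, christoffel_eq g hz, hpull, hpull,
    metricForm_transition g hz hz', ← hh] at h0
  have hv : (h ∘ c) t = h z := rfl
  rw [hv, hd1, hd2, ← metricForm_apply, christoffel_eq g hhz]
  simp only [map_add, add_apply]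
  have e1 := metricForm_symm g q (h z) (fderiv ℝ (fderiv ℝ h) z w (deriv c t))
    (fderiv ℝ h z (deriv c t))
  have e2 := hsymm w (deriv c t)
  rw [e2] at h0 e1
  rw [e1] at h0
  linarith

/-! ### Geodesics -/

theorem IsGeodesicOn.mono {g : Metric d M} {γ : ℝ → M} {s u : Set ℝ} (h : IsGeodesicOn g γ s)
    (hu : u ⊆ s) : IsGeodesicOn g γ u :=
  ⟨h.1.mono hu, fun t ht => h.2 t (hu ht)⟩

theorem IsGeodesicOn.contMDiffAt {g : Metric d M} {γ : ℝ → M} {s : Set ℝ}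
    (h : IsGeodesicOn g γ s) (hs : IsOpen s) {t : ℝ} (ht : t ∈ s) :
    ContMDiffAt 𝓘(ℝ, ℝ) (𝓡 (d + 1)) 2 γ t := h.1.contMDiffAt (hs.mem_nhds ht)

theorem IsGeodesicOn.contDiffAt_coord {g : Metric d M} {γ : ℝ → M} {s : Set ℝ}
    (h : IsGeodesicOn g γ s) (hs : IsOpen s) {t : ℝ} (ht : t ∈ s) {p : M}
    (hp : γ t ∈ (extChartAt (𝓡 (d + 1)) p).source) :
    ContDiffAt ℝ 2 (fun r => extChartAt (𝓡 (d + 1)) p (γ r)) t := by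
  rw [← contMDiffAt_iff_contDiffAt]
  have h1 : ContMDiffAt (𝓡 (d + 1)) 𝓘(ℝ, Model d) 2 (extChartAt (𝓡 (d + 1)) p) (γ t) :=
    (contMDiffAt_extChartAt' (n := ∞) (by rwa [extChartAt_source] at hp)).of_le ENat.LEInfty.out
  exact h1.comp t (h.contMDiffAt hs ht)

theorem IsGeodesicOn.geodesicEqAt {g : Metric d M} {γ : ℝ → M} {s : Set ℝ}
    (h : IsGeodesicOn g γ s) {t : ℝ} (ht : t ∈ s) {p : M}
    (hp : γ t ∈ (extChartAt (𝓡 (d + 1)) p).source) :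
    GeodesicEqAt g p (fun r => extChartAt (𝓡 (d + 1)) p (γ r)) t :=
  h.2 t ht p (by rwa [extChartAt_source] at hp)

theorem IsGeodesicOn.congr {g : Metric d M} {γ γ' : ℝ → M} {s : Set ℝ} (hs : IsOpen s)
    (h : IsGeodesicOn g γ s) (he : EqOn γ' γ s) : IsGeodesicOn g γ' s := by
  refine ⟨h.1.congr he, fun t ht p hp w => ?_⟩
  have h1 : (fun r => extChartAt (𝓡 (d + 1)) p (γ' r)) =ᶠ[𝓝 t]
      fun r => extChartAt (𝓡 (d + 1)) p (γ r) := by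
    filter_upwards [hs.mem_nhds ht] with r hr
    rw [he hr]
  have h2 := h.2 t ht p (by rwa [he ht] at hp) w
  simp only [h1.deriv.deriv_eq, h1.deriv_eq, he ht]
  exact h2

theorem IsGeodesicOn.union {g : Metric d M} {γ : ℝ → M} {s u : Set ℝ} (hs : IsOpen s)
    (hu : IsOpen u) (h : IsGeodesicOn g γ s) (h' : IsGeodesicOn g γ u) :
    IsGeodesicOn g γ (s ∪ u) :=
  ⟨h.1.union_of_isOpen h'.1 hs hu, fun t ht => ht.elim (h.2 t) (h'.2 t)⟩

theorem stateCoord_stateAt {γ : ℝ → M} {t : ℝ} {p : M}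
    (hγ : MDifferentiableAt 𝓘(ℝ, ℝ) (𝓡 (d + 1)) γ t)
    (hp : γ t ∈ (extChartAt (𝓡 (d + 1)) p).source) :
    stateCoord p (stateAt (d := d) γ t) = (extChartAt (𝓡 (d + 1)) p (γ t),
      deriv (fun r => extChartAt (𝓡 (d + 1)) p (γ r)) t) := by
  refine Prod.ext rfl ?_
  have h1 := mfderiv_comp t (mdifferentiableAt_extChartAt (I := 𝓡 (d + 1)) (x := p)
    (by rwa [extChartAt_source] at hp)) hγ
  have h2 := congrArg (fun A => A (1 : ℝ)) h1
  have h3 : deriv (fun r => extChartAt (𝓡 (d + 1)) p (γ r)) t =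
      mfderiv 𝓘(ℝ, ℝ) 𝓘(ℝ, Model d) (extChartAt (𝓡 (d + 1)) p ∘ γ) t (1 : ℝ) := by
    rw [mfderiv_eq_fderiv]
    rfl
  exact (h3.trans h2).symm

/-- The vector field of the geodesic flow in the chart at `p`. -/
def geodesicField (g : Metric d M) (p : M) (q : Model d × Model d) : Model d × Model d :=
  (q.2, geodesicAccel g p q)

theorem contDiffAt_geodesicField (g : Metric d M) {p : M} {q : Model d × Model d}
    (hq : q.1 ∈ (extChartAt (𝓡 (d + 1)) p).target) : ContDiffAt ℝ ∞ (geodesicField g p) q :=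
  contDiffAt_snd.prodMk (contDiffAt_geodesicAccel g hq)

theorem IsGeodesicOn.eventually_stateCoord {g : Metric d M} {γ : ℝ → M} {s : Set ℝ}
    (h : IsGeodesicOn g γ s) (hs : IsOpen s) {t : ℝ} (ht : t ∈ s) {p : M}
    (hp : γ t ∈ (extChartAt (𝓡 (d + 1)) p).source) :
    ∀ᶠ r in 𝓝 t, r ∈ s ∧ γ r ∈ (extChartAt (𝓡 (d + 1)) p).source ∧
      stateCoord p (stateAt (d := d) γ r) = (extChartAt (𝓡 (d + 1)) p (γ r),
      deriv (fun r => extChartAt (𝓡 (d + 1)) p (γ r)) r) := by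
  filter_upwards [hs.mem_nhds ht, (h.contMDiffAt hs ht).continuousAt.eventually
    ((isOpen_extChartAt_source (I := 𝓡 (d + 1)) p).mem_nhds hp)] with r hr hr'
  exact ⟨hr, hr', stateCoord_stateAt ((h.contMDiffAt hs hr).mdifferentiableAt (by simp)) hr'⟩

/-- In a chart, the states of a geodesic follow the geodesic vector field. -/
theorem IsGeodesicOn.hasDerivAt_stateCoord {g : Metric d M} {γ : ℝ → M} {s : Set ℝ}
    (h : IsGeodesicOn g γ s) (hs : IsOpen s) {t : ℝ} (ht : t ∈ s) {p : M}
    (hp : γ t ∈ (extChartAt (𝓡 (d + 1)) p).source) :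
    HasDerivAt (fun r => stateCoord p (stateAt (d := d) γ r))
      (geodesicField g p (stateCoord p (stateAt (d := d) γ t))) t := by
  have hev := h.eventually_stateCoord hs ht hp
  have h0 := hev.self_of_nhds.2.2
  have hc := h.contDiffAt_coord hs ht hp
  set c := fun r => extChartAt (𝓡 (d + 1)) p (γ r)
  have hdc : HasDerivAt c (deriv c t) t := (hc.differentiableAt (by simp)).hasDerivAt
  have hddc : HasDerivAt (deriv c) (deriv (deriv c) t) t := by
    have h1 : ContDiffAt ℝ 1 (deriv c) t := by
      have : ContDiffAt ℝ 1 (fderiv ℝ c) t := hc.fderiv_right (by norm_num)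
      exact this.clm_apply contDiffAt_const
    exact (h1.differentiableAt (by simp)).hasDerivAt
  rw [(geodesicEqAt_iff g ((extChartAt (𝓡 (d + 1)) p).map_source hp)).1
    (h.geodesicEqAt ht hp)] at hddc
  rw [h0]
  refine (hdc.prodMk hddc).congr_of_eventuallyEq ?_
  filter_upwards [hev] with r hr
  exact hr.2.2

theorem IsGeodesicOn.continuousAt_stateAt {g : Metric d M} {γ : ℝ → M} {s : Set ℝ}
    (h : IsGeodesicOn g γ s) (hs : IsOpen s) {t : ℝ} (ht : t ∈ s) :
    ContinuousAt (stateAt (d := d) γ) t := by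
  have hp : γ t ∈ (extChartAt (𝓡 (d + 1)) (γ t)).source := mem_extChartAt_source _
  have h1 := (h.hasDerivAt_stateCoord hs ht hp).continuousAt
  have h2 : ContinuousAt (chartState (γ t)) (stateCoord (γ t) (stateAt (d := d) γ t)) :=
    (contMDiffAt_chartState ((extChartAt (𝓡 (d + 1)) (γ t)).map_source hp)).continuousAt
  refine (h2.comp (f := fun r => stateCoord (γ t) (stateAt (d := d) γ r)) h1).congr ?_
  filter_upwards [h.eventually_stateCoord hs ht hp] with r hr
  exact chartState_stateCoord hr.2.1

/-- Integral curves of the geodesic vector field in a chart are geodesics. -/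
theorem isGeodesicOn_of_hasDerivAt {g : Metric d M} {p : M} {Y : ℝ → Model d × Model d}
    {s : Set ℝ} (hs : IsOpen s) (hY : ∀ t ∈ s, (Y t).1 ∈ (extChartAt (𝓡 (d + 1)) p).target)
    (hd : ∀ t ∈ s, HasDerivAt Y (geodesicField g p (Y t)) t) :
    IsGeodesicOn g (fun t => (chartState p (Y t)).proj) s ∧
      ∀ t ∈ s, stateAt (d := d) (fun t => (chartState p (Y t)).proj) t = chartState p (Y t) := by
  have hd1 : ∀ t ∈ s, HasDerivAt (fun t => (Y t).1) (Y t).2 t := fun t ht =>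
    (hd t ht).fst
  have hd2 : ∀ t ∈ s, HasDerivAt (fun t => (Y t).2) (geodesicAccel g p (Y t)) t := fun t ht =>
    (hd t ht).snd
  have hYc : ContinuousOn Y s := fun t ht => (hd t ht).continuousAt.continuousWithinAt
  have hc1 : ContDiffOn ℝ 1 (fun t => (Y t).2) s := by
    rw [show (1 : WithTop ℕ∞) = 0 + 1 by norm_num, contDiffOn_succ_iff_deriv_of_isOpen hs]
    refine ⟨fun t ht => (hd2 t ht).differentiableAt.differentiableWithinAt, by simp, ?_⟩
    rw [contDiffOn_zero]
    have : ContinuousOn (fun t => geodesicAccel g p (Y t)) s := fun t ht =>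
      (ContinuousAt.comp (f := Y) (contDiffAt_geodesicAccel g (hY t ht)).continuousAt
        (hd t ht).continuousAt).continuousWithinAt
    exact this.congr fun t ht => (hd2 t ht).deriv
  have hc2 : ContDiffOn ℝ 2 (fun t => (Y t).1) s := by
    rw [show (2 : WithTop ℕ∞) = 1 + 1 by norm_num, contDiffOn_succ_iff_deriv_of_isOpen hs]
    refine ⟨fun t ht => (hd1 t ht).differentiableAt.differentiableWithinAt, by simp, ?_⟩
    exact hc1.congr fun t ht => (hd1 t ht).deriv
  have hγ : ContMDiffOn 𝓘(ℝ, ℝ) (𝓡 (d + 1)) 2 (fun t => (chartState p (Y t)).proj) s := by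
    have h1 := (contMDiffOn_extChartAt_symm (I := 𝓡 (d + 1)) (n := ∞) p).of_le
      (ENat.LEInfty.out : 2 ≤ (∞ : WithTop ℕ∞))
    exact h1.comp hc2.contMDiffOn fun t ht => hY t ht
  have hsrc : ∀ t ∈ s, (chartState p (Y t)).proj ∈ (extChartAt (𝓡 (d + 1)) p).source :=
    fun t ht => (extChartAt (𝓡 (d + 1)) p).map_target (hY t ht)
  have hcoord : ∀ t ∈ s, extChartAt (𝓡 (d + 1)) p (chartState p (Y t)).proj = (Y t).1 :=
    fun t ht => (extChartAt (𝓡 (d + 1)) p).right_inv (hY t ht)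
  have hderiv1 : ∀ t ∈ s, deriv (fun t => (Y t).1) =ᶠ[𝓝 t] fun t => (Y t).2 := fun t ht => by
    filter_upwards [hs.mem_nhds ht] with r hr
    exact (hd1 r hr).deriv
  refine ⟨⟨hγ, fun t ht q hq => ?_⟩, fun t ht => ?_⟩
  · have h1 : GeodesicEqAt g p (fun t => (Y t).1) t := by
      rw [geodesicEqAt_iff g (hY t ht), (hderiv1 t ht).deriv_eq, (hd2 t ht).deriv,
        (hd1 t ht).deriv]
    have hq' : (extChartAt (𝓡 (d + 1)) p).symm (Y t).1 ∈ (extChartAt (𝓡 (d + 1)) q).source := by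
      rw [extChartAt_source]
      exact hq
    have h2 : GeodesicEqAt g q (transition p q ∘ fun t => (Y t).1) t :=
      h1.comp_transition (hc2.contDiffAt (hs.mem_nhds ht)) (hY t ht) hq'
    exact h2
  · have h1 := stateCoord_stateAt ((hγ.contMDiffAt (hs.mem_nhds ht)).mdifferentiableAt (by simp))
      (hsrc t ht)
    have h2 : (fun r => extChartAt (𝓡 (d + 1)) p (chartState p (Y r)).proj) =ᶠ[𝓝 t]
        fun r => (Y r).1 := by
      filter_upwards [hs.mem_nhds ht] with r hr
      exact hcoord r hr
    rw [h2.deriv_eq, (hd1 t ht).deriv, hcoord t ht] at h1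
    rw [← chartState_stateCoord (p := p)
      (ζ := stateAt (d := d) (fun t => (chartState p (Y t)).proj) t) (hsrc t ht), h1]

theorem christoffel_smul (g : Metric d M) {p : M} {z : Model d}
    (hz : z ∈ (extChartAt (𝓡 (d + 1)) p).target) (σ : ℝ) (v w : Model d) :
    christoffel g p z (σ • v) (σ • v) w = σ ^ 2 * christoffel g p z v v w := by
  simp only [christoffel_eq g hz, map_smul, smul_apply, smul_eq_mul]
  ring

/-- Affine changes of time turn geodesics into geodesics. -/
theorem IsGeodesicOn.comp_affine {g : Metric d M} {γ : ℝ → M} {s : Set ℝ}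
    (h : IsGeodesicOn g γ s) (a σ : ℝ) :
    IsGeodesicOn g (fun r => γ (a + σ * r)) {r | a + σ * r ∈ s} := by
  have hlin : ContMDiff 𝓘(ℝ, ℝ) 𝓘(ℝ, ℝ) 2 fun r : ℝ => a + σ * r := by
    rw [contMDiff_iff_contDiff]
    fun_prop
  refine ⟨h.1.comp hlin.contMDiffOn fun r hr => hr, fun t ht p hp w => ?_⟩
  have hp' : γ (a + σ * t) ∈ (extChartAt (𝓡 (d + 1)) p).source := by rwa [extChartAt_source]
  have h0 := h.geodesicEqAt ht hp' w
  set c := fun r => extChartAt (𝓡 (d + 1)) p (γ r)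
  have hd : ∀ f : ℝ → Model d, deriv (fun r => f (a + σ * r)) =
      fun r => σ • deriv f (a + σ * r) := fun f => by
    funext r
    have h1 := deriv_comp_mul_left σ (fun x => f (a + x)) r
    rw [h1, deriv_comp_const_add]
  have hd1 : deriv (fun r => c (a + σ * r)) = fun r => σ • deriv c (a + σ * r) := hd c
  have hd2 : deriv (deriv (fun r => c (a + σ * r))) t =
      σ ^ 2 • deriv (deriv c) (a + σ * t) := by
    rw [hd1]
    have h3 := congrFun (hd (deriv c)) t
    have h4 : deriv (fun r => σ • deriv c (a + σ * r)) t =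
        σ • deriv (fun r => deriv c (a + σ * r)) t := by
      exact deriv_const_smul_field σ (fun r => deriv c (a + σ * r))
    rw [h4, h3, smul_smul, pow_two]
  change metricInChart g p (c (a + σ * t)) (deriv (deriv fun r => c (a + σ * r)) t) w
    + christoffel g p (c (a + σ * t)) (deriv (fun r => c (a + σ * r)) t)
      (deriv (fun r => c (a + σ * r)) t) w = 0
  rw [hd2, hd1, christoffel_smul g ((extChartAt (𝓡 (d + 1)) p).map_source hp'),
    ← metricForm_apply, map_smul, smul_apply, smul_eq_mul, metricForm_apply, ← mul_add, h0,
    mul_zero]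

theorem stateAt_comp_affine {γ : ℝ → M} (a σ r : ℝ)
    (hγ : MDifferentiableAt 𝓘(ℝ, ℝ) (𝓡 (d + 1)) γ (a + σ * r)) :
    stateAt (d := d) (fun r => γ (a + σ * r)) r =
      ⟨(stateAt (d := d) γ (a + σ * r)).proj, σ • (stateAt (d := d) γ (a + σ * r)).snd⟩ := by
  have h0 : HasDerivAt (fun r : ℝ => a + σ * r) σ r := by
    simpa using ((hasDerivAt_id r).const_mul σ).const_add a
  have h1 : HasMFDerivAt 𝓘(ℝ, ℝ) 𝓘(ℝ, ℝ) (fun r : ℝ => a + σ * r) r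
    (ContinuousLinearMap.toSpanSingleton ℝ σ) := h0.hasFDerivAt.hasMFDerivAt
  have h2 := HasMFDerivAt.comp r (hγ.hasMFDerivAt) h1
  have h3 := congrArg (fun A => A (1 : ℝ)) h2.mfderiv
  refine congrArg (Bundle.TotalSpace.mk (γ (a + σ * r))) (h3.trans ?_)
  have h4 : (ContinuousLinearMap.toSpanSingleton ℝ σ : ℝ →L[ℝ] ℝ) (1 : ℝ) = σ • (1 : ℝ) := by simp
  refine (congrArg (mfderiv 𝓘(ℝ, ℝ) (𝓡 (d + 1)) γ (a + σ * r)) h4).trans ?_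
  exact map_smul (mfderiv 𝓘(ℝ, ℝ) (𝓡 (d + 1)) γ (a + σ * r)) σ (1 : ℝ)

/-- Two geodesics that have the same state at one time have the same state at nearby times. -/
theorem IsGeodesicOn.eventually_stateAt_eq {g : Metric d M} {γ₁ γ₂ : ℝ → M} {s : Set ℝ}
    (hs : IsOpen s) (h₁ : IsGeodesicOn g γ₁ s) (h₂ : IsGeodesicOn g γ₂ s) {t : ℝ} (ht : t ∈ s)
    (he : stateAt (d := d) γ₁ t = stateAt (d := d) γ₂ t) : ∀ᶠ r in 𝓝 t, stateAt (d := d) γ₁ r = stateAt (d := d) γ₂ r := by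
  have hγ : γ₁ t = γ₂ t := congrArg Bundle.TotalSpace.proj he
  have hp₁ : γ₁ t ∈ (extChartAt (𝓡 (d + 1)) (γ₁ t)).source := mem_extChartAt_source _
  have hp₂ : γ₂ t ∈ (extChartAt (𝓡 (d + 1)) (γ₁ t)).source := hγ ▸ hp₁
  set p := γ₁ t
  have htgt : (stateCoord p (stateAt (d := d) γ₁ t)).1 ∈ (extChartAt (𝓡 (d + 1)) p).target :=
    (extChartAt (𝓡 (d + 1)) p).map_source hp₁
  obtain ⟨K, U, hU, hK⟩ := ((contDiffAt_geodesicField g htgt).of_le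
    (ENat.LEInfty.out : 1 ≤ (∞ : WithTop ℕ∞))).exists_lipschitzOnWith
  have key : ∀ {γ : ℝ → M}, IsGeodesicOn g γ s → γ t ∈ (extChartAt (𝓡 (d + 1)) p).source →
      stateAt (d := d) γ₁ t = stateAt (d := d) γ t → ∀ᶠ r in 𝓝 t,
      HasDerivAt (fun r => stateCoord p (stateAt (d := d) γ r))
        (geodesicField g p (stateCoord p (stateAt (d := d) γ r))) r ∧ stateCoord p (stateAt (d := d) γ r) ∈ U := by
    intro γ h hp he'
    have h1 := (h.hasDerivAt_stateCoord hs ht hp).continuousAt.eventually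
      (p := fun y => y ∈ U) (by simp only [← he']; exact hU)
    filter_upwards [h.eventually_stateCoord hs ht hp, h1] with r hr hr'
    exact ⟨h.hasDerivAt_stateCoord hs hr.1 hr.2.1, hr'⟩
  have := ODE_solution_unique_of_eventually (v := fun _ => geodesicField g p) (s := fun _ => U)
    (K := K) (Eventually.of_forall fun _ => hK) (key h₁ hp₁ rfl) (key h₂ hp₂ he)
    (congrArg (stateCoord p) he)
  filter_upwards [this, h₁.eventually_stateCoord hs ht hp₁,
    h₂.eventually_stateCoord hs ht hp₂] with r hr hr1 hr2
  rw [← chartState_stateCoord (p := p) (ζ := stateAt (d := d) γ₁ r) hr1.2.1, hr,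
    chartState_stateCoord (p := p) (ζ := stateAt (d := d) γ₂ r) hr2.2.1]

/-- A geodesic is determined by its state at one time. -/
theorem IsGeodesicOn.stateAt_eq [T2Space M] {g : Metric d M} {γ₁ γ₂ : ℝ → M} {a b t₀ : ℝ}
    (h₁ : IsGeodesicOn g γ₁ (Ioo a b)) (h₂ : IsGeodesicOn g γ₂ (Ioo a b)) (ht₀ : t₀ ∈ Ioo a b)
    (he : stateAt (d := d) γ₁ t₀ = stateAt (d := d) γ₂ t₀) : ∀ t ∈ Ioo a b, stateAt (d := d) γ₁ t = stateAt (d := d) γ₂ t := by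
  let u : Set ℝ := {t | t ∈ Ioo a b ∧ stateAt (d := d) γ₁ t = stateAt (d := d) γ₂ t}
  have hu : IsOpen u := by
    rw [isOpen_iff_mem_nhds]
    rintro t ⟨ht, hte⟩
    filter_upwards [isOpen_Ioo.mem_nhds ht,
      h₁.eventually_stateAt_eq isOpen_Ioo h₂ ht hte] with r hr hr'
    exact ⟨hr, hr'⟩
  have hsub := isPreconnected_Ioo.subset_of_closure_inter_subset hu ⟨t₀, ht₀, ht₀, he⟩ ?_
  · exact fun t ht => (hsub ht).2
  · rintro t ⟨htc, ht⟩
    refine ⟨ht, ?_⟩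
    have hfreq : ∃ᶠ r in 𝓝 t, stateAt (d := d) γ₁ r = stateAt (d := d) γ₂ r :=
      (mem_closure_iff_frequently.1 htc).mono fun r hr => hr.2
    have hγ : γ₁ t = γ₂ t :=
      tendsto_nhds_unique_of_frequently_eq (h₁.contMDiffAt isOpen_Ioo ht).continuousAt
        (h₂.contMDiffAt isOpen_Ioo ht).continuousAt
        (hfreq.mono fun r hr => congrArg Bundle.TotalSpace.proj hr)
    have hp₁ : γ₁ t ∈ (extChartAt (𝓡 (d + 1)) (γ₁ t)).source := mem_extChartAt_source _
    have hp₂ : γ₂ t ∈ (extChartAt (𝓡 (d + 1)) (γ₁ t)).source := hγ ▸ hp₁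
    have := tendsto_nhds_unique_of_frequently_eq
      (h₁.hasDerivAt_stateCoord isOpen_Ioo ht hp₁).continuousAt
      (h₂.hasDerivAt_stateCoord isOpen_Ioo ht hp₂).continuousAt
      (hfreq.mono fun r hr => congrArg (stateCoord (γ₁ t)) hr)
    simp only at this
    rw [← chartState_stateCoord (p := γ₁ t) (ζ := stateAt (d := d) γ₁ t) hp₁, this,
      chartState_stateCoord (p := γ₁ t) (ζ := stateAt (d := d) γ₂ t) hp₂]

/-! ### The geodesic flow -/

/-- The geodesic with initial state `ζ` is defined up to time `t` and has state `ζ'` there. The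
time `t` may be negative. -/
def GeodesicReaches (g : Metric d M) (t : ℝ) (ζ ζ' : TangentBundle (𝓡 (d + 1)) M) : Prop :=
  ∃ (γ : ℝ → M) (a b : ℝ), (0 : ℝ) ∈ Ioo a b ∧ t ∈ Ioo a b ∧ IsGeodesicOn g γ (Ioo a b) ∧
    stateAt γ 0 = ζ ∧ stateAt γ t = ζ'

theorem IsGeodesicOn.reaches {g : Metric d M} {γ : ℝ → M} {a b t : ℝ}
    (h : IsGeodesicOn g γ (Ioo a b)) (h0 : (0 : ℝ) ∈ Ioo a b) (ht : t ∈ Ioo a b) :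
    GeodesicReaches g t (stateAt γ 0) (stateAt γ t) := ⟨γ, a, b, h0, ht, h, rfl, rfl⟩

open Classical in
/-- The geodesic flow; it is the identity where the geodesic does not exist for long enough. -/
def geodesicFlow (g : Metric d M) (t : ℝ) (ζ : TangentBundle (𝓡 (d + 1)) M) :
    TangentBundle (𝓡 (d + 1)) M :=
  if h : ∃ ζ', GeodesicReaches g t ζ ζ' then h.choose else ζ

section

variable [T2Space M]

theorem IsGeodesicOn.stateAt_eq_of_eq {g : Metric d M} {γ₁ γ₂ : ℝ → M} {a₁ b₁ a₂ b₂ t₀ t : ℝ}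
    (h₁ : IsGeodesicOn g γ₁ (Ioo a₁ b₁)) (h₂ : IsGeodesicOn g γ₂ (Ioo a₂ b₂))
    (ht₁ : t₀ ∈ Ioo a₁ b₁) (ht₂ : t₀ ∈ Ioo a₂ b₂) (he : stateAt (d := d) γ₁ t₀ = stateAt γ₂ t₀)
    (ht₁' : t ∈ Ioo a₁ b₁) (ht₂' : t ∈ Ioo a₂ b₂) : stateAt (d := d) γ₁ t = stateAt γ₂ t := by
  refine IsGeodesicOn.stateAt_eq (g := g) (a := max a₁ a₂) (b := min b₁ b₂) (t₀ := t₀)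
    (h₁.mono (Ioo_subset_Ioo (le_max_left _ _) (min_le_left _ _)))
    (h₂.mono (Ioo_subset_Ioo (le_max_right _ _) (min_le_right _ _))) ?_ he t ?_
  · exact ⟨max_lt ht₁.1 ht₂.1, lt_min ht₁.2 ht₂.2⟩
  · exact ⟨max_lt ht₁'.1 ht₂'.1, lt_min ht₁'.2 ht₂'.2⟩

theorem GeodesicReaches.unique {g : Metric d M} {t : ℝ} {ζ ζ₁ ζ₂ : TangentBundle (𝓡 (d + 1)) M}
    (h₁ : GeodesicReaches g t ζ ζ₁) (h₂ : GeodesicReaches g t ζ ζ₂) : ζ₁ = ζ₂ := by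
  obtain ⟨γ₁, a₁, b₁, h01, ht1, hg1, hs1, he1⟩ := h₁
  obtain ⟨γ₂, a₂, b₂, h02, ht2, hg2, hs2, he2⟩ := h₂
  rw [← he1, ← he2]
  exact hg1.stateAt_eq_of_eq hg2 h01 h02 (hs1.trans hs2.symm) ht1 ht2

theorem geodesicFlow_eq {g : Metric d M} {t : ℝ} {ζ ζ' : TangentBundle (𝓡 (d + 1)) M}
    (h : GeodesicReaches g t ζ ζ') : geodesicFlow g t ζ = ζ' := by
  have hex : ∃ ζ', GeodesicReaches g t ζ ζ' := ⟨ζ', h⟩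
  rw [geodesicFlow, dif_pos hex]
  exact hex.choose_spec.unique h

/-- The states of a curve depend on the curve near the time only. -/
theorem stateAt_congr {γ₁ γ₂ : ℝ → M} {t : ℝ} (h : γ₁ =ᶠ[𝓝 t] γ₂) :
    stateAt (d := d) γ₁ t = stateAt (d := d) γ₂ t := by
  have h1 := h.mfderiv_eq (I := 𝓘(ℝ, ℝ)) (I' := 𝓡 (d + 1))
  have h0 := h.self_of_nhds
  unfold stateAt
  generalize γ₁ t = x at h0 h1 ⊢
  subst h0
  exact congrArg (fun A : ℝ →L[ℝ] TangentSpace (𝓡 (d + 1)) (γ₂ t) =>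
    (⟨γ₂ t, A 1⟩ : TangentBundle (𝓡 (d + 1)) M)) h1

/-- Geodesics may be concatenated when the states match. -/
theorem GeodesicReaches.trans {g : Metric d M} {s t : ℝ} {ζ ζ' ζ'' : TangentBundle (𝓡 (d + 1)) M}
    (h₁ : GeodesicReaches g s ζ ζ') (h₂ : GeodesicReaches g t ζ' ζ'') :
    GeodesicReaches g (s + t) ζ ζ'' := by
  classical
  obtain ⟨γ₁, a₁, b₁, h01, hs1, hg1, rfl, rfl⟩ := h₁
  obtain ⟨γ₂', a₂', b₂', h02', ht2', hg2', he2', rfl⟩ := h₂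
  -- The second geodesic, shifted in time so that the states match at `s`.
  obtain ⟨γ₂, a₂, b₂, hs2, hst2, hg2, he2, hf2⟩ : ∃ (γ₂ : ℝ → M) (a₂ b₂ : ℝ), s ∈ Ioo a₂ b₂ ∧
      s + t ∈ Ioo a₂ b₂ ∧ IsGeodesicOn g γ₂ (Ioo a₂ b₂) ∧ stateAt (d := d) γ₂ s = stateAt γ₁ s ∧
      stateAt (d := d) γ₂ (s + t) = stateAt γ₂' t := by
    have hset : {r : ℝ | -s + 1 * r ∈ Ioo a₂' b₂'} = Ioo (a₂' + s) (b₂' + s) := by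
      ext r
      change (a₂' < -s + 1 * r ∧ -s + 1 * r < b₂') ↔ (a₂' + s < r ∧ r < b₂' + s)
      constructor <;> rintro ⟨h1, h2⟩ <;> constructor <;> linarith
    have hst : ∀ r, -s + 1 * r ∈ Ioo a₂' b₂' → stateAt (d := d) (fun r => γ₂' (-s + 1 * r)) r =
        stateAt (d := d) γ₂' (-s + 1 * r) := fun r hr => by
      rw [stateAt_comp_affine _ _ _ ((hg2'.contMDiffAt isOpen_Ioo hr).mdifferentiableAt (by simp))]
      rw [one_smul]
    have e1 : -s + 1 * s = 0 := by ring
    have e2 : -s + 1 * (s + t) = t := by ring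
    refine ⟨fun r => γ₂' (-s + 1 * r), a₂' + s, b₂' + s, ?_, ?_, hset ▸ hg2'.comp_affine (-s) 1,
      ?_, ?_⟩
    · constructor <;> linarith [h02'.1, h02'.2]
    · constructor <;> linarith [ht2'.1, ht2'.2]
    · rw [hst s (by rwa [e1]), e1, he2']
    · rw [hst (s + t) (by rwa [e2]), e2]
  let γ : ℝ → M := fun r => if r ∈ Ioo a₁ b₁ then γ₁ r else γ₂ r
  have he1 : EqOn γ γ₁ (Ioo a₁ b₁) := fun r hr => if_pos hr
  have he2' : EqOn γ γ₂ (Ioo a₂ b₂) := fun r hr => by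
    by_cases h : r ∈ Ioo a₁ b₁
    · rw [he1 h]
      exact congrArg Bundle.TotalSpace.proj (hg1.stateAt_eq_of_eq hg2 hs1 hs2 he2.symm h hr)
    · exact if_neg h
  have hat1 : ∀ r ∈ Ioo a₁ b₁, stateAt (d := d) γ r = stateAt γ₁ r := fun r hr =>
    stateAt_congr (Filter.eventuallyEq_of_mem (isOpen_Ioo.mem_nhds hr) he1)
  have hat2 : ∀ r ∈ Ioo a₂ b₂, stateAt (d := d) γ r = stateAt γ₂ r := fun r hr =>
    stateAt_congr (Filter.eventuallyEq_of_mem (isOpen_Ioo.mem_nhds hr) he2')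
  have hun : Ioo (min a₁ a₂) (max b₁ b₂) ⊆ Ioo a₁ b₁ ∪ Ioo a₂ b₂ := by
    rintro r ⟨hr1, hr2⟩
    rcases lt_or_ge r s with h | h
    · rcases min_lt_iff.1 hr1 with h' | h'
      · exact Or.inl ⟨h', h.trans hs1.2⟩
      · exact Or.inr ⟨h', h.trans hs2.2⟩
    · rcases lt_max_iff.1 hr2 with h' | h'
      · exact Or.inl ⟨hs1.1.trans_le h, h'⟩
      · exact Or.inr ⟨hs2.1.trans_le h, h'⟩
  refine ⟨γ, min a₁ a₂, max b₁ b₂, ?_, ?_, ?_, hat1 0 h01, (hat2 _ hst2).trans hf2⟩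
  · exact ⟨(min_le_left _ _).trans_lt h01.1, h01.2.trans_le (le_max_left _ _)⟩
  · exact ⟨(min_le_right _ _).trans_lt hst2.1, hst2.2.trans_le (le_max_right _ _)⟩
  · exact ((hg1.congr isOpen_Ioo he1).union isOpen_Ioo isOpen_Ioo
      (hg2.congr isOpen_Ioo he2')).mono hun

/-- The geodesic flow is defined and smooth for short times. -/
theorem eventually_geodesicFlow_zero (g : Metric d M) (ζ₀ : TangentBundle (𝓡 (d + 1)) M) :
    ∀ᶠ p in 𝓝 ((0 : ℝ), ζ₀), (∃ ζ', GeodesicReaches g p.1 p.2 ζ') ∧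
      ContMDiffAt (𝓘(ℝ, ℝ).prod (𝓡 (d + 1)).tangent) (𝓡 (d + 1)).tangent ∞
        (fun p : ℝ × TangentBundle (𝓡 (d + 1)) M => geodesicFlow g p.1 p.2) p := by
  have hp₀ : ζ₀.proj ∈ (extChartAt (𝓡 (d + 1)) ζ₀.proj).source := mem_extChartAt_source _
  set p₀ := ζ₀.proj
  have htgt : (stateCoord p₀ ζ₀).1 ∈ (extChartAt (𝓡 (d + 1)) p₀).target :=
    (extChartAt (𝓡 (d + 1)) p₀).map_source hp₀
  have htopen : ∀ q : Model d × Model d, q.1 ∈ (extChartAt (𝓡 (d + 1)) p₀).target →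
      ∀ᶠ q' in 𝓝 q, q'.1 ∈ (extChartAt (𝓡 (d + 1)) p₀).target := fun q hq =>
    ((isOpen_extChartAt_target (I := 𝓡 (d + 1)) p₀).preimage continuous_fst).mem_nhds hq
  obtain ⟨Φ, hΦ, hΦ0, hΦd⟩ := exists_smooth_flow (f := geodesicField g p₀)
    (x₀ := stateCoord p₀ ζ₀) ((htopen _ htgt).mono fun q hq => contDiffAt_geodesicField g hq)
  have hΦt : ∀ᶠ p in 𝓝 ((0 : ℝ), stateCoord p₀ ζ₀),
      (Φ p).1 ∈ (extChartAt (𝓡 (d + 1)) p₀).target := by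
    have := hΦ.self_of_nhds.continuousAt
    exact this.eventually (htopen _ (by rw [hΦ0]; exact htgt))
  obtain ⟨U, hU, V, hV, hUV⟩ := mem_nhds_prod_iff.1 (hΦ.and (hΦd.and hΦt))
  obtain ⟨δ, hδ, hδU⟩ := Metric.mem_nhds_iff.1 hU
  rw [Real.ball_eq_Ioo, zero_sub, zero_add] at hδU
  have h0δ : (0 : ℝ) ∈ Ioo (-δ) δ := ⟨by linarith, hδ⟩
  have hreach : ∀ t ∈ Ioo (-δ) δ, ∀ ζ : TangentBundle (𝓡 (d + 1)) M,
      ζ.proj ∈ (extChartAt (𝓡 (d + 1)) p₀).source → stateCoord p₀ ζ ∈ V →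
      GeodesicReaches g t ζ (chartState p₀ (Φ (t, stateCoord p₀ ζ))) := by
    intro t ht ζ hζ hζV
    have hall : ∀ r ∈ Ioo (-δ) δ, _ := fun r hr => @hUV (r, stateCoord p₀ ζ) ⟨hδU hr, hζV⟩
    obtain ⟨hgeo, hst⟩ := isGeodesicOn_of_hasDerivAt (g := g) (p := p₀)
      (Y := fun r => Φ (r, stateCoord p₀ ζ)) isOpen_Ioo (fun r hr => (hall r hr).2.2)
      (fun r hr => (hall r hr).2.1.2)
    have h0 : Φ (0, stateCoord p₀ ζ) = stateCoord p₀ ζ := (hall 0 h0δ).2.1.1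
    refine ⟨_, -δ, δ, h0δ, ht, hgeo, ?_, hst t ht⟩
    rw [hst 0 h0δ, h0, chartState_stateCoord hζ]
  have hcoord : ContMDiffAt (𝓡 (d + 1)).tangent 𝓘(ℝ, Model d × Model d) ∞ (stateCoord p₀) ζ₀ :=
    contMDiffAt_stateCoord hp₀
  have hW : ∀ᶠ ζ in 𝓝 ζ₀, ζ.proj ∈ (extChartAt (𝓡 (d + 1)) p₀).source ∧ stateCoord p₀ ζ ∈ V :=
    Filter.Eventually.and ((isOpen_proj_preimage_source p₀).mem_nhds hp₀)
      (hcoord.continuousAt.eventually hV)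
  have hev : ∀ᶠ p in 𝓝 ((0 : ℝ), ζ₀), p.1 ∈ Ioo (-δ) δ ∧
      p.2.proj ∈ (extChartAt (𝓡 (d + 1)) p₀).source ∧ stateCoord p₀ p.2 ∈ V := by
    rw [nhds_prod_eq]
    exact Filter.Eventually.prod_mk (isOpen_Ioo.mem_nhds h0δ) hW
  filter_upwards [eventually_eventually_nhds.2 hev] with p hp
  obtain ⟨hp1, hp2, hp3⟩ := hp.self_of_nhds
  refine ⟨⟨_, hreach p.1 hp1 p.2 hp2 hp3⟩, ?_⟩
  have hsm : ContMDiffAt (𝓘(ℝ, ℝ).prod (𝓡 (d + 1)).tangent) (𝓡 (d + 1)).tangent ∞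
      (fun p : ℝ × TangentBundle (𝓡 (d + 1)) M =>
        chartState p₀ (Φ (p.1, stateCoord p₀ p.2))) p := by
    have hpUV := @hUV (p.1, stateCoord p₀ p.2) ⟨hδU hp1, hp3⟩
    have h1 : ContMDiffAt (𝓘(ℝ, ℝ).prod (𝓡 (d + 1)).tangent) 𝓘(ℝ, ℝ × (Model d × Model d)) ∞
        (fun p : ℝ × TangentBundle (𝓡 (d + 1)) M => (p.1, stateCoord p₀ p.2)) p :=
      contMDiffAt_fst.prodMk_space ((contMDiffAt_stateCoord hp2).comp p contMDiffAt_snd)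
    have h2 : ContMDiffAt 𝓘(ℝ, ℝ × (Model d × Model d)) 𝓘(ℝ, Model d × Model d) ∞ Φ
        (p.1, stateCoord p₀ p.2) := hpUV.1.contMDiffAt
    have h3 : ContMDiffAt 𝓘(ℝ, Model d × Model d) (𝓡 (d + 1)).tangent ∞ (chartState p₀)
        (Φ (p.1, stateCoord p₀ p.2)) := contMDiffAt_chartState hpUV.2.2
    exact h3.comp p (h2.comp p h1)
  refine hsm.congr_of_eventuallyEq ?_
  filter_upwards [hp] with p' hp'
  exact geodesicFlow_eq (hreach p'.1 hp'.1 p'.2 hp'.2.1 hp'.2.2)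

/-- The domain of the geodesic flow is open, and the geodesic flow is smooth. -/
theorem GeodesicReaches.eventually {g : Metric d M} {T : ℝ}
    {ζ₀ ζ₁ : TangentBundle (𝓡 (d + 1)) M} (h : GeodesicReaches g T ζ₀ ζ₁) :
    ∀ᶠ p in 𝓝 (T, ζ₀), (∃ ζ', GeodesicReaches g p.1 p.2 ζ') ∧
      ContMDiffAt (𝓘(ℝ, ℝ).prod (𝓡 (d + 1)).tangent) (𝓡 (d + 1)).tangent ∞
        (fun p : ℝ × TangentBundle (𝓡 (d + 1)) M => geodesicFlow g p.1 p.2) p := by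
  obtain ⟨γ, a, b, h0, hT, hγ, rfl, rfl⟩ := h
  let Q : ℝ × TangentBundle (𝓡 (d + 1)) M → Prop := fun p =>
    (∃ ζ', GeodesicReaches g p.1 p.2 ζ') ∧
      ContMDiffAt (𝓘(ℝ, ℝ).prod (𝓡 (d + 1)).tangent) (𝓡 (d + 1)).tangent ∞
        (fun p : ℝ × TangentBundle (𝓡 (d + 1)) M => geodesicFlow g p.1 p.2) p
  let P : ℝ → Prop := fun t => ∀ᶠ p in 𝓝 (t, stateAt (d := d) γ 0), Q p
  have hstep : ∀ t ∈ Ioo a b, ∃ N ∈ 𝓝 t, ∀ t₁ ∈ N, ∀ t₂ ∈ N, P t₁ → P t₂ := by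
    intro t ht
    obtain ⟨U, hU, W, hW, hUW⟩ :=
      mem_nhds_prod_iff.1 (eventually_geodesicFlow_zero g (stateAt (d := d) γ t))
    obtain ⟨δ, hδ, hδU⟩ := Metric.mem_nhds_iff.1 hU
    refine ⟨Metric.ball t (δ / 2) ∩ (Ioo a b ∩ stateAt (d := d) γ ⁻¹' interior W),
      inter_mem (Metric.ball_mem_nhds _ (by positivity)) (inter_mem (isOpen_Ioo.mem_nhds ht)
        ((hγ.continuousAt_stateAt isOpen_Ioo ht).eventually (interior_mem_nhds.2 hW))), ?_⟩
    rintro t₁ ⟨ht1, ht1', ht1''⟩ t₂ ⟨ht2, ht2', ht2''⟩ hP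
    have hPself : Q (t₁, stateAt (d := d) γ 0) := hP.self_of_nhds
    have hflow : geodesicFlow g t₁ (stateAt (d := d) γ 0) = stateAt γ t₁ :=
      geodesicFlow_eq (hγ.reaches h0 ht1')
    have hcont : ContinuousAt (fun ζ => geodesicFlow g t₁ ζ) (stateAt (d := d) γ 0) :=
      ContinuousAt.comp (f := fun ζ : TangentBundle (𝓡 (d + 1)) M => (t₁, ζ))
        hPself.2.continuousAt (by fun_prop)
    have hζ : ∀ᶠ ζ in 𝓝 (stateAt (d := d) γ 0), Q (t₁, ζ) ∧ geodesicFlow g t₁ ζ ∈ interior W := by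
      have h1 : ∀ᶠ ζ in 𝓝 (stateAt (d := d) γ 0), Q (t₁, ζ) :=
        ((by fun_prop : Continuous fun ζ : TangentBundle (𝓡 (d + 1)) M =>
          (t₁, ζ)).tendsto (stateAt (d := d) γ 0)).eventually hP
      refine h1.and (hcont.eventually (isOpen_interior.mem_nhds ?_))
      simp only [hflow]
      exact ht1''
    have hdist : dist t₂ t₁ < δ := by
      have := dist_triangle_right t₂ t₁ t
      rw [Metric.mem_ball] at ht1 ht2
      linarith
    have ht : ∀ᶠ s in 𝓝 t₂, s - t₁ ∈ U := by
      have : ∀ᶠ s in 𝓝 t₂, dist s t₁ < δ :=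
        (continuous_id.dist continuous_const).continuousAt.eventually (gt_mem_nhds hdist)
      filter_upwards [this] with s hs
      refine hδU ?_
      rw [Metric.mem_ball, Real.dist_eq, sub_zero]
      rwa [Real.dist_eq] at hs
    have hev : ∀ᶠ p in 𝓝 (t₂, stateAt (d := d) γ 0), p.1 - t₁ ∈ U ∧ Q (t₁, p.2) ∧
        geodesicFlow g t₁ p.2 ∈ interior W := by
      rw [nhds_prod_eq]
      exact ht.prod_mk hζ
    have hcomp : ∀ p : ℝ × TangentBundle (𝓡 (d + 1)) M, p.1 - t₁ ∈ U ∧ Q (t₁, p.2) ∧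
        geodesicFlow g t₁ p.2 ∈ interior W →
        GeodesicReaches g p.1 p.2 (geodesicFlow g (p.1 - t₁) (geodesicFlow g t₁ p.2)) := by
      rintro p ⟨hp1, ⟨⟨ζ', hζ'⟩, -⟩, hp3⟩
      rw [geodesicFlow_eq hζ'] at hp3 ⊢
      obtain ⟨⟨ζ'', hζ''⟩, -⟩ := @hUW (p.1 - t₁, ζ') ⟨hp1, interior_subset hp3⟩
      rw [geodesicFlow_eq hζ'']
      have := hζ'.trans hζ''
      rwa [add_sub_cancel] at this
    change ∀ᶠ p in 𝓝 (t₂, stateAt (d := d) γ 0), Q p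
    filter_upwards [eventually_eventually_nhds.2 hev] with p hp
    refine ⟨⟨_, hcomp p hp.self_of_nhds⟩, ?_⟩
    have hsm : ContMDiffAt (𝓘(ℝ, ℝ).prod (𝓡 (d + 1)).tangent) (𝓡 (d + 1)).tangent ∞
        (fun p : ℝ × TangentBundle (𝓡 (d + 1)) M =>
          geodesicFlow g (p.1 - t₁) (geodesicFlow g t₁ p.2)) p := by
      obtain ⟨hp1, hp2, hp3⟩ := hp.self_of_nhds
      have h1 : ContMDiffAt (𝓘(ℝ, ℝ).prod (𝓡 (d + 1)).tangent) (𝓡 (d + 1)).tangent ∞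
          (fun p : ℝ × TangentBundle (𝓡 (d + 1)) M => geodesicFlow g t₁ p.2) p :=
        ContMDiffAt.comp p (f := fun p : ℝ × TangentBundle (𝓡 (d + 1)) M => (t₁, p.2)) hp2.2
          (contMDiffAt_const.prodMk contMDiffAt_snd)
      have h2 : ContMDiffAt (𝓘(ℝ, ℝ).prod (𝓡 (d + 1)).tangent) 𝓘(ℝ, ℝ) ∞
          (fun p : ℝ × TangentBundle (𝓡 (d + 1)) M => p.1 - t₁) p :=
        ContMDiffAt.comp p (g := fun s : ℝ => s - t₁)
          (contMDiffAt_iff_contDiffAt.2 (by fun_prop)) contMDiffAt_fst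
      have h3 := (@hUW (p.1 - t₁, geodesicFlow g t₁ p.2) ⟨hp1, interior_subset hp3⟩).2
      exact ContMDiffAt.comp p (f := fun p : ℝ × TangentBundle (𝓡 (d + 1)) M =>
        (p.1 - t₁, geodesicFlow g t₁ p.2)) h3 (h2.prodMk h1)
    refine hsm.congr_of_eventuallyEq ?_
    filter_upwards [hp] with p' hp'
    exact geodesicFlow_eq (hcomp p' hp')
  let u : Set ℝ := {t | t ∈ Ioo a b ∧ P t}
  have hu : IsOpen u := by
    rw [isOpen_iff_mem_nhds]
    rintro t ⟨ht, hPt⟩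
    obtain ⟨N, hN, hNP⟩ := hstep t ht
    filter_upwards [isOpen_Ioo.mem_nhds ht, hN] with r hr hr'
    exact ⟨hr, hNP t (mem_of_mem_nhds hN) r hr' hPt⟩
  have hsub := isPreconnected_Ioo.subset_of_closure_inter_subset hu
    ⟨0, h0, h0, eventually_geodesicFlow_zero g _⟩ ?_
  · exact (hsub hT).2
  · rintro t ⟨htc, ht⟩
    obtain ⟨N, hN, hNP⟩ := hstep t ht
    obtain ⟨r, hrN, hru⟩ := mem_closure_iff_nhds.1 htc N hN
    exact ⟨ht, hNP r hrN t (mem_of_mem_nhds hN) hru.2⟩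

end

/-! ### The first variation formula -/

section

variable {E F : Type*} [NormedAddCommGroup E] [NormedSpace ℝ E] [NormedAddCommGroup F]
  [NormedSpace ℝ F]

theorem hasFDerivAt_bilin_fderiv {G : E → E →L[ℝ] E →L[ℝ] ℝ} {c : F → E} {p : F}
    (hG : DifferentiableAt ℝ G (c p)) (hc : ContDiffAt ℝ 2 c p) (a b : F) :
    ∃ L : F →L[ℝ] ℝ, HasFDerivAt (fun q => G (c q) (fderiv ℝ c q a) (fderiv ℝ c q b)) L p ∧
      ∀ ξ, L ξ = fderiv ℝ G (c p) (fderiv ℝ c p ξ) (fderiv ℝ c p a) (fderiv ℝ c p b)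
        + G (c p) (fderiv ℝ (fderiv ℝ c) p ξ a) (fderiv ℝ c p b)
        + G (c p) (fderiv ℝ c p a) (fderiv ℝ (fderiv ℝ c) p ξ b) := by
  have h1 : HasFDerivAt (fderiv ℝ c) (fderiv ℝ (fderiv ℝ c) p) p :=
    ((hc.fderiv_right (m := 1) (by norm_num)).differentiableAt (by simp)).hasFDerivAt
  have h2 : HasFDerivAt c (fderiv ℝ c p) p := (hc.differentiableAt (by simp)).hasFDerivAt
  have h3 : HasFDerivAt (G ∘ c) (fderiv ℝ G (c p) ∘L fderiv ℝ c p) p :=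
    HasFDerivAt.comp (g := G) p hG.hasFDerivAt h2
  refine ⟨_, (h3.clm_apply (h1.clm_apply (hasFDerivAt_const a p))).clm_apply
    (h1.clm_apply (hasFDerivAt_const b p)), fun ξ => ?_⟩
  simp only [add_apply, ContinuousLinearMap.comp_apply, ContinuousLinearMap.flip_apply,
    zero_apply, map_zero, zero_add, Function.comp_apply]
  ring

/-- The first variation formula in coordinates: if the curve `t ↦ c (t, u)` is a geodesic of `G`
and if the speed of the neighbouring curves is constant, then the scalar product of the
velocity with the variation vector field has derivative zero. -/
theorem hasDerivAt_variation {G : E → E →L[ℝ] E →L[ℝ] ℝ} {c : ℝ × F → E} {t : ℝ} {u e : F}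
    (hsymm : ∀ v w, G (c (t, u)) v w = G (c (t, u)) w v)
    (hG : DifferentiableAt ℝ G (c (t, u))) (hc : ContDiffAt ℝ 2 c (t, u))
    (hgeo : ∀ w, G (c (t, u)) (fderiv ℝ (fderiv ℝ c) (t, u) (1, 0) (1, 0)) w
      + (fderiv ℝ G (c (t, u)) (fderiv ℝ c (t, u) (1, 0)) (fderiv ℝ c (t, u) (1, 0)) w
        - fderiv ℝ G (c (t, u)) w (fderiv ℝ c (t, u) (1, 0)) (fderiv ℝ c (t, u) (1, 0)) / 2) = 0)
    {K : ℝ} (hspeed : ∀ᶠ u' in 𝓝 u,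
      G (c (t, u')) (fderiv ℝ c (t, u') (1, 0)) (fderiv ℝ c (t, u') (1, 0)) = K) :
    HasDerivAt (fun s => G (c (s, u)) (fderiv ℝ c (s, u) (1, 0)) (fderiv ℝ c (s, u) (0, e))) 0
      t := by
  obtain ⟨L₁, hL₁, hL₁'⟩ := hasFDerivAt_bilin_fderiv hG hc ((1 : ℝ), (0 : F)) (1, 0)
  obtain ⟨L₂, hL₂, hL₂'⟩ := hasFDerivAt_bilin_fderiv hG hc ((1 : ℝ), (0 : F)) (0, e)
  have h1 : L₁ (0, e) = 0 := by
    have h2 := HasFDerivAt.comp u hL₁ (hasFDerivAt_prodMk_right (𝕜 := ℝ) t u)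
    have h3 : HasFDerivAt ((fun q => G (c q) (fderiv ℝ c q (1, 0)) (fderiv ℝ c q (1, 0))) ∘
        fun u' => (t, u')) (0 : F →L[ℝ] ℝ) u :=
      (hasFDerivAt_const K u).congr_of_eventuallyEq hspeed
    have := congrArg (fun A => A e) (h2.unique h3)
    simpa using this
  have h2 : L₂ (1, 0) = 0 := by
    have hD := (hc.isSymmSndFDerivAt (by simp)).eq ((1 : ℝ), (0 : F)) (0, e)
    have h3 := hgeo (fderiv ℝ c (t, u) (0, e))
    have h4 := hsymm (fderiv ℝ (fderiv ℝ c) (t, u) (0, e) (1, 0)) (fderiv ℝ c (t, u) (1, 0))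
    rw [hL₁', h4] at h1
    rw [hL₂', hD]
    linarith
  have h3 := hL₂.comp_hasDerivAt t ((hasDerivAt_id t).prodMk (hasDerivAt_const t u))
  rw [h2] at h3
  exact h3

end

theorem GeodesicEqAt.metricForm_eq {g : Metric d M} {p : M} {c : ℝ → Model d} {t : ℝ}
    (h : GeodesicEqAt g p c t) (hz : c t ∈ (extChartAt (𝓡 (d + 1)) p).target) (w : Model d) :
    metricForm g p (c t) (deriv (deriv c) t) w
      + (fderiv ℝ (metricForm g p) (c t) (deriv c t) (deriv c t) w
        - fderiv ℝ (metricForm g p) (c t) w (deriv c t) (deriv c t) / 2) = 0 := by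
  have := h w
  rw [christoffel_eq g hz, ← metricForm_apply] at this
  linarith

/-- Geodesics have constant speed. -/
theorem IsGeodesicOn.hasDerivAt_speed {g : Metric d M} {γ : ℝ → M} {s : Set ℝ}
    (h : IsGeodesicOn g γ s) (hs : IsOpen s) {t : ℝ} (ht : t ∈ s) :
    HasDerivAt (fun r => g.inner (γ r) (stateAt γ r).snd (stateAt γ r).snd) 0 t := by
  have hp : γ t ∈ (extChartAt (𝓡 (d + 1)) (γ t)).source := mem_extChartAt_source _
  set p := γ t
  have hz : extChartAt (𝓡 (d + 1)) p (γ t) ∈ (extChartAt (𝓡 (d + 1)) p).target :=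
    (extChartAt (𝓡 (d + 1)) p).map_source hp
  have hY := h.hasDerivAt_stateCoord hs ht hp
  have hG := ((contDiffAt_metricForm g hz).differentiableAt (by simp)).hasFDerivAt
  have h1 : HasDerivAt (fun r => (stateCoord p (stateAt (d := d) γ r)).1)
    (stateCoord p (stateAt (d := d) γ t)).2 t := hY.fst
  have h2 : HasDerivAt (fun r => (stateCoord p (stateAt (d := d) γ r)).2)
    (geodesicAccel g p (stateCoord p (stateAt (d := d) γ t))) t := hY.snd
  have h3 : HasDerivAt (metricForm g p ∘ fun r => (stateCoord p (stateAt (d := d) γ r)).1)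
      (fderiv ℝ (metricForm g p) (extChartAt (𝓡 (d + 1)) p (γ t))
        (stateCoord p (stateAt (d := d) γ t)).2) t :=
    HasFDerivAt.comp_hasDerivAt t (f := fun r => (stateCoord p (stateAt (d := d) γ r)).1)
      (l := metricForm g p) hG h1
  have h4 := (h3.clm_apply h2).clm_apply h2
  have h5 : (fun r => g.inner (γ r) (stateAt (d := d) γ r).snd (stateAt (d := d) γ r).snd)
      =ᶠ[𝓝 t] fun r => (metricForm g p ∘ fun r => (stateCoord p (stateAt (d := d) γ r)).1) r
        (stateCoord p (stateAt (d := d) γ r)).2 (stateCoord p (stateAt (d := d) γ r)).2 := by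
    filter_upwards [h.eventually_stateCoord hs ht hp] with r hr
    exact (metricForm_vectorCoord g hr.2.1 _ _).symm
  refine (h4.congr_of_eventuallyEq h5).congr_deriv ?_
  set v := (stateCoord p (stateAt (d := d) γ t)).2 with hv
  have h6 : geodesicAccel g p (stateCoord p (stateAt (d := d) γ t)) =
      geodesicAccel g p (extChartAt (𝓡 (d + 1)) p (γ t), v) := rfl
  have h7 : metricForm g p (extChartAt (𝓡 (d + 1)) p (γ t))
      (geodesicAccel g p (extChartAt (𝓡 (d + 1)) p (γ t), v)) v =
      -christoffel g p (extChartAt (𝓡 (d + 1)) p (γ t)) v v v := by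
    rw [geodesicAccel]
    simp only
    rw [metricForm_inverse_apply g hz, neg_apply, christoffelForm_apply g hz]
  have h8 := metricForm_symm g p (extChartAt (𝓡 (d + 1)) p (γ t)) v
    (geodesicAccel g p (extChartAt (𝓡 (d + 1)) p (γ t), v))
  rw [christoffel_eq g hz] at h7
  have h9 : (metricForm g p ∘ fun r => (stateCoord p (stateAt (d := d) γ r)).1) t =
    metricForm g p (extChartAt (𝓡 (d + 1)) p (γ t)) := rfl
  rw [h9, h6]
  simp only [add_apply]
  linarith

theorem eq_of_hasDerivAt_zero {f : ℝ → ℝ} {a b : ℝ} (h : ∀ t ∈ Ioo a b, HasDerivAt f 0 t)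
    {s t : ℝ} (hs : s ∈ Ioo a b) (ht : t ∈ Ioo a b) : f s = f t :=
  isOpen_Ioo.is_const_of_deriv_eq_zero isPreconnected_Ioo
    (fun r hr => (h r hr).differentiableAt.differentiableWithinAt) (fun r hr => (h r hr).deriv)
    hs ht

theorem GeodesicReaches.speed_eq {g : Metric d M} {t : ℝ} {ζ ζ' : TangentBundle (𝓡 (d + 1)) M}
    (h : GeodesicReaches g t ζ ζ') :
    g.inner ζ'.proj ζ'.snd ζ'.snd = g.inner ζ.proj ζ.snd ζ.snd := by
  obtain ⟨γ, a, b, h0, ht, hγ, rfl, rfl⟩ := h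
  exact eq_of_hasDerivAt_zero (fun r hr => hγ.hasDerivAt_speed isOpen_Ioo hr) ht h0

section

variable [T2Space M]

theorem geodesicFlow_zero (g : Metric d M) (ζ : TangentBundle (𝓡 (d + 1)) M) :
    geodesicFlow g 0 ζ = ζ := by
  obtain ⟨⟨ζ', h⟩, -⟩ := (eventually_geodesicFlow_zero g ζ).self_of_nhds
  change GeodesicReaches g 0 ζ ζ' at h
  have h' := h
  obtain ⟨γ, a, b, h0, ht, hγ, h1, h2⟩ := h
  rw [geodesicFlow_eq h']
  exact h2.symm.trans h1

variable {F : Type*} [NormedAddCommGroup F] [NormedSpace ℝ F]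

/-- A smooth family of initial states gives a smooth family of geodesics, jointly in the time and
the parameter. -/
theorem GeodesicReaches.contMDiffAt_family {g : Metric d M} {t : ℝ}
    {ζ : F → TangentBundle (𝓡 (d + 1)) M} {u : F} {ζ' : TangentBundle (𝓡 (d + 1)) M}
    (h : GeodesicReaches g t (ζ u) ζ')
    (hζ : ContMDiffAt 𝓘(ℝ, F) (𝓡 (d + 1)).tangent ∞ ζ u) :
    ContMDiffAt 𝓘(ℝ, ℝ × F) (𝓡 (d + 1)).tangent ∞
      (fun p : ℝ × F => geodesicFlow g p.1 (ζ p.2)) (t, u) := by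
  have h1 : ContMDiffAt 𝓘(ℝ, ℝ × F) (𝓘(ℝ, ℝ).prod (𝓡 (d + 1)).tangent) ∞
      (fun p : ℝ × F => (p.1, ζ p.2)) (t, u) := by
    refine ContMDiffAt.prodMk (contMDiffAt_iff_contDiffAt.2 contDiffAt_fst) ?_
    exact ContMDiffAt.comp (t, u) (g := ζ) (f := fun p : ℝ × F => p.2) hζ
      (contMDiffAt_iff_contDiffAt.2 contDiffAt_snd)
  exact ContMDiffAt.comp (t, u) (f := fun p : ℝ × F => (p.1, ζ p.2))
    (g := fun p : ℝ × TangentBundle (𝓡 (d + 1)) M => geodesicFlow g p.1 p.2)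
    h.eventually.self_of_nhds.2 h1

theorem GeodesicReaches.eventually_family {g : Metric d M} {t : ℝ}
    {ζ : F → TangentBundle (𝓡 (d + 1)) M} {u : F} {ζ' : TangentBundle (𝓡 (d + 1)) M}
    (h : GeodesicReaches g t (ζ u) ζ')
    (hζ : ContMDiffAt 𝓘(ℝ, F) (𝓡 (d + 1)).tangent ∞ ζ u) :
    ∀ᶠ p in 𝓝 (t, u), GeodesicReaches g p.1 (ζ p.2) (geodesicFlow g p.1 (ζ p.2)) := by
  have hc : ContinuousAt (fun p : ℝ × F => (p.1, ζ p.2)) (t, u) :=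
    continuousAt_fst.prodMk (ContinuousAt.comp (f := fun p : ℝ × F => p.2) (g := ζ)
      hζ.continuousAt continuousAt_snd)
  filter_upwards [hc.eventually h.eventually] with p hp
  obtain ⟨ζ', h'⟩ := hp.1
  rw [geodesicFlow_eq h']
  exact h'

/-- The first variation formula: in a smooth family of geodesics of the same speed, the scalar
product of the velocity with the variation vector field is constant in time. -/
theorem GeodesicReaches.inner_variation {g : Metric d M} {T : ℝ}
    {ζ : F → TangentBundle (𝓡 (d + 1)) M} {u : F} {ζ' : TangentBundle (𝓡 (d + 1)) M}
    (h : GeodesicReaches g T (ζ u) ζ')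
    (hζ : ∀ᶠ u' in 𝓝 u, ContMDiffAt 𝓘(ℝ, F) (𝓡 (d + 1)).tangent ∞ ζ u') {K : ℝ}
    (hspeed : ∀ᶠ u' in 𝓝 u, g.inner (ζ u').proj (ζ u').snd (ζ u').snd = K) (e : F) :
    g.inner (geodesicFlow g T (ζ u)).proj (geodesicFlow g T (ζ u)).snd
      (mfderiv 𝓘(ℝ, F) (𝓡 (d + 1)) (fun u' => (geodesicFlow g T (ζ u')).proj) u e) =
    g.inner (ζ u).proj (ζ u).snd (mfderiv 𝓘(ℝ, F) (𝓡 (d + 1)) (fun u' => (ζ u').proj) u e) := by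
  obtain ⟨γ, a, b, h0, hT, hγ, hγ0, -⟩ := h
  have hreach : ∀ t ∈ Ioo a b, GeodesicReaches g t (ζ u) (stateAt γ t) := fun t ht =>
    hγ0 ▸ hγ.reaches h0 ht
  suffices hd : ∀ t ∈ Ioo a b, HasDerivAt (fun t =>
      g.inner (geodesicFlow g t (ζ u)).proj (geodesicFlow g t (ζ u)).snd
      (mfderiv 𝓘(ℝ, F) (𝓡 (d + 1)) (fun u' => (geodesicFlow g t (ζ u')).proj) u e)) 0 t by
    have h1 : (fun u' => geodesicFlow g 0 (ζ u')) = ζ := funext fun u' => geodesicFlow_zero g _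
    exact (eq_of_hasDerivAt_zero hd hT h0).trans (congrArg (fun Z : F → TangentBundle _ M =>
      g.inner (Z u).proj (Z u).snd
        (mfderiv 𝓘(ℝ, F) (𝓡 (d + 1)) (fun u' => (Z u').proj) u e)) h1)
  intro t ht
  have hflow : ∀ r ∈ Ioo a b, geodesicFlow g r (ζ u) = stateAt γ r := fun r hr =>
    geodesicFlow_eq (hreach r hr)
  have hp : γ t ∈ (extChartAt (𝓡 (d + 1)) (γ t)).source := mem_extChartAt_source _
  set p := γ t
  let X : ℝ × F → M := fun q => (geodesicFlow g q.1 (ζ q.2)).proj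
  let c : ℝ × F → Model d := fun q => extChartAt (𝓡 (d + 1)) p (X q)
  have hXu : ∀ r ∈ Ioo a b, X (r, u) = γ r := fun r hr =>
    congrArg Bundle.TotalSpace.proj (hflow r hr)
  have hζu := hζ.self_of_nhds
  have hsmooth : ∀ᶠ q in 𝓝 (t, u), ContMDiffAt 𝓘(ℝ, ℝ × F) (𝓡 (d + 1)) ∞ X q := by
    have h1 : ∀ᶠ q in 𝓝 (t, u), ContMDiffAt 𝓘(ℝ, F) (𝓡 (d + 1)).tangent ∞ ζ q.2 :=
      (continuous_snd.tendsto (t, u)).eventually hζ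
    filter_upwards [h1, (hreach t ht).eventually_family hζu] with q hq hq'
    exact (Bundle.contMDiff_proj (TangentSpace (𝓡 (d + 1)))).contMDiffAt.comp q
      (hq'.contMDiffAt_family hq)
  have hsrc : ∀ᶠ q in 𝓝 (t, u), X q ∈ (extChartAt (𝓡 (d + 1)) p).source := by
    refine hsmooth.self_of_nhds.continuousAt.eventually
      ((isOpen_extChartAt_source (I := 𝓡 (d + 1)) p).mem_nhds ?_)
    rw [hXu t ht]
    exact hp
  have hc : ∀ᶠ q in 𝓝 (t, u), ContDiffAt ℝ ∞ c q := by
    filter_upwards [hsmooth, hsrc] with q hq hq'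
    rw [← contMDiffAt_iff_contDiffAt]
    exact ContMDiffAt.comp q (contMDiffAt_extChartAt' (by rwa [extChartAt_source] at hq')) hq
  have hcd : ∀ᶠ q in 𝓝 (t, u), DifferentiableAt ℝ c q :=
    hc.mono fun q hq => hq.differentiableAt (by simp)
  have hslice_t : ∀ q, DifferentiableAt ℝ c q →
      HasDerivAt (fun r => c (r, q.2)) (fderiv ℝ c q (1, 0)) q.1 := fun q hq =>
    HasFDerivAt.comp_hasDerivAt q.1 (l := c) (f := fun r => (r, q.2)) hq.hasFDerivAt
      ((hasDerivAt_id' q.1).prodMk (hasDerivAt_const q.1 q.2))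
  have htends : Tendsto (fun r : ℝ => (r, u)) (𝓝 t) (𝓝 (t, u)) :=
    (by fun_prop : Continuous fun r : ℝ => (r, u)).tendsto t
  have htends' : Tendsto (fun u' : F => (t, u')) (𝓝 u) (𝓝 (t, u)) :=
    (by fun_prop : Continuous fun u' : F => (t, u')).tendsto u
  -- In coordinates, velocities are time derivatives.
  have hvel : ∀ᶠ q in 𝓝 (t, u), vectorCoord p (X q) (geodesicFlow g q.1 (ζ q.2)).snd =
      fderiv ℝ c q (1, 0) := by
    filter_upwards [hcd, hsrc, (hreach t ht).eventually_family hζu] with q hq hq' hq''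
    obtain ⟨γ', a', b', h0', ht', hγ', hγ0', hγt'⟩ := hq''
    have h1 : (fun r => c (r, q.2)) =ᶠ[𝓝 q.1]
        fun r => extChartAt (𝓡 (d + 1)) p (γ' r) := by
      filter_upwards [isOpen_Ioo.mem_nhds ht'] with r hr
      have : geodesicFlow g r (ζ q.2) = stateAt γ' r :=
        geodesicFlow_eq (hγ0' ▸ hγ'.reaches h0' hr)
      simp only [c, X, this]
      rfl
    have hX : X q = γ' q.1 := (congrArg Bundle.TotalSpace.proj hγt').symm
    have h2 := stateCoord_stateAt (p := p)
      ((hγ'.contMDiffAt isOpen_Ioo ht').mdifferentiableAt (by simp)) (by rwa [← hX])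
    rw [hγt', ← h1.deriv_eq, (hslice_t q hq).deriv] at h2
    exact congrArg Prod.snd h2
  have hp' : c (t, u) ∈ (extChartAt (𝓡 (d + 1)) p).target :=
    (extChartAt (𝓡 (d + 1)) p).map_source hsrc.self_of_nhds
  have hct := hc.self_of_nhds
  have hderiv : deriv (fun r => c (r, u)) =ᶠ[𝓝 t] fun r => fderiv ℝ c (r, u) (1, 0) := by
    filter_upwards [htends.eventually hcd] with r hr
    exact (hslice_t (r, u) hr).deriv
  have hγc : (fun r => extChartAt (𝓡 (d + 1)) p (γ r)) =ᶠ[𝓝 t] fun r => c (r, u) := by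
    filter_upwards [isOpen_Ioo.mem_nhds ht] with r hr
    simp only [c, hXu r hr]
  have hgeo : GeodesicEqAt g p (fun r => c (r, u)) t := by
    have h1 := hγ.geodesicEqAt ht hp
    rw [geodesicEqAt_iff g ((extChartAt (𝓡 (d + 1)) p).map_source hp), hγc.deriv.deriv_eq,
      hγc.deriv_eq] at h1
    have h2 : extChartAt (𝓡 (d + 1)) p (γ t) = c (t, u) := hγc.self_of_nhds
    rw [h2] at h1
    exact (geodesicEqAt_iff g (c := fun r => c (r, u)) hp').2 h1
  have hdd : deriv (deriv fun r => c (r, u)) t = fderiv ℝ (fderiv ℝ c) (t, u) (1, 0) (1, 0) := by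
    rw [hderiv.deriv_eq]
    have h1 : HasFDerivAt (fderiv ℝ c) (fderiv ℝ (fderiv ℝ c) (t, u)) (t, u) :=
      (((hct.of_le (ENat.LEInfty.out : 2 ≤ (∞ : WithTop ℕ∞))).fderiv_right (m := 1)
        (by norm_num)).differentiableAt (by simp)).hasFDerivAt
    have h2 := h1.comp_hasDerivAt t ((hasDerivAt_id t).prodMk (hasDerivAt_const t u))
    have h3 := h2.clm_apply (hasDerivAt_const t ((1 : ℝ), (0 : F)))
    simpa using h3.deriv
  have hmain := hasDerivAt_variation (G := metricForm g p) (c := c) (t := t) (u := u) (e := e)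
    (metricForm_symm g p _) ((contDiffAt_metricForm g hp').differentiableAt (by simp))
    (hct.of_le ENat.LEInfty.out) (fun w => by
      have := hgeo.metricForm_eq hp' w
      rw [hdd, hderiv.self_of_nhds] at this
      exact this) (K := K) (by
      filter_upwards [htends'.eventually hvel, htends'.eventually hsrc, hspeed,
        htends'.eventually ((hreach t ht).eventually_family hζu)] with u' h1 h2 h3 h4
      rw [← h1, ← h3, ← h4.speed_eq]
      exact metricForm_vectorCoord g h2 _ _)
  refine hmain.congr_of_eventuallyEq ?_
  filter_upwards [htends.eventually hvel, htends.eventually hsrc, htends.eventually hsmooth,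
    htends.eventually hcd] with r h1 h2 h3 h4
  have h5 : vectorCoord p (X (r, u)) (mfderiv 𝓘(ℝ, F) (𝓡 (d + 1)) (fun u' => X (r, u')) u e) =
      fderiv ℝ c (r, u) (0, e) := by
    have h6 : MDifferentiableAt 𝓘(ℝ, F) (𝓡 (d + 1)) (fun u' => X (r, u')) u := by
      refine MDifferentiableAt.comp (I' := 𝓘(ℝ, ℝ × F)) u (g := X) (f := fun u' => (r, u'))
        (h3.mdifferentiableAt (by simp)) ?_
      exact (differentiableAt_const r).prodMk differentiableAt_id |>.mdifferentiableAt
    have h7 := mfderiv_comp u (mdifferentiableAt_extChartAt (I := 𝓡 (d + 1)) (x := p)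
      (by rwa [extChartAt_source] at h2)) h6
    have h8 : HasFDerivAt (extChartAt (𝓡 (d + 1)) p ∘ fun u' => X (r, u'))
        (fderiv ℝ c (r, u) ∘L ContinuousLinearMap.inr ℝ ℝ F) u :=
      HasFDerivAt.comp (g := c) u h4.hasFDerivAt (hasFDerivAt_prodMk_right (𝕜 := ℝ) r u)
    rw [mfderiv_eq_fderiv, h8.fderiv] at h7
    exact (congrArg (fun A => A e) h7).symm
  rw [← h1, ← h5]
  exact (metricForm_vectorCoord g h2 _ _).symm

end

/-! ### Smooth boundary points and their normals -/

/-- The differential of a function, as a linear form with values in `ℝ`. -/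
def differential (f : M → ℝ) (x : M) : TangentSpace (𝓡 (d + 1)) x →L[ℝ] ℝ :=
  mfderiv (𝓡 (d + 1)) 𝓘(ℝ, ℝ) f x

/-- A smooth boundary description of `D` in the open set `U`: there `D` is `{f ≥ 0}`, with `f`
smooth without critical points, and `N` is the smooth unit vector field along the gradient of
`f`. -/
structure BoundaryChart (g : Metric d M) (D U : Set M) (f : M → ℝ)
    (N : ∀ x : M, TangentSpace (𝓡 (d + 1)) x) : Prop where
  isOpen : IsOpen U
  smooth : ContMDiffOn (𝓡 (d + 1)) 𝓘(ℝ, ℝ) ∞ f U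
  mem_iff : ∀ y ∈ U, y ∈ D ↔ 0 ≤ f y
  smooth_normal : ∀ y ∈ U, ContMDiffAt (𝓡 (d + 1)) (𝓡 (d + 1)).tangent ∞
    (fun y => (⟨y, N y⟩ : TangentBundle (𝓡 (d + 1)) M)) y
  norm : ∀ y ∈ U, g.inner y (N y) (N y) = 1
  gradient : ∀ y ∈ U, ∃ c > 0, ∀ w : TangentSpace (𝓡 (d + 1)) y,
    differential f y w = c * g.inner y (N y) w

/-- Along a coordinate line, a function has its directional derivative. -/
theorem hasDerivAt_coordinateLine {f : M → ℝ} {x : M}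
    (hf : MDifferentiableAt (𝓡 (d + 1)) 𝓘(ℝ, ℝ) f x) (w : TangentSpace (𝓡 (d + 1)) x) :
    HasDerivAt (fun r : ℝ => f ((extChartAt (𝓡 (d + 1)) x).symm
      (extChartAt (𝓡 (d + 1)) x x + r • vectorCoord x x w)))
      (differential f x w) 0 := by
  have hs := mem_extChartAt_source (I := 𝓡 (d + 1)) x
  have ht := mem_extChartAt_target (I := 𝓡 (d + 1)) x
  have hl : (extChartAt (𝓡 (d + 1)) x).symm (extChartAt (𝓡 (d + 1)) x x) = x :=
    (extChartAt (𝓡 (d + 1)) x).left_inv hs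
  have h1 := (mdifferentiableAt_extChartAt_symm ht).hasMFDerivAt
  have h2 : HasMFDerivAt (𝓡 (d + 1)) 𝓘(ℝ, ℝ) f
      ((extChartAt (𝓡 (d + 1)) x).symm (extChartAt (𝓡 (d + 1)) x x))
      (mfderiv (𝓡 (d + 1)) 𝓘(ℝ, ℝ) f
        ((extChartAt (𝓡 (d + 1)) x).symm (extChartAt (𝓡 (d + 1)) x x))) := by
    rw [hl]
    exact hf.hasMFDerivAt
  have h3 := (hasMFDerivAt_iff_hasFDerivAt.1 (h2.comp _ h1))
  have h4 : HasDerivAt (fun r : ℝ => extChartAt (𝓡 (d + 1)) x x + r • vectorCoord x x w)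
      (vectorCoord x x w) 0 := by
    simpa using ((hasDerivAt_id (0 : ℝ)).smul_const (vectorCoord x x w)).const_add
      (extChartAt (𝓡 (d + 1)) x x)
  have h5 := HasFDerivAt.comp_hasDerivAt_of_eq (0 : ℝ) h3 h4 (by simp)
  refine h5.congr_deriv ?_
  have h6 := mfderiv_symm_mfderiv_extChartAt hs w
  have h7 : ∀ (y : M) (hy : y = x) (v : TangentSpace (𝓡 (d + 1)) y),
      (⟨y, v⟩ : TangentBundle (𝓡 (d + 1)) M) = ⟨x, w⟩ →
      differential f y v = differential f x w := by
    rintro y rfl v hv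
    cases hv
    rfl
  exact h7 _ hl _ (chartState_stateCoord (ζ := ⟨x, w⟩) hs)

theorem HasDerivAt.eventually_pos {φ : ℝ → ℝ} {c : ℝ} (h : HasDerivAt φ c 0) (h0 : φ 0 = 0)
    (hc : 0 < c) : ∀ᶠ r in 𝓝[>] 0, 0 < φ r := by
  have h1 := (hasDerivAt_iff_tendsto_slope_zero.1 h).mono_left
    (nhdsWithin_mono 0 (fun r (hr : 0 < r) => ne_of_gt hr) : 𝓝[>] (0 : ℝ) ≤ 𝓝[≠] 0)
  filter_upwards [h1.eventually (lt_mem_nhds hc), self_mem_nhdsWithin] with r hr hr'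
  rw [zero_add, h0, sub_zero, smul_eq_mul] at hr
  exact (pos_iff_pos_of_mul_pos hr).1 (inv_pos.2 hr')

theorem eventually_pos_coordinateLine {f : M → ℝ} {x : M}
    (hf : MDifferentiableAt (𝓡 (d + 1)) 𝓘(ℝ, ℝ) f x) (h0 : f x = 0)
    {w : TangentSpace (𝓡 (d + 1)) x} (hw : 0 < differential f x w) :
    ∀ᶠ r : ℝ in 𝓝[>] 0, 0 < f ((extChartAt (𝓡 (d + 1)) x).symm
      (extChartAt (𝓡 (d + 1)) x x + r • vectorCoord x x w)) := by
  refine HasDerivAt.eventually_pos (hasDerivAt_coordinateLine hf w) ?_ hw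
  rw [zero_smul, add_zero, extChartAt_to_inv, h0]

theorem tendsto_coordinateLine (x : M) (w : TangentSpace (𝓡 (d + 1)) x) :
    Tendsto (fun r : ℝ => (extChartAt (𝓡 (d + 1)) x).symm
      (extChartAt (𝓡 (d + 1)) x x + r • vectorCoord x x w)) (𝓝[>] 0) (𝓝 x) := by
  have h1 := continuousAt_extChartAt_symm (I := 𝓡 (d + 1)) x
  have h2 : Tendsto (fun r : ℝ => extChartAt (𝓡 (d + 1)) x x + r • vectorCoord x x w) (𝓝 0)
      (𝓝 (extChartAt (𝓡 (d + 1)) x x)) :=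
    Continuous.tendsto' (by fun_prop) _ _ (by simp)
  have h3 := h1.tendsto.comp h2
  rw [extChartAt_to_inv] at h3
  exact h3.mono_left nhdsWithin_le_nhds

theorem Metric.inner_add_left (g : Metric d M) (x : M) (u v w : TangentSpace (𝓡 (d + 1)) x) :
    g.inner x (u + v) w = g.inner x u w + g.inner x v w := by
  rw [map_add]; rfl

theorem Metric.inner_sub_left (g : Metric d M) (x : M) (u v w : TangentSpace (𝓡 (d + 1)) x) :
    g.inner x (u - v) w = g.inner x u w - g.inner x v w := by
  rw [map_sub]; rfl

theorem Metric.inner_neg_left (g : Metric d M) (x : M) (u w : TangentSpace (𝓡 (d + 1)) x) :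
    g.inner x (-u) w = -g.inner x u w := by
  rw [map_neg]; rfl

theorem Metric.inner_smul_left (g : Metric d M) (x : M) (a : ℝ)
    (u w : TangentSpace (𝓡 (d + 1)) x) : g.inner x (a • u) w = a * g.inner x u w := by
  rw [map_smul]; rfl

theorem Metric.inner_add_right (g : Metric d M) (x : M) (u v w : TangentSpace (𝓡 (d + 1)) x) :
    g.inner x u (v + w) = g.inner x u v + g.inner x u w := map_add _ _ _

theorem Metric.inner_sub_right (g : Metric d M) (x : M) (u v w : TangentSpace (𝓡 (d + 1)) x) :
    g.inner x u (v - w) = g.inner x u v - g.inner x u w := map_sub _ _ _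

theorem Metric.inner_neg_right (g : Metric d M) (x : M) (u w : TangentSpace (𝓡 (d + 1)) x) :
    g.inner x u (-w) = -g.inner x u w := map_neg _ _

theorem Metric.inner_smul_right (g : Metric d M) (x : M) (a : ℝ)
    (u w : TangentSpace (𝓡 (d + 1)) x) : g.inner x u (a • w) = a * g.inner x u w :=
  map_smul _ _ _

/-- The inward unit normal is unique: at a direction of increase for one defining function and
of decrease for another one, the two functions would have different signs. -/
theorem IsInwardNormal.unique {g : Metric d M} {D : Set M} {x : M}
    {ν ν' : TangentSpace (𝓡 (d + 1)) x} (h : IsInwardNormal g D x ν)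
    (h' : IsInwardNormal g D x ν') : ν = ν' := by
  obtain ⟨h1, U, f, c, hU, hxU, hf, hfx, hD, hc, hdf⟩ := h
  change ∀ w, differential f x w = c * g.inner x ν w at hdf
  obtain ⟨h1', U', f', c', hU', hxU', hf', hfx', hD', hc', hdf'⟩ := h'
  change ∀ w, differential f' x w = c' * g.inner x ν' w at hdf'
  by_contra hne
  have hpos := g.pos x (ν - ν') (sub_ne_zero.2 hne)
  have hsymm := g.symm x ν ν'
  rw [Metric.inner_sub_left, Metric.inner_sub_right, Metric.inner_sub_right, h1, h1', ← hsymm]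
    at hpos
  have hdiff : MDifferentiableAt (𝓡 (d + 1)) 𝓘(ℝ, ℝ) f x :=
    (hf.contMDiffAt (hU.mem_nhds hxU)).mdifferentiableAt (by simp)
  have hdiff' : MDifferentiableAt (𝓡 (d + 1)) 𝓘(ℝ, ℝ) f' x :=
    (hf'.contMDiffAt (hU'.mem_nhds hxU')).mdifferentiableAt (by simp)
  have e1 := eventually_pos_coordinateLine hdiff hfx (w := ν - ν') (by
    rw [hdf, Metric.inner_sub_right, h1]
    exact mul_pos hc (by linarith))
  have e2 := HasDerivAt.eventually_pos (hasDerivAt_coordinateLine hdiff' (ν - ν')).neg (by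
      simp only [Pi.neg_apply, zero_smul, add_zero, extChartAt_to_inv, hfx', neg_zero]) (by
    rw [hdf', Metric.inner_sub_right, h1', ← hsymm, ← mul_neg]
    exact mul_pos hc' (by linarith))
  obtain ⟨r, hr1, hr2, hr3, hr4⟩ := (e1.and (e2.and (((tendsto_coordinateLine x (ν - ν')).eventually
    (hU.mem_nhds hxU)).and ((tendsto_coordinateLine x (ν - ν')).eventually
    (hU'.mem_nhds hxU'))))).exists
  have h5 := (hD' _ hr4).1 ((hD _ hr3).2 hr1.le)
  rw [Pi.neg_apply] at hr2
  linarith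

theorem BoundaryChart.mono {g : Metric d M} {D U V : Set M} {f : M → ℝ}
    {N : ∀ x : M, TangentSpace (𝓡 (d + 1)) x} (h : BoundaryChart g D U f N) (hV : IsOpen V)
    (hVU : V ⊆ U) : BoundaryChart g D V f N :=
  ⟨hV, h.smooth.mono hVU, fun y hy => h.mem_iff y (hVU hy),
    fun y hy => h.smooth_normal y (hVU hy), fun y hy => h.norm y (hVU hy),
    fun y hy => h.gradient y (hVU hy)⟩

theorem BoundaryChart.mdifferentiableAt {g : Metric d M} {D U : Set M} {f : M → ℝ}
    {N : ∀ x : M, TangentSpace (𝓡 (d + 1)) x} (h : BoundaryChart g D U f N) {y : M} (hy : y ∈ U) :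
    MDifferentiableAt (𝓡 (d + 1)) 𝓘(ℝ, ℝ) f y :=
  (h.smooth.contMDiffAt (h.isOpen.mem_nhds hy)).mdifferentiableAt (by simp)

theorem BoundaryChart.isInwardNormal {g : Metric d M} {D U : Set M} {f : M → ℝ}
    {N : ∀ x : M, TangentSpace (𝓡 (d + 1)) x} (h : BoundaryChart g D U f N) {y : M} (hy : y ∈ U)
    (hf : f y = 0) : IsInwardNormal g D y (N y) := by
  obtain ⟨c, hc, hc'⟩ := h.gradient y hy
  exact ⟨h.norm y hy, U, f, c, h.isOpen, hy, h.smooth, hf, h.mem_iff, hc, hc'⟩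

theorem BoundaryChart.mem_interior {g : Metric d M} {D U : Set M} {f : M → ℝ}
    {N : ∀ x : M, TangentSpace (𝓡 (d + 1)) x} (h : BoundaryChart g D U f N) {y : M} (hy : y ∈ U)
    (hf : 0 < f y) : y ∈ interior D := by
  rw [mem_interior_iff_mem_nhds]
  filter_upwards [h.isOpen.mem_nhds hy, (h.mdifferentiableAt hy).continuousAt.eventually
    (lt_mem_nhds hf)] with z hz hz'
  exact (h.mem_iff z hz).2 hz'.le

/-- Points where the defining function is negative accumulate at the boundary. -/
theorem BoundaryChart.mem_closure_neg {g : Metric d M} {D U : Set M} {f : M → ℝ}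
    {N : ∀ x : M, TangentSpace (𝓡 (d + 1)) x} (h : BoundaryChart g D U f N) {y : M} (hy : y ∈ U)
    (hf : f y = 0) : y ∈ closure {z | z ∈ U ∧ f z < 0} := by
  obtain ⟨c, hc, hc'⟩ := h.gradient y hy
  have e2 := HasDerivAt.eventually_pos
    (hasDerivAt_coordinateLine (h.mdifferentiableAt hy) (-N y)).neg (by
      simp only [Pi.neg_apply, zero_smul, add_zero, extChartAt_to_inv, hf, neg_zero]) (by
    rw [hc', Metric.inner_neg_right, h.norm y hy]
    linarith)
  refine mem_closure_of_tendsto (tendsto_coordinateLine y (-N y)) ?_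
  filter_upwards [e2, (tendsto_coordinateLine y (-N y)).eventually (h.isOpen.mem_nhds hy)]
    with r hr hr'
  exact ⟨hr', neg_pos.1 hr⟩

theorem BoundaryChart.mem_frontier_iff {g : Metric d M} {D U : Set M} {f : M → ℝ}
    {N : ∀ x : M, TangentSpace (𝓡 (d + 1)) x} (h : BoundaryChart g D U f N) {y : M}
    (hy : y ∈ U) : y ∈ frontier D ↔ f y = 0 := by
  constructor
  · rintro ⟨hcl, hint⟩
    refine le_antisymm (not_lt.1 fun hf => hint (h.mem_interior hy hf)) (not_lt.1 fun hf => ?_)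
    rw [mem_closure_iff_frequently] at hcl
    refine hcl ?_
    filter_upwards [h.isOpen.mem_nhds hy, (h.mdifferentiableAt hy).continuousAt.eventually
      (gt_mem_nhds hf)] with z hz hz' hzD
    exact absurd ((h.mem_iff z hz).1 hzD) (not_le.2 hz')
  · intro hf
    refine ⟨subset_closure ((h.mem_iff y hy).2 hf.ge), ?_⟩
    rw [← mem_compl_iff, ← closure_compl]
    refine closure_mono ?_ (h.mem_closure_neg hy hf)
    rintro z ⟨hz, hz'⟩ hzD
    exact absurd ((h.mem_iff z hz).1 hzD) (not_le.2 hz')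

/-- Near a point with an inward normal there is a smooth boundary description. -/
theorem IsInwardNormal.exists_boundaryChart {g : Metric d M} {D : Set M} {x : M}
    {ν : TangentSpace (𝓡 (d + 1)) x} (h : IsInwardNormal g D x ν) :
    ∃ (U : Set M) (f : M → ℝ) (N : ∀ x : M, TangentSpace (𝓡 (d + 1)) x),
      BoundaryChart g D U f N ∧ x ∈ U ∧ f x = 0 ∧ N x = ν := by
  have hν := h
  obtain ⟨h1, U, f, c, hU, hxU, hf, hfx, hD, hc, hdf⟩ := h
  change ∀ w, differential f x w = c * g.inner x ν w at hdf
  set φ := extChartAt (𝓡 (d + 1)) x with hφ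
  have hxs : x ∈ φ.source := mem_extChartAt_source x
  -- The differential of `f` in the chart, its gradient, and the square of the gradient's length.
  let α : Model d → Model d →L[ℝ] ℝ := fun z => fderiv ℝ (f ∘ φ.symm) z
  let n : Model d → Model d := fun z => (metricForm g x z).inverse (α z)
  let q : Model d → ℝ := fun z => α z (n z)
  have hF : ∀ y ∈ U, y ∈ φ.source → ContDiffAt ℝ ∞ (f ∘ φ.symm) (φ y) := by
    intro y hy hys
    rw [← contMDiffAt_iff_contDiffAt]
    have h2 := (contMDiffOn_extChartAt_symm (I := 𝓡 (d + 1)) (n := ∞) x).contMDiffAt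
      ((isOpen_extChartAt_target (I := 𝓡 (d + 1)) x).mem_nhds (φ.map_source hys))
    refine ContMDiffAt.comp (φ y) ?_ h2
    rw [φ.left_inv hys]
    exact hf.contMDiffAt (hU.mem_nhds hy)
  have hα : ∀ y ∈ U, y ∈ φ.source → ContDiffAt ℝ ∞ α (φ y) := fun y hy hys =>
    (hF y hy hys).fderiv_right (m := ∞) (by simp)
  have hn : ∀ y ∈ U, y ∈ φ.source → ContDiffAt ℝ ∞ n (φ y) := fun y hy hys =>
    (contDiffAt_inverse_metricForm g (φ.map_source hys)).clm_apply (hα y hy hys)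
  have hq : ∀ y ∈ U, y ∈ φ.source → ContDiffAt ℝ ∞ q (φ y) := fun y hy hys =>
    (hα y hy hys).clm_apply (hn y hy hys)
  have hα' : ∀ y ∈ U, y ∈ φ.source → ∀ w : TangentSpace (𝓡 (d + 1)) y,
      differential f y w = α (φ y) (vectorCoord x y w) := by
    intro y hy hys w
    have h2 : f =ᶠ[𝓝 y] (f ∘ φ.symm) ∘ φ := by
      filter_upwards [(isOpen_extChartAt_source (I := 𝓡 (d + 1)) x).mem_nhds hys] with z hz
      simp only [Function.comp_apply]
      rw [φ.left_inv hz]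
    have h3 : HasMFDerivAt 𝓘(ℝ, Model d) 𝓘(ℝ, ℝ) (f ∘ φ.symm) (φ y) (α (φ y)) :=
      ((hF y hy hys).differentiableAt (by simp)).hasFDerivAt.hasMFDerivAt
    have h4 := (mdifferentiableAt_extChartAt (I := 𝓡 (d + 1)) (x := x) (y := y)
      (by rwa [← extChartAt_source (𝓡 (d + 1))])).hasMFDerivAt
    have h5 := ((h3.comp y h4).congr_of_eventuallyEq h2).mfderiv
    exact congrArg (fun A => A w) h5
  have hmet : ∀ y ∈ φ.source, ∀ w, metricForm g x (φ y) (n (φ y)) w = α (φ y) w := fun y hys w =>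
    congrArg (fun A => A w) (metricForm_inverse_apply g (φ.map_source hys) (α (φ y)))
  have hqpos : 0 < q (φ x) := by
    have h2 : n (φ x) ≠ 0 := by
      intro h0
      have h3 := hα' x hxU hxs ν
      rw [hdf, h1, ← hmet x hxs, h0, map_zero] at h3
      rw [zero_apply] at h3
      linarith
    have h3 := metricForm_pos g (φ.map_source hxs) h2
    rwa [hmet x hxs] at h3
  have hev : ∀ᶠ y in 𝓝 x, y ∈ U ∧ y ∈ φ.source ∧ 0 < q (φ y) :=
    Filter.Eventually.and (hU.mem_nhds hxU) (Filter.Eventually.and ((isOpen_extChartAt_source (I := 𝓡 (d + 1)) x).mem_nhds hxs)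
      (((hq x hxU hxs).continuousAt.comp (f := φ) (continuousAt_extChartAt x)).eventually
        (lt_mem_nhds hqpos)))
  obtain ⟨U', hU'sub, hU', hxU'⟩ := mem_nhds_iff.1 hev
  let e : Model d → Model d := fun z => (Real.sqrt (q z))⁻¹ • n z
  let N : ∀ y : M, TangentSpace (𝓡 (d + 1)) y := fun y => (chartVector x (φ y) (e (φ y)) : Model d)
  have hNmk : ∀ y ∈ φ.source, (⟨y, N y⟩ : TangentBundle (𝓡 (d + 1)) M) =
      chartState x (φ y, e (φ y)) := by
    intro y hys
    exact congrArg (fun z => (⟨z, (chartVector x (φ y) (e (φ y)) : Model d)⟩ :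
      TangentBundle (𝓡 (d + 1)) M)) (φ.left_inv hys).symm
  have hNc : ∀ y ∈ φ.source, vectorCoord x y (N y) = e (φ y) := by
    intro y hys
    have h2 := stateCoord_chartState (p := x) (q := (φ y, e (φ y))) (φ.map_source hys)
    rw [← hNmk y hys] at h2
    exact congrArg Prod.snd h2
  have hgrad : ∀ y ∈ U', ∀ w : TangentSpace (𝓡 (d + 1)) y,
      differential f y w = Real.sqrt (q (φ y)) * g.inner y (N y) w := by
    intro y hy w
    obtain ⟨hyU, hys, hyq⟩ := hU'sub hy
    have h2 := Real.sqrt_pos.2 hyq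
    rw [hα' y hyU hys, ← metricForm_vectorCoord g hys, hNc y hys]
    simp only [e]
    rw [map_smul, smul_apply, hmet y hys, smul_eq_mul, mul_inv_cancel_left₀ h2.ne']
  have hchart : BoundaryChart g D U' f N := by
    refine ⟨hU', hf.mono fun y hy => (hU'sub hy).1, fun y hy => hD y (hU'sub hy).1, ?_, ?_,
      fun y hy => ⟨_, Real.sqrt_pos.2 (hU'sub hy).2.2, hgrad y hy⟩⟩
    · intro y hy
      obtain ⟨hyU, hys, hyq⟩ := hU'sub hy
      have h2 : ContDiffAt ℝ ∞ e (φ y) :=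
        (((hq y hyU hys).sqrt hyq.ne').inv (Real.sqrt_pos.2 hyq).ne').smul (hn y hyU hys)
      have h3 : ContMDiffAt (𝓡 (d + 1)) 𝓘(ℝ, Model d × Model d) ∞
          (fun y => (φ y, e (φ y))) y :=
        ContMDiffAt.comp y (g := fun z => (z, e z)) (f := φ)
          (contMDiffAt_iff_contDiffAt.2 (contDiffAt_id.prodMk h2))
          (contMDiffAt_extChartAt' (by rwa [← extChartAt_source (𝓡 (d + 1))]))
      refine (ContMDiffAt.comp y (g := chartState x) (f := fun y => (φ y, e (φ y)))
        (contMDiffAt_chartState (φ.map_source hys)) h3).congr_of_eventuallyEq ?_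
      filter_upwards [(isOpen_extChartAt_source (I := 𝓡 (d + 1)) x).mem_nhds hys] with z hz
      exact hNmk z hz
    · intro y hy
      obtain ⟨hyU, hys, hyq⟩ := hU'sub hy
      have h2 := hgrad y hy (N y)
      rw [hα' y hyU hys, hNc y hys] at h2
      simp only [e] at h2
      rw [map_smul, smul_eq_mul] at h2
      have h3 : α (φ y) (n (φ y)) = q (φ y) := rfl
      have h4 := Real.sqrt_pos.2 hyq
      have h5 := Real.mul_self_sqrt hyq.le
      rw [h3] at h2
      field_simp at h2
      nlinarith
  exact ⟨U', f, N, hchart, hxU', hfx, (hchart.isInwardNormal hxU' hfx).unique hν⟩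

theorem IsInwardNormal.mem_frontier {g : Metric d M} {D : Set M} {x : M}
    {ν : TangentSpace (𝓡 (d + 1)) x} (h : IsInwardNormal g D x ν) : x ∈ frontier D := by
  obtain ⟨U, f, N, hc, hx, hfx, -⟩ := h.exists_boundaryChart
  exact (hc.mem_frontier_iff hx).2 hfx

theorem BoundaryChart.eq_normal {g : Metric d M} {D U : Set M} {f : M → ℝ}
    {N : ∀ x : M, TangentSpace (𝓡 (d + 1)) x} (h : BoundaryChart g D U f N) {y : M} (hy : y ∈ U)
    {ν : TangentSpace (𝓡 (d + 1)) y} (hν : IsInwardNormal g D y ν) : f y = 0 ∧ ν = N y := by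
  have hf := (h.mem_frontier_iff hy).1 hν.mem_frontier
  exact ⟨hf, hν.unique (h.isInwardNormal hy hf)⟩

/-! ### Pull-backs of the canonical one-form -/

section

variable {F : Type*} [NormedAddCommGroup F] [NormedSpace ℝ F]

theorem vectorCoord_mfderiv {X : F → M} {u : F} {p : M}
    (hX : MDifferentiableAt 𝓘(ℝ, F) (𝓡 (d + 1)) X u)
    (hp : X u ∈ (extChartAt (𝓡 (d + 1)) p).source) (e : F) :
    vectorCoord p (X u) (mfderiv 𝓘(ℝ, F) (𝓡 (d + 1)) X u e) =
      fderiv ℝ (fun u' => extChartAt (𝓡 (d + 1)) p (X u')) u e := by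
  have h := mfderiv_comp u (mdifferentiableAt_extChartAt (I := 𝓡 (d + 1)) (x := p)
    (by rwa [extChartAt_source] at hp)) hX
  rw [mfderiv_eq_fderiv] at h
  exact (congrArg (fun A => A e) h).symm

/-- Maps that agree near a point have the same derivative there. The values are compared in the
tangent bundle, as they lie in the tangent spaces at `X u` and `X' u`. -/
theorem mk_mfderiv_congr {X X' : F → M} {u : F} (h : X =ᶠ[𝓝 u] X') (e : F) :
    (⟨X u, mfderiv 𝓘(ℝ, F) (𝓡 (d + 1)) X u e⟩ : TangentBundle (𝓡 (d + 1)) M) =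
      ⟨X' u, mfderiv 𝓘(ℝ, F) (𝓡 (d + 1)) X' u e⟩ := by
  have h1 := h.mfderiv_eq (I := 𝓘(ℝ, F)) (I' := 𝓡 (d + 1))
  have h0 := h.self_of_nhds
  generalize X u = x at h0 h1 ⊢
  subst h0
  exact congrArg (fun A : F →L[ℝ] TangentSpace (𝓡 (d + 1)) (X' u) =>
    (⟨X' u, A e⟩ : TangentBundle (𝓡 (d + 1)) M)) h1

/-- Curves in the boundary are orthogonal to its normal. -/
theorem inner_normal_mfderiv_eq_zero {g : Metric d M} {D : Set M} {X : F → M} {u : F}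
    (hX : MDifferentiableAt 𝓘(ℝ, F) (𝓡 (d + 1)) X u) (hD : ∀ᶠ u' in 𝓝 u, X u' ∈ frontier D)
    {ν : TangentSpace (𝓡 (d + 1)) (X u)} (hν : IsInwardNormal g D (X u) ν) (e : F) :
    g.inner (X u) ν (mfderiv 𝓘(ℝ, F) (𝓡 (d + 1)) X u e) = 0 := by
  obtain ⟨U, f, N, hc, hU, hf, rfl⟩ := hν.exists_boundaryChart
  obtain ⟨c, hc0, hdf⟩ := hc.gradient _ hU
  have h1 : (f ∘ X) =ᶠ[𝓝 u] fun _ => (0 : ℝ) := by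
    filter_upwards [hD, hX.continuousAt.eventually (hc.isOpen.mem_nhds hU)] with u' h1 h2
    exact (hc.mem_frontier_iff h2).1 h1
  have h2 := mfderiv_comp u (hc.mdifferentiableAt hU) hX
  have h3 : differential f (X u) (mfderiv 𝓘(ℝ, F) (𝓡 (d + 1)) X u e) = 0 := by
    have h4 := congrArg (fun A => A e) (h2.symm.trans h1.mfderiv_eq)
    have h5 : mfderiv 𝓘(ℝ, F) 𝓘(ℝ, ℝ) (fun _ : F => (0 : ℝ)) u = 0 := mfderiv_const
    rw [h5] at h4
    exact h4
  rw [hdf] at h3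
  exact (mul_eq_zero.1 h3).resolve_left hc0.ne'

end

theorem pullbackForm_congr (g : Metric d M) {ψ φ : Coord d → TangentBundle (𝓡 (d + 1)) M}
    {u : Coord d} (h : ψ =ᶠ[𝓝 u] φ) (a : Fin d ⊕ Fin d) :
    pullbackForm g ψ a u = pullbackForm g φ a u :=
  inner_congr_of_mk_eq g h.self_of_nhds
    (mk_mfderiv_congr (h.fun_comp Bundle.TotalSpace.proj) _)

theorem mdifferentiableAt_proj {F : Type*} [NormedAddCommGroup F] [NormedSpace ℝ F]
    {ψ : F → TangentBundle (𝓡 (d + 1)) M} {u : F}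
    (h : ContMDiffAt 𝓘(ℝ, F) (𝓡 (d + 1)).tangent ∞ ψ u) :
    MDifferentiableAt 𝓘(ℝ, F) (𝓡 (d + 1)) (fun u' => (ψ u').proj) u :=
  ((Bundle.contMDiff_proj (n := ∞) (TangentSpace (𝓡 (d + 1)))).contMDiffAt.comp u
    h).mdifferentiableAt (by simp)

theorem differentiableAt_pullbackForm (g : Metric d M)
    {ψ : Coord d → TangentBundle (𝓡 (d + 1)) M} {u : Coord d}
    (h : ∀ᶠ u' in 𝓝 u, ContMDiffAt 𝓘(ℝ, Coord d) (𝓡 (d + 1)).tangent ∞ ψ u')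
    (a : Fin d ⊕ Fin d) : DifferentiableAt ℝ (pullbackForm g ψ a) u := by
  set p := (ψ u).proj with hp
  have hs : ∀ᶠ u' in 𝓝 u, (ψ u').proj ∈ (extChartAt (𝓡 (d + 1)) p).source :=
    h.self_of_nhds.continuousAt.eventually ((isOpen_proj_preimage_source p).mem_nhds
      (mem_extChartAt_source (I := 𝓡 (d + 1)) p))
  have hY : ContDiffAt ℝ ∞ (fun u' => stateCoord p (ψ u')) u := by
    rw [← contMDiffAt_iff_contDiffAt]
    exact ContMDiffAt.comp u (contMDiffAt_stateCoord hs.self_of_nhds) h.self_of_nhds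
  have hz : (stateCoord p (ψ u)).1 ∈ (extChartAt (𝓡 (d + 1)) p).target :=
    (extChartAt (𝓡 (d + 1)) p).map_source hs.self_of_nhds
  have h1 : pullbackForm g ψ a =ᶠ[𝓝 u] fun u' => metricForm g p (stateCoord p (ψ u')).1
      (stateCoord p (ψ u')).2
      (fderiv ℝ (fun u' => (stateCoord p (ψ u')).1) u' (Pi.single a 1)) := by
    filter_upwards [h, hs] with u' h1 h2
    have h3 := vectorCoord_mfderiv (mdifferentiableAt_proj h1) h2 (Pi.single a 1)
    have h4 := metricForm_vectorCoord g h2 (ψ u').snd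
      (mfderiv 𝓘(ℝ, Coord d) (𝓡 (d + 1)) (fun u' => (ψ u').proj) u' (Pi.single a 1))
    rw [h3] at h4
    exact h4.symm
  refine DifferentiableAt.congr_of_eventuallyEq ?_ h1
  have h2 : ContDiffAt ℝ ∞ (fun u' => metricForm g p (stateCoord p (ψ u')).1) u :=
    ContDiffAt.comp u (g := metricForm g p) (f := fun u' => (stateCoord p (ψ u')).1)
      (contDiffAt_metricForm g hz) hY.fst
  have h3 : ContDiffAt ℝ ∞ (fun u' =>
      fderiv ℝ (fun u' => (stateCoord p (ψ u')).1) u' (Pi.single a 1)) u :=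
    (hY.fst.fderiv_right (m := ∞) (by simp)).clm_apply contDiffAt_const
  exact ((h2.clm_apply hY.snd).clm_apply h3).differentiableAt (by simp)

/-- The Liouville density does not change when the pull-back of the canonical one-form changes
by an exact form or by its sign. -/
theorem liouvilleDensity_eq (g : Metric d M) {ψ φ : Coord d → TangentBundle (𝓡 (d + 1)) M}
    {u : Coord d} {ε : ℝ} (hε : ε = 1 ∨ ε = -1) {T : Coord d → ℝ} (hT : ContDiffAt ℝ 2 T u)
    (hψ : ∀ᶠ u' in 𝓝 u, ContMDiffAt 𝓘(ℝ, Coord d) (𝓡 (d + 1)).tangent ∞ ψ u')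
    (h : ∀ a, ∀ᶠ u' in 𝓝 u, pullbackForm g φ a u' =
      ε * (pullbackForm g ψ a u' + fderiv ℝ T u' (Pi.single a 1))) :
    liouvilleDensity g φ u = liouvilleDensity g ψ u := by
  have hTT : HasFDerivAt (fderiv ℝ T) (fderiv ℝ (fderiv ℝ T) u) u :=
    ((hT.fderiv_right (m := 1) (by norm_num)).differentiableAt (by simp)).hasFDerivAt
  have h1 : ∀ a e, fderiv ℝ (pullbackForm g φ a) u e =
      ε * (fderiv ℝ (pullbackForm g ψ a) u e + fderiv ℝ (fderiv ℝ T) u e (Pi.single a 1)) := by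
    intro a e
    have h2 := (((differentiableAt_pullbackForm g hψ a).hasFDerivAt.add
      (hTT.clm_apply (hasFDerivAt_const (Pi.single a 1) u))).const_mul ε).congr_of_eventuallyEq
        (h a)
    rw [h2.fderiv]
    simp [mul_add]
  have h2 : symplecticMatrix g φ u = ε • symplecticMatrix g ψ u := by
    ext a b
    have h3 := (hT.isSymmSndFDerivAt (by simp)).eq (Pi.single a 1) (Pi.single b 1)
    simp only [symplecticMatrix, Matrix.of_apply, Matrix.smul_apply, smul_eq_mul, h1, h3]
    ring
  -- The number of coordinates is even, so that the sign does not enter the determinant.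
  have h3 : ε ^ Fintype.card (Fin d ⊕ Fin d) = 1 := by
    rw [Fintype.card_sum, pow_add, ← mul_pow]
    rcases hε with rfl | rfl <;> simp
  rw [liouvilleDensity, liouvilleDensity, h2, Matrix.det_smul, h3, one_mul]

/-- Smoothness of maps of states that move the velocity in the direction of a vector field. -/
theorem contMDiffAt_velocity_combination {N : ∀ x : M, TangentSpace (𝓡 (d + 1)) x}
    {ζ₀ : TangentBundle (𝓡 (d + 1)) M} {a b : TangentBundle (𝓡 (d + 1)) M → ℝ}
    (ha : ContMDiffAt (𝓡 (d + 1)).tangent 𝓘(ℝ, ℝ) ∞ a ζ₀)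
    (hb : ContMDiffAt (𝓡 (d + 1)).tangent 𝓘(ℝ, ℝ) ∞ b ζ₀)
    (hN : ContMDiffAt (𝓡 (d + 1)) (𝓡 (d + 1)).tangent ∞
      (fun y => (⟨y, N y⟩ : TangentBundle (𝓡 (d + 1)) M)) ζ₀.proj) :
    ContMDiffAt (𝓡 (d + 1)).tangent (𝓡 (d + 1)).tangent ∞
      (fun ζ => (⟨ζ.proj, a ζ • ζ.snd + b ζ • N ζ.proj⟩ : TangentBundle (𝓡 (d + 1)) M)) ζ₀ := by
  set p := ζ₀.proj with hp
  have hs : p ∈ (extChartAt (𝓡 (d + 1)) p).source := mem_extChartAt_source p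
  have h1 := contMDiffAt_stateCoord (ζ := ζ₀) (p := p) hs
  have h2 : ContMDiffAt (𝓡 (d + 1)).tangent 𝓘(ℝ, Model d × Model d) ∞
      (fun ζ : TangentBundle (𝓡 (d + 1)) M => stateCoord p ⟨ζ.proj, N ζ.proj⟩) ζ₀ := by
    have h3 := contMDiffAt_stateCoord (ζ := ⟨p, N p⟩) (p := p) hs
    exact (ContMDiffAt.comp p h3 hN).comp ζ₀
      (Bundle.contMDiff_proj (TangentSpace (𝓡 (d + 1)))).contMDiffAt
  have h3 : ContMDiffAt (𝓡 (d + 1)).tangent 𝓘(ℝ, Model d × Model d) ∞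
      (fun ζ : TangentBundle (𝓡 (d + 1)) M => ((stateCoord p ζ).1, a ζ • (stateCoord p ζ).2 +
        b ζ • (stateCoord p ⟨ζ.proj, N ζ.proj⟩).2)) ζ₀ := by
    have e1 : ContMDiffAt (𝓡 (d + 1)).tangent 𝓘(ℝ, Model d) ∞
        (fun ζ : TangentBundle (𝓡 (d + 1)) M => (stateCoord p ζ).1) ζ₀ :=
      ContMDiffAt.comp ζ₀ (g := Prod.fst) (f := stateCoord p)
        (contMDiffAt_iff_contDiffAt.2 contDiffAt_fst) h1
    have e2 : ContMDiffAt (𝓡 (d + 1)).tangent 𝓘(ℝ, Model d) ∞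
        (fun ζ : TangentBundle (𝓡 (d + 1)) M => (stateCoord p ζ).2) ζ₀ :=
      ContMDiffAt.comp ζ₀ (g := Prod.snd) (f := stateCoord p)
        (contMDiffAt_iff_contDiffAt.2 contDiffAt_snd) h1
    have e3 : ContMDiffAt (𝓡 (d + 1)).tangent 𝓘(ℝ, Model d) ∞
        (fun ζ : TangentBundle (𝓡 (d + 1)) M => (stateCoord p ⟨ζ.proj, N ζ.proj⟩).2) ζ₀ :=
      ContMDiffAt.comp ζ₀ (g := Prod.snd)
        (f := fun ζ : TangentBundle (𝓡 (d + 1)) M => stateCoord p ⟨ζ.proj, N ζ.proj⟩)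
        (contMDiffAt_iff_contDiffAt.2 contDiffAt_snd) h2
    exact e1.prodMk_space ((ha.smul e2).add (hb.smul e3))
  refine ((contMDiffAt_chartState (p := p) ?_).comp ζ₀ h3).congr_of_eventuallyEq ?_
  · exact (extChartAt (𝓡 (d + 1)) p).map_source hs
  · filter_upwards [(isOpen_proj_preimage_source p).mem_nhds (show ζ₀.proj ∈ _ from hs)]
      with ζ hζ
    have h4 := chartState_stateCoord (p := p) (ζ := ⟨ζ.proj, a ζ • ζ.snd + b ζ • N ζ.proj⟩) hζ
    rw [stateCoord_eq, map_add, map_smul, map_smul] at h4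
    exact h4.symm

/-! ### Transverse states -/

/-- The states of the phase space whose velocity points strictly inwards. -/
def transverse (g : Metric d M) (R A : Set M) (m C E : ℝ) : Set (State d M) :=
  {z | (∃ ν, IsRegular g R A z.1 z.2.proj ν ∧ 0 < g.inner z.2.proj ν z.2.snd) ∧
    g.inner z.2.proj z.2.snd z.2.snd = 2 * (E - potential C z.1) / m}

theorem isClosed_piece (R A : Set M) (i : Bool) : IsClosed (piece R A i) := by
  cases i <;> exact isClosed_closure

theorem speedSq_pos {m C E : ℝ} (hm : 0 < m) (hE : 0 < E) (hCE : C < E) (i : Bool) :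
    0 < 2 * (E - potential C i) / m := by
  refine div_pos (mul_pos two_pos ?_) hm
  cases i
  · simpa [potential] using hE
  · simpa [potential] using hCE

theorem Metric.inner_self_nonneg (g : Metric d M) (x : M) (v : TangentSpace (𝓡 (d + 1)) x) :
    0 ≤ g.inner x v v := by
  by_cases h : v = 0
  · rw [h, map_zero]
  · exact (g.pos x v h).le

theorem transverse_subset_phaseSpace (g : Metric d M) (R A : Set M) (m C E : ℝ) :
    transverse g R A m C E ⊆ phaseSpace g R A m C E := by
  rintro z ⟨⟨ν, hν, hpos⟩, hs⟩
  exact ⟨ν, hν, hpos.le, by rw [hs]⟩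

theorem mem_transverse_of_mem_phaseSpace {g : Metric d M} {R A : Set M} {m C E : ℝ} (hm : 0 < m)
    (hE : 0 < E) (hCE : C < E) {z : State d M} (hz : z ∈ phaseSpace g R A m C E)
    (h : ∃ ν, IsRegular g R A z.1 z.2.proj ν ∧ 0 < g.inner z.2.proj ν z.2.snd) :
    z ∈ transverse g R A m C E := by
  obtain ⟨ν, -, -, hs⟩ := hz
  exact ⟨h, (Real.sqrt_inj (Metric.inner_self_nonneg g _ _) (speedSq_pos hm hE hCE z.1).le).1 hs⟩

/-- Near a regular point all boundary points are regular. -/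
theorem IsRegular.exists_boundaryChart {g : Metric d M} {R A : Set M} {i : Bool} {x : M}
    {ν : TangentSpace (𝓡 (d + 1)) x} (h : IsRegular g R A i x ν) :
    ∃ (U : Set M) (f : M → ℝ) (N : ∀ x : M, TangentSpace (𝓡 (d + 1)) x),
      BoundaryChart g (piece R A i) U f N ∧ x ∈ U ∧ f x = 0 ∧ N x = ν ∧
      ∀ y ∈ U, f y = 0 → IsRegular g R A i y (N y) := by
  obtain ⟨U, f, N, hc, hx, hf, hN⟩ := h.1.exists_boundaryChart
  by_cases hx' : x ∈ piece R A (!i)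
  · refine ⟨U ∩ interior R, f, N, hc.mono (hc.isOpen.inter isOpen_interior) inter_subset_left,
      ⟨hx, h.2 hx'⟩, hf, hN, fun y hy hfy => ⟨hc.isInwardNormal hy.1 hfy, fun _ => hy.2⟩⟩
  · refine ⟨U ∩ (piece R A (!i))ᶜ, f, N,
      hc.mono (hc.isOpen.inter (isClosed_piece R A _).isOpen_compl) inter_subset_left,
      ⟨hx, hx'⟩, hf, hN, fun y hy hfy => ⟨hc.isInwardNormal hy.1 hfy, fun h' => absurd h' hy.2⟩⟩

theorem contMDiff_inner_self (g : Metric d M) :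
    ContMDiff (𝓡 (d + 1)).tangent 𝓘(ℝ, ℝ) ∞
      (fun ζ : TangentBundle (𝓡 (d + 1)) M => g.inner ζ.proj ζ.snd ζ.snd) := fun _ =>
  contMDiffAt_inner g (b := fun ζ : TangentBundle (𝓡 (d + 1)) M => ζ.proj)
    (v := fun ζ => ζ.snd) (w := fun ζ => ζ.snd) contMDiffAt_id contMDiffAt_id

theorem continuous_stateProj :
    Continuous fun ζ : TangentBundle (𝓡 (d + 1)) M => ζ.proj :=
  FiberBundle.continuous_proj (Model d) _

theorem BoundaryChart.contMDiffAt_inner_normal {g : Metric d M} {D U : Set M} {f : M → ℝ}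
    {N : ∀ x : M, TangentSpace (𝓡 (d + 1)) x} (h : BoundaryChart g D U f N)
    {ζ : TangentBundle (𝓡 (d + 1)) M} (hζ : ζ.proj ∈ U) :
    ContMDiffAt (𝓡 (d + 1)).tangent 𝓘(ℝ, ℝ) ∞
      (fun ζ : TangentBundle (𝓡 (d + 1)) M => g.inner ζ.proj (N ζ.proj) ζ.snd) ζ :=
  contMDiffAt_inner g (b := fun ζ : TangentBundle (𝓡 (d + 1)) M => ζ.proj)
    (v := fun ζ => N ζ.proj) (w := fun ζ => ζ.snd)
    ((h.smooth_normal _ hζ).comp ζ (Bundle.contMDiff_proj (TangentSpace (𝓡 (d + 1)))).contMDiffAt)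
    contMDiffAt_id

theorem BoundaryChart.eventually_mem {g : Metric d M} {D U : Set M} {f : M → ℝ}
    {N : ∀ x : M, TangentSpace (𝓡 (d + 1)) x} (h : BoundaryChart g D U f N)
    {ζ : TangentBundle (𝓡 (d + 1)) M} (hζ : ζ.proj ∈ U) : ∀ᶠ ζ' in 𝓝 ζ, ζ'.proj ∈ U :=
  (h.isOpen.preimage continuous_stateProj).mem_nhds hζ

/-- Near a transverse state, transversality can be read off from a single boundary chart. -/
theorem exists_boundaryChart_of_mem_transverse {g : Metric d M} {R A : Set M} {m C E : ℝ}
    {z : State d M} (hz : z ∈ transverse g R A m C E) :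
    ∃ (U : Set M) (f : M → ℝ) (N : ∀ x : M, TangentSpace (𝓡 (d + 1)) x),
      BoundaryChart g (piece R A z.1) U f N ∧ z.2.proj ∈ U ∧ f z.2.proj = 0 ∧
      0 < g.inner z.2.proj (N z.2.proj) z.2.snd ∧
      (∀ y ∈ U, f y = 0 → IsRegular g R A z.1 y (N y)) := by
  obtain ⟨⟨ν, hν, hpos⟩, hs⟩ := hz
  obtain ⟨U, f, N, hc, hx, hf, rfl, hreg⟩ := hν.exists_boundaryChart
  exact ⟨U, f, N, hc, hx, hf, hpos, hreg⟩

theorem eventually_mem_transverse {g : Metric d M} {R A : Set M} {m C E : ℝ} (hm : 0 < m)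
    (hE : 0 < E) (hCE : C < E) {z : State d M} (hz : z ∈ transverse g R A m C E) :
    ∀ᶠ ζ in 𝓝 z.2, (z.1, ζ) ∈ phaseSpace g R A m C E → (z.1, ζ) ∈ transverse g R A m C E := by
  obtain ⟨U, f, N, hc, hx, hf, hpos, hreg⟩ := exists_boundaryChart_of_mem_transverse hz
  filter_upwards [hc.eventually_mem hx,
    (hc.contMDiffAt_inner_normal hx).continuousAt.eventually (lt_mem_nhds hpos)] with ζ h1 h2 h3
  obtain ⟨ν, hν, -⟩ := id h3
  have h4 := hc.eq_normal h1 hν.1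
  exact mem_transverse_of_mem_phaseSpace hm hE hCE h3 ⟨N ζ.proj, hreg _ h1 h4.1, h2⟩

theorem eventually_state_iff {z₀ : State d M} {p : State d M → Prop} :
    (∀ᶠ z in 𝓝 z₀, p z) ↔ ∀ᶠ ζ in 𝓝 z₀.2, p (z₀.1, ζ) := by
  rw [show 𝓝 z₀ = 𝓝 (z₀.1, z₀.2) from rfl, nhds_prod_eq, nhds_discrete, Filter.pure_prod,
    Filter.eventually_map]

/-- A locally closed set is measurable. -/
theorem measurableSet_of_eventually_closure {X : Type*} [TopologicalSpace X] [MeasurableSpace X]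
    [OpensMeasurableSpace X] {s : Set X} (h : ∀ x ∈ s, ∀ᶠ y in 𝓝 x, y ∈ closure s → y ∈ s) :
    MeasurableSet s := by
  have h1 : s = closure s ∩ interior {y | y ∈ closure s → y ∈ s} := by
    refine Subset.antisymm (fun x hx => ⟨subset_closure hx, ?_⟩) fun x hx => ?_
    · exact mem_interior_iff_mem_nhds.2 (h x hx)
    · exact interior_subset hx.2 hx.1
  rw [h1]
  exact isClosed_closure.measurableSet.inter isOpen_interior.measurableSet

/-- A relatively open subset of a measurable set is measurable. -/
theorem measurableSet_of_eventually {X : Type*} [TopologicalSpace X] [MeasurableSpace X]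
    [OpensMeasurableSpace X] {s t : Set X} (ht : MeasurableSet t) (hst : s ⊆ t)
    (h : ∀ x ∈ s, ∀ᶠ y in 𝓝 x, y ∈ t → y ∈ s) : MeasurableSet s := by
  have h1 : s = t ∩ interior {y | y ∈ t → y ∈ s} := by
    refine Subset.antisymm (fun x hx => ⟨hst hx, ?_⟩) fun x hx => ?_
    · exact mem_interior_iff_mem_nhds.2 (h x hx)
    · exact interior_subset hx.2 hx.1
  rw [h1]
  exact ht.inter isOpen_interior.measurableSet

theorem eq_of_frequently_eq {X : Type*} [TopologicalSpace X] {f : X → ℝ} {x : X} {c : ℝ}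
    (hf : ContinuousAt f x) (h : ∃ᶠ y in 𝓝 x, f y = c) : f x = c := by
  by_contra hne
  exact h (hf.eventually_ne hne)

theorem measurableSet_transverse (g : Metric d M) (R A : Set M) (m C E : ℝ) :
    MeasurableSet (transverse g R A m C E) := by
  refine measurableSet_of_eventually_closure fun z hz => ?_
  obtain ⟨U, f, N, hc, hx, hf, hpos, hreg⟩ := exists_boundaryChart_of_mem_transverse hz
  rw [eventually_state_iff]
  have hev : ∀ᶠ ζ in 𝓝 z.2, ζ.proj ∈ U ∧ 0 < g.inner ζ.proj (N ζ.proj) ζ.snd :=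
    (hc.eventually_mem hx).and
      ((hc.contMDiffAt_inner_normal hx).continuousAt.eventually (lt_mem_nhds hpos))
  filter_upwards [hev, hev.eventually_nhds] with ζ h1 h2 h3
  have h4 : ∃ᶠ ζ' in 𝓝 ζ, (z.1, ζ') ∈ transverse g R A m C E := by
    rw [mem_closure_iff_frequently] at h3
    intro h5
    exact h3 (eventually_state_iff.2 h5)
  have h5 : ∃ᶠ ζ' in 𝓝 ζ, f ζ'.proj = 0 ∧
      g.inner ζ'.proj ζ'.snd ζ'.snd = 2 * (E - potential C z.1) / m := by
    refine (h4.and_eventually h2).mono ?_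
    rintro ζ' ⟨⟨⟨ν, hν, -⟩, hs⟩, hU, -⟩
    exact ⟨(hc.eq_normal hU hν.1).1, hs⟩
  have h6 : f ζ.proj = 0 := eq_of_frequently_eq (f := fun ζ => f ζ.proj)
    ((hc.mdifferentiableAt h1.1).continuousAt.comp continuous_stateProj.continuousAt)
    (h5.mono fun _ h => h.1)
  exact ⟨⟨N ζ.proj, hreg _ h1.1 h6, h1.2⟩,
    eq_of_frequently_eq
      (f := fun ζ : TangentBundle (𝓡 (d + 1)) M => g.inner ζ.proj ζ.snd ζ.snd)
      (contMDiff_inner_self g).continuous.continuousAt (h5.mono fun _ h => h.2)⟩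

/-! ### Involutions that preserve the Liouville measure -/

/-- A smooth involution `h` of a relatively open set `S` of transverse states, extended by the
identity, that preserves the Liouville density of all parametrizations. -/
structure LiouvilleInvolution (g : Metric d M) (R A : Set M) (m C E : ℝ) (S : Set (State d M))
    (h : State d M → State d M) : Prop where
  subset : S ⊆ transverse g R A m C E
  maps : ∀ z ∈ S, h z ∈ S
  involutive : ∀ z ∈ S, h (h z) = z
  eq_off : ∀ z, z ∉ S → h z = z
  smooth : ∀ z ∈ S, ∃ (j : Bool) (k : TangentBundle (𝓡 (d + 1)) M → TangentBundle (𝓡 (d + 1)) M),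
    ContMDiffAt (𝓡 (d + 1)).tangent (𝓡 (d + 1)).tangent ∞ k z.2 ∧
    ∀ᶠ ζ in 𝓝 z.2, (z.1, ζ) ∈ transverse g R A m C E →
      (z.1, ζ) ∈ S ∧ h (z.1, ζ) = (j, k ζ)
  density : ∀ (i j : Bool) (ψ φ : Coord d → TangentBundle (𝓡 (d + 1)) M) (u : Coord d),
    (∀ᶠ u' in 𝓝 u, ContMDiffAt 𝓘(ℝ, Coord d) (𝓡 (d + 1)).tangent ∞ ψ u' ∧
      ContMDiffAt 𝓘(ℝ, Coord d) (𝓡 (d + 1)).tangent ∞ φ u' ∧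
      (i, ψ u') ∈ S ∧ h (i, ψ u') = (j, φ u')) →
    liouvilleDensity g φ u = liouvilleDensity g ψ u

namespace LiouvilleInvolution

variable {g : Metric d M} {R A : Set M} {m C E : ℝ} {S : Set (State d M)}
  {h : State d M → State d M}

theorem measurableSet (H : LiouvilleInvolution g R A m C E S h) : MeasurableSet S := by
  refine measurableSet_of_eventually (measurableSet_transverse g R A m C E) H.subset fun z hz => ?_
  obtain ⟨j, k, -, hk⟩ := H.smooth z hz
  rw [eventually_state_iff]
  exact hk.mono fun ζ hζ h' => (hζ h').1

theorem continuousOn (H : LiouvilleInvolution g R A m C E S h) : ContinuousOn h S := by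
  intro z hz
  obtain ⟨j, k, hk, hk'⟩ := H.smooth z hz
  have h1 : ContinuousAt (fun z : State d M => (j, k z.2)) z :=
    continuousAt_const.prodMk (hk.continuousAt.comp continuousAt_snd)
  refine (h1.continuousWithinAt (s := S)).congr_of_eventuallyEq ?_
    (hk'.self_of_nhds (H.subset hz)).2
  have h2 : ∀ᶠ z' in 𝓝 z, z' ∈ transverse g R A m C E → h z' = (j, k z'.2) :=
    eventually_state_iff.2 (hk'.mono fun ζ hζ h' => (hζ h').2)
  filter_upwards [nhdsWithin_le_nhds h2, self_mem_nhdsWithin] with z' h3 h4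
  exact h3 (H.subset h4)

theorem measurable (H : LiouvilleInvolution g R A m C E S h) : Measurable h := by
  refine measurable_of_restrict_of_restrict_compl H.measurableSet
    H.continuousOn.domRestrict.measurable ?_
  have h1 : Sᶜ.domRestrict h = Subtype.val := by
    ext1 z
    exact H.eq_off z z.2
  rw [h1]
  exact measurable_subtype_coe

end LiouvilleInvolution

namespace Parametrization

variable {g : Metric d M} {R A : Set M} {m C E : ℝ}

theorem measure_apply (P : Parametrization g R A m C E) {B : Set (State d M)}
    (hB : MeasurableSet B) :
    P.measure B = ∫⁻ u in {u | (P.side, P.toFun u) ∈ B} ∩ P.dom, liouvilleDensity g P.toFun u := by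
  have h1 : AEMeasurable (fun u => (P.side, P.toFun u))
      ((volume : Measure (Coord d)).restrict P.dom) :=
    aemeasurable_const.prodMk (P.smooth.continuousOn.aemeasurable P.isOpen_dom.measurableSet)
  rw [measure, Measure.map_apply_of_aemeasurable
    (h1.mono_ac (withDensity_absolutelyContinuous _ _)) hB, withDensity_apply',
    Measure.restrict_restrict' P.isOpen_dom.measurableSet]
  rfl

theorem measure_le (P : Parametrization g R A m C E) : P.measure ≤ liouvilleMeasure g R A m C E :=
  le_iSup (fun P : Parametrization g R A m C E => P.measure) P

end Parametrization

namespace LiouvilleInvolution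

variable {g : Metric d M} {R A : Set M} {m C E : ℝ} {S : Set (State d M)}
  {h : State d M → State d M}

/-- The part of the domain of a parametrization that `h` maps to the component `j`. -/
def domPart (S : Set (State d M)) (h : State d M → State d M)
    (P : Parametrization g R A m C E) (j : Bool) : Set (Coord d) :=
  {u | u ∈ P.dom ∧ (P.side, P.toFun u) ∈ S ∧ (h (P.side, P.toFun u)).1 = j}

theorem eventually_domPart (H : LiouvilleInvolution g R A m C E S h) (hm : 0 < m) (hE : 0 < E)
    (hCE : C < E) (P : Parametrization g R A m C E) {j : Bool} {u : Coord d}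
    (hu : u ∈ domPart S h P j) :
    ∃ k : TangentBundle (𝓡 (d + 1)) M → TangentBundle (𝓡 (d + 1)) M,
      ContMDiffAt (𝓡 (d + 1)).tangent (𝓡 (d + 1)).tangent ∞ k (P.toFun u) ∧
      ∀ᶠ u' in 𝓝 u, u' ∈ domPart S h P j ∧ h (P.side, P.toFun u') = (j, k (P.toFun u')) := by
  obtain ⟨hud, huS, huj⟩ := hu
  obtain ⟨j', k, hk, hk'⟩ := H.smooth _ huS
  have h1 := (hk'.self_of_nhds (H.subset huS)).2
  have h2 : j' = j := by
    have h3 : (h (P.side, P.toFun u)).1 = j' := congrArg Prod.fst h1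
    exact h3.symm.trans huj
  subst h2
  have hcont : ContinuousAt P.toFun u :=
    P.smooth.continuousOn.continuousAt (P.isOpen_dom.mem_nhds hud)
  refine ⟨k, hk, ?_⟩
  filter_upwards [P.isOpen_dom.mem_nhds hud, hcont.eventually hk',
    hcont.eventually (eventually_mem_transverse hm hE hCE (H.subset huS))] with u' h3 h4 h5
  have h6 := h4 (h5 (P.mem_phaseSpace u' h3))
  exact ⟨⟨h3, h6.1, congrArg Prod.fst h6.2⟩, h6.2⟩

/-- The image of a part of a parametrization under the involution. -/
def imageParametrization (H : LiouvilleInvolution g R A m C E S h) (hm : 0 < m) (hE : 0 < E)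
    (hCE : C < E) (P : Parametrization g R A m C E) (j : Bool) :
    Parametrization g R A m C E where
  side := j
  dom := domPart S h P j
  toFun u := (h (P.side, P.toFun u)).2
  isOpen_dom := isOpen_iff_mem_nhds.2 fun u hu => by
    obtain ⟨k, -, hk⟩ := H.eventually_domPart hm hE hCE P hu
    exact hk.mono fun u' h' => h'.1
  smooth := fun u hu => by
    obtain ⟨k, hk, hk'⟩ := H.eventually_domPart hm hE hCE P hu
    have h1 := P.smooth.contMDiffAt (P.isOpen_dom.mem_nhds hu.1)
    refine ((hk.comp u h1).congr_of_eventuallyEq ?_).contMDiffWithinAt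
    filter_upwards [hk'] with u' h'
    exact congrArg Prod.snd h'.2
  injOn := fun u hu u' hu' he => by
    have h1 : h (P.side, P.toFun u) = h (P.side, P.toFun u') :=
      Prod.ext (hu.2.2.trans hu'.2.2.symm) he
    have h2 := congrArg h h1
    rw [H.involutive _ hu.2.1, H.involutive _ hu'.2.1] at h2
    exact P.injOn hu.1 hu'.1 (congrArg Prod.snd h2)
  mem_phaseSpace := fun u hu => by
    have h1 := transverse_subset_phaseSpace g R A m C E (H.subset (H.maps _ hu.2.1))
    have h2 : h (P.side, P.toFun u) = (j, (h (P.side, P.toFun u)).2) := Prod.ext hu.2.2 rfl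
    rwa [h2] at h1

theorem liouvilleDensity_image (H : LiouvilleInvolution g R A m C E S h) (hm : 0 < m) (hE : 0 < E)
    (hCE : C < E) (P : Parametrization g R A m C E) {j : Bool} {u : Coord d}
    (hu : u ∈ domPart S h P j) :
    liouvilleDensity g (H.imageParametrization hm hE hCE P j).toFun u =
      liouvilleDensity g P.toFun u := by
  refine H.density P.side j _ _ u ?_
  filter_upwards [(H.imageParametrization hm hE hCE P j).isOpen_dom.mem_nhds hu] with u' hu'
  refine ⟨P.smooth.contMDiffAt (P.isOpen_dom.mem_nhds hu'.1),
    (H.imageParametrization hm hE hCE P j).smooth.contMDiffAt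
      ((H.imageParametrization hm hE hCE P j).isOpen_dom.mem_nhds hu'), hu'.2.1,
    Prod.ext hu'.2.2 rfl⟩

/-- For a single parametrization, the Liouville mass of `B` in the part of the domain that `h` sends
to the component `j` is at most the mass of the preimage of `B` in the component `j`: there, the image
parametrization has the same density. -/
theorem setLIntegral_domPart_le (H : LiouvilleInvolution g R A m C E S h) (hm : 0 < m)
    (hE : 0 < E) (hCE : C < E) (P : Parametrization g R A m C E) (j : Bool) {B : Set (State d M)}
    (hB : MeasurableSet B) :
    ∫⁻ u in {u | (P.side, P.toFun u) ∈ B} ∩ domPart S h P j, liouvilleDensity g P.toFun u ≤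
      liouvilleMeasure g R A m C E (h ⁻¹' B ∩ S ∩ {z | z.1 = j}) := by
  have hj : MeasurableSet {z : State d M | z.1 = j} :=
    measurable_fst (measurableSet_singleton j)
  have hB' := ((H.measurable hB).inter H.measurableSet).inter hj
  refine le_trans (le_of_eq ?_) ((H.imageParametrization hm hE hCE P j).measure_le _)
  rw [Parametrization.measure_apply _ hB']
  have hopen : MeasurableSet (domPart S h P j) :=
    (H.imageParametrization hm hE hCE P j).isOpen_dom.measurableSet
  have hset : {u | (P.side, P.toFun u) ∈ B} ∩ domPart S h P j =
      {u | (j, (h (P.side, P.toFun u)).2) ∈ h ⁻¹' B ∩ S ∩ {z | z.1 = j}} ∩ domPart S h P j := by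
    ext u
    refine and_congr_left fun hu => ?_
    have h2 : (j, (h (P.side, P.toFun u)).2) = h (P.side, P.toFun u) := Prod.ext hu.2.2.symm rfl
    change _ ↔ (j, (h (P.side, P.toFun u)).2) ∈ h ⁻¹' B ∩ S ∩ {z | z.1 = j}
    rw [h2]
    refine ⟨fun hb => ⟨⟨?_, H.maps _ hu.2.1⟩, hu.2.2⟩, fun hb => ?_⟩
    · rw [mem_preimage, H.involutive _ hu.2.1]
      exact hb
    · have := hb.1.1
      rwa [mem_preimage, H.involutive _ hu.2.1] at this
  have hdens : ∀ u ∈ domPart S h P j, liouvilleDensity g P.toFun u =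
      liouvilleDensity g (H.imageParametrization hm hE hCE P j).toFun u := fun u hu =>
    (H.liouvilleDensity_image hm hE hCE P hu).symm
  rw [hset]
  change _ = ∫⁻ u in {u | (j, (h (P.side, P.toFun u)).2) ∈ h ⁻¹' B ∩ S ∩ {z | z.1 = j}} ∩
    domPart S h P j, liouvilleDensity g (H.imageParametrization hm hE hCE P j).toFun u
  rw [← Measure.restrict_restrict' hopen]
  refine lintegral_congr_ae (ae_restrict_of_ae ?_)
  filter_upwards [ae_restrict_mem hopen] with u hu
  exact hdens u hu

/-- The involution preserves the Liouville measure. -/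
theorem measurePreserving (H : LiouvilleInvolution g R A m C E S h) (hm : 0 < m) (hE : 0 < E)
    (hCE : C < E) :
    MeasurePreserving h (liouvilleMeasure g R A m C E) (liouvilleMeasure g R A m C E) := by
  set μ := liouvilleMeasure g R A m C E with hμ
  refine ⟨H.measurable, ?_⟩
  have hle : μ ≤ μ.map h := by
    rw [hμ, liouvilleMeasure]
    refine iSup_le fun P => Measure.le_iff.2 fun B hB => ?_
    change P.measure B ≤ (liouvilleMeasure g R A m C E).map h B
    rw [← hμ, Measure.map_apply H.measurable hB]
    have hj : ∀ j, MeasurableSet {z : State d M | z.1 = j} := fun j =>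
      measurable_fst (measurableSet_singleton j)
    have hoff : h ⁻¹' B \ S = B \ S := by
      ext z
      refine and_congr_left fun hz => ?_
      rw [mem_preimage, H.eq_off z hz]
    have h1 : {u | (P.side, P.toFun u) ∈ B} ∩ P.dom ⊆
        ({u | (P.side, P.toFun u) ∈ B} ∩ domPart S h P true ∪
          {u | (P.side, P.toFun u) ∈ B} ∩ domPart S h P false) ∪
          ({u | (P.side, P.toFun u) ∈ B \ S} ∩ P.dom) := by
      rintro u ⟨hu, hud⟩
      by_cases huS : (P.side, P.toFun u) ∈ S
      · cases hj' : (h (P.side, P.toFun u)).1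
        · exact .inl (.inr ⟨hu, hud, huS, hj'⟩)
        · exact .inl (.inl ⟨hu, hud, huS, hj'⟩)
      · exact .inr ⟨⟨hu, huS⟩, hud⟩
    calc P.measure B = _ := P.measure_apply hB
      _ ≤ _ := lintegral_mono_set h1
      _ ≤ _ := lintegral_union_le _ _ _
      _ ≤ _ := add_le_add_left (lintegral_union_le _ _ _) _
      _ ≤ (μ (h ⁻¹' B ∩ S ∩ {z | z.1 = true}) + μ (h ⁻¹' B ∩ S ∩ {z | z.1 = false})) +
          μ (B \ S) := by
        refine add_le_add (add_le_add (H.setLIntegral_domPart_le hm hE hCE P true hB)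
          (H.setLIntegral_domPart_le hm hE hCE P false hB)) ?_
        rw [← P.measure_apply (hB.diff H.measurableSet)]
        exact P.measure_le _
      _ = μ (h ⁻¹' B) := by
        rw [← hoff, ← measure_inter_add_sdiff (h ⁻¹' B) H.measurableSet,
          ← measure_inter_add_sdiff (h ⁻¹' B ∩ S) (hj true)]
        congr 3
        ext z
        exact and_congr_right fun _ => by simp
  refine le_antisymm ?_ hle
  -- The opposite inequality is the image of the first one under the involution.
  have h2 := Measure.map_mono hle H.measurable
  rw [Measure.map_map H.measurable H.measurable] at h2
  have h3 : h ∘ h = id := by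
    ext1 z
    by_cases hz : z ∈ S
    · exact H.involutive z hz
    · simp only [Function.comp_apply, H.eq_off z hz, id]
  rwa [h3, Measure.map_id] at h2

end LiouvilleInvolution

/-! ### Reflection and refraction of transverse states -/

open Classical in
/-- The inward unit normal of `D`, with junk value zero where there is none. -/
def inwardNormal (g : Metric d M) (D : Set M) (x : M) : TangentSpace (𝓡 (d + 1)) x :=
  if h : ∃ ν, IsInwardNormal g D x ν then h.choose else 0

theorem IsInwardNormal.inwardNormal_eq {g : Metric d M} {D : Set M} {x : M}
    {ν : TangentSpace (𝓡 (d + 1)) x} (h : IsInwardNormal g D x ν) : inwardNormal g D x = ν := by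
  have hex : ∃ ν, IsInwardNormal g D x ν := ⟨ν, h⟩
  rw [inwardNormal, dif_pos hex]
  exact hex.choose_spec.unique h

/-- The component of the velocity along the inward normal. -/
def normalSpeed (g : Metric d M) (D : Set M) (ζ : TangentBundle (𝓡 (d + 1)) M) : ℝ :=
  g.inner ζ.proj (inwardNormal g D ζ.proj) ζ.snd

/-- Multiply the velocity by `ε` and add `β` times the inward normal. -/
def changeVelocity (g : Metric d M) (D : Set M) (ε β : ℝ) (ζ : TangentBundle (𝓡 (d + 1)) M) :
    TangentBundle (𝓡 (d + 1)) M :=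
  ⟨ζ.proj, ε • ζ.snd + β • inwardNormal g D ζ.proj⟩

theorem normalSpeed_changeVelocity {g : Metric d M} {D : Set M}
    {ζ : TangentBundle (𝓡 (d + 1)) M} (h : IsInwardNormal g D ζ.proj (inwardNormal g D ζ.proj))
    (ε β : ℝ) :
    normalSpeed g D (changeVelocity g D ε β ζ) = ε * normalSpeed g D ζ + β := by
  have h1 := h.1
  change g.inner ζ.proj (inwardNormal g D ζ.proj) (ε • ζ.snd + β • inwardNormal g D ζ.proj) =
    ε * g.inner ζ.proj (inwardNormal g D ζ.proj) ζ.snd + β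
  rw [Metric.inner_add_right, Metric.inner_smul_right, Metric.inner_smul_right, h1, mul_one]

theorem inner_self_changeVelocity {g : Metric d M} {D : Set M}
    {ζ : TangentBundle (𝓡 (d + 1)) M} (h : IsInwardNormal g D ζ.proj (inwardNormal g D ζ.proj))
    (ε β : ℝ) :
    g.inner (changeVelocity g D ε β ζ).proj (changeVelocity g D ε β ζ).snd
      (changeVelocity g D ε β ζ).snd =
      ε ^ 2 * g.inner ζ.proj ζ.snd ζ.snd + 2 * ε * β * normalSpeed g D ζ + β ^ 2 := by
  have h1 := h.1
  have h2 := g.symm ζ.proj (inwardNormal g D ζ.proj) ζ.snd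
  change g.inner ζ.proj (ε • ζ.snd + β • inwardNormal g D ζ.proj)
    (ε • ζ.snd + β • inwardNormal g D ζ.proj) = ε ^ 2 * g.inner ζ.proj ζ.snd ζ.snd +
      2 * ε * β * g.inner ζ.proj (inwardNormal g D ζ.proj) ζ.snd + β ^ 2
  rw [Metric.inner_add_right, Metric.inner_smul_right, Metric.inner_smul_right,
    Metric.inner_add_left, Metric.inner_smul_left, Metric.inner_smul_left, Metric.inner_add_left,
    Metric.inner_smul_left, Metric.inner_smul_left, h1, ← h2]
  ring

theorem changeVelocity_changeVelocity (g : Metric d M) (D : Set M) (ε β ε' β' : ℝ)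
    (ζ : TangentBundle (𝓡 (d + 1)) M) :
    changeVelocity g D ε' β' (changeVelocity g D ε β ζ) =
      changeVelocity g D (ε' * ε) (ε' * β + β') ζ := by
  have h : ε' • (ε • ζ.snd + β • inwardNormal g D ζ.proj) + β' • inwardNormal g D ζ.proj =
      (ε' * ε) • ζ.snd + (ε' * β + β') • inwardNormal g D ζ.proj := by module
  exact congrArg (fun v => (⟨ζ.proj, v⟩ : TangentBundle (𝓡 (d + 1)) M)) h

theorem changeVelocity_one_zero (g : Metric d M) (D : Set M) (ζ : TangentBundle (𝓡 (d + 1)) M) :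
    changeVelocity g D 1 0 ζ = ζ := by
  have h : (1 : ℝ) • ζ.snd + (0 : ℝ) • inwardNormal g D ζ.proj = ζ.snd := by module
  exact congrArg (fun v => (⟨ζ.proj, v⟩ : TangentBundle (𝓡 (d + 1)) M)) h

theorem changeVelocity_of_neg {g : Metric d M} {D D' : Set M} {ζ : TangentBundle (𝓡 (d + 1)) M}
    (h : inwardNormal g D' ζ.proj = -inwardNormal g D ζ.proj) (ε β : ℝ) :
    changeVelocity g D' ε β ζ = changeVelocity g D ε (-β) ζ := by
  have h : ε • ζ.snd + β • inwardNormal g D' ζ.proj =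
      ε • ζ.snd + (-β) • inwardNormal g D ζ.proj := by
    rw [h]
    module
  exact congrArg (fun v => (⟨ζ.proj, v⟩ : TangentBundle (𝓡 (d + 1)) M)) h

theorem normalSpeed_of_neg {g : Metric d M} {D D' : Set M} {ζ : TangentBundle (𝓡 (d + 1)) M}
    (h : inwardNormal g D' ζ.proj = -inwardNormal g D ζ.proj) :
    normalSpeed g D' ζ = -normalSpeed g D ζ := by
  rw [normalSpeed, h, Metric.inner_neg_left, normalSpeed]

/-- Changing the velocity by `ε = ±1` and a normal vector preserves the Liouville density, since
the canonical one-form sees the tangential part of the velocity only. -/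
theorem liouvilleDensity_changeVelocity {g : Metric d M} {D : Set M} {ε : ℝ}
    (hε : ε = 1 ∨ ε = -1) {β : TangentBundle (𝓡 (d + 1)) M → ℝ}
    {ψ φ : Coord d → TangentBundle (𝓡 (d + 1)) M} {u : Coord d}
    (h : ∀ᶠ u' in 𝓝 u, ContMDiffAt 𝓘(ℝ, Coord d) (𝓡 (d + 1)).tangent ∞ ψ u' ∧
      IsInwardNormal g D (ψ u').proj (inwardNormal g D (ψ u').proj) ∧
      φ u' = changeVelocity g D ε (β (ψ u')) (ψ u')) :
    liouvilleDensity g φ u = liouvilleDensity g ψ u := by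
  refine liouvilleDensity_eq g hε (T := fun _ => 0) contDiffAt_const (h.mono fun u' h => h.1)
    fun a => ?_
  filter_upwards [h, h.eventually_nhds] with u' h1 h2
  rw [pullbackForm_congr g (h2.mono fun u'' h => h.2.2) a]
  have h3 := inner_normal_mfderiv_eq_zero (mdifferentiableAt_proj h1.1)
    (h2.mono fun u'' h => h.2.1.mem_frontier) h1.2.1 (Pi.single a 1)
  have h4 : fderiv ℝ (fun _ : Coord d => (0 : ℝ)) u' (Pi.single a 1) = 0 := by simp
  rw [h4, add_zero]
  change g.inner (ψ u').proj (ε • (ψ u').snd + β (ψ u') • inwardNormal g D (ψ u').proj)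
    (mfderiv 𝓘(ℝ, Coord d) (𝓡 (d + 1)) (fun u' => (ψ u').proj) u' (Pi.single a 1)) =
    ε * g.inner (ψ u').proj (ψ u').snd
      (mfderiv 𝓘(ℝ, Coord d) (𝓡 (d + 1)) (fun u' => (ψ u').proj) u' (Pi.single a 1))
  rw [Metric.inner_add_left, Metric.inner_smul_left, Metric.inner_smul_left, h3, mul_zero,
    add_zero]

theorem BoundaryChart.contMDiffAt_changeVelocity {g : Metric d M} {D U : Set M} {f : M → ℝ}
    {N : ∀ x : M, TangentSpace (𝓡 (d + 1)) x} (h : BoundaryChart g D U f N)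
    {ζ₀ : TangentBundle (𝓡 (d + 1)) M} (hζ : ζ₀.proj ∈ U) (ε : ℝ)
    {β : TangentBundle (𝓡 (d + 1)) M → ℝ}
    (hβ : ContMDiffAt (𝓡 (d + 1)).tangent 𝓘(ℝ, ℝ) ∞ β ζ₀) :
    ContMDiffAt (𝓡 (d + 1)).tangent (𝓡 (d + 1)).tangent ∞
      (fun ζ => (⟨ζ.proj, ε • ζ.snd + β ζ • N ζ.proj⟩ : TangentBundle (𝓡 (d + 1)) M)) ζ₀ :=
  contMDiffAt_velocity_combination contMDiffAt_const hβ (h.smooth_normal _ hζ)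

theorem changeVelocity_eq {g : Metric d M} {D : Set M}
    {N : ∀ x : M, TangentSpace (𝓡 (d + 1)) x} {ζ : TangentBundle (𝓡 (d + 1)) M}
    (h : IsInwardNormal g D ζ.proj (N ζ.proj)) (ε β : ℝ) :
    changeVelocity g D ε β ζ = ⟨ζ.proj, ε • ζ.snd + β • N ζ.proj⟩ := by
  rw [changeVelocity, h.inwardNormal_eq]

theorem normalSpeed_eq {g : Metric d M} {D : Set M}
    {N : ∀ x : M, TangentSpace (𝓡 (d + 1)) x} {ζ : TangentBundle (𝓡 (d + 1)) M}
    (h : IsInwardNormal g D ζ.proj (N ζ.proj)) :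
    normalSpeed g D ζ = g.inner ζ.proj (N ζ.proj) ζ.snd := by
  rw [normalSpeed, h.inwardNormal_eq]

theorem isRegular_of_mem_transverse {g : Metric d M} {R A : Set M} {m C E : ℝ} {z : State d M}
    (hz : z ∈ transverse g R A m C E) :
    IsRegular g R A z.1 z.2.proj (inwardNormal g (piece R A z.1) z.2.proj) ∧
      0 < normalSpeed g (piece R A z.1) z.2 := by
  obtain ⟨⟨ν, hν, hpos⟩, -⟩ := hz
  have h := hν.1.inwardNormal_eq
  rw [normalSpeed, h]
  exact ⟨hν, hpos⟩

open Classical in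
/-- The reflection of the velocity in the normal line: the tangential part changes its sign, and
the normal part is kept. This is the collision law for a reversed incoming velocity; it is extended
by the identity to states that are not transverse. -/
def reflect (g : Metric d M) (R A : Set M) (m C E : ℝ) (z : State d M) : State d M :=
  if z ∈ transverse g R A m C E then
    (z.1, changeVelocity g (piece R A z.1) (-1) (2 * normalSpeed g (piece R A z.1) z.2) z.2)
  else z

theorem reflect_mem {g : Metric d M} {R A : Set M} {m C E : ℝ} {z : State d M}
    (hz : z ∈ transverse g R A m C E) : reflect g R A m C E z ∈ transverse g R A m C E := by
  obtain ⟨hreg, hpos⟩ := isRegular_of_mem_transverse hz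
  rw [reflect, if_pos hz]
  refine ⟨⟨_, hreg, ?_⟩, ?_⟩
  · have := normalSpeed_changeVelocity hreg.1 (-1) (2 * normalSpeed g (piece R A z.1) z.2)
    change 0 < normalSpeed g (piece R A z.1) _
    rw [this]
    linarith
  · refine (inner_self_changeVelocity hreg.1 _ _).trans (Eq.trans ?_ hz.2)
    ring

theorem reflect_reflect {g : Metric d M} {R A : Set M} {m C E : ℝ} {z : State d M}
    (hz : z ∈ transverse g R A m C E) :
    reflect g R A m C E (reflect g R A m C E z) = z := by
  obtain ⟨hreg, hpos⟩ := isRegular_of_mem_transverse hz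
  have h1 : reflect g R A m C E z = (z.1, changeVelocity g (piece R A z.1) (-1)
    (2 * normalSpeed g (piece R A z.1) z.2) z.2) := if_pos hz
  rw [reflect, if_pos (reflect_mem hz), h1]
  refine Prod.ext rfl ?_
  simp only
  rw [normalSpeed_changeVelocity hreg.1, changeVelocity_changeVelocity]
  convert changeVelocity_one_zero g (piece R A z.1) z.2 using 2 <;> ring

theorem liouvilleInvolution_reflect (g : Metric d M) (R A : Set M) (m C E : ℝ) :
    LiouvilleInvolution g R A m C E (transverse g R A m C E) (reflect g R A m C E) where
  subset := Subset.rfl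
  maps _ hz := reflect_mem hz
  involutive _ hz := reflect_reflect hz
  eq_off z hz := if_neg hz
  smooth z hz := by
    obtain ⟨U, f, N, hc, hx, hf, hpos, hreg⟩ := exists_boundaryChart_of_mem_transverse hz
    refine ⟨z.1, _, hc.contMDiffAt_changeVelocity hx (-1)
      (contMDiffAt_const.mul (hc.contMDiffAt_inner_normal hx) :
        ContMDiffAt (𝓡 (d + 1)).tangent 𝓘(ℝ, ℝ) ∞ (fun ζ : TangentBundle (𝓡 (d + 1)) M =>
          2 * g.inner ζ.proj (N ζ.proj) ζ.snd) z.2), ?_⟩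
    filter_upwards [hc.eventually_mem hx] with ζ hU hζ
    refine ⟨hζ, ?_⟩
    have hn := hc.isInwardNormal hU (hc.eq_normal hU (isRegular_of_mem_transverse hζ).1.1).1
    rw [reflect, if_pos hζ]
    simp only
    rw [changeVelocity_eq hn, normalSpeed_eq hn]
    rfl
  density i j ψ φ u hev := by
    refine liouvilleDensity_changeVelocity (D := piece R A i) (.inr rfl)
      (β := fun ζ => 2 * normalSpeed g (piece R A i) ζ) ?_
    filter_upwards [hev] with u' h
    obtain ⟨h1, -, h2, h3⟩ := h
    refine ⟨h1, (isRegular_of_mem_transverse h2).1.1, ?_⟩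
    rw [reflect, if_pos h2] at h3
    exact (congrArg Prod.snd h3).symm

/-- In the interior of `R`, the two components lie on different sides of a smooth boundary
piece. -/
theorem BoundaryChart.mem_piece_not_iff {g : Metric d M} {R A U : Set M}
    (hA : ∃ O : Set M, IsOpen O ∧ A = O ∩ R) {i : Bool} {f : M → ℝ}
    {N : ∀ x : M, TangentSpace (𝓡 (d + 1)) x} (h : BoundaryChart g (piece R A i) U f N)
    (hU : U ⊆ interior R) {y : M} (hy : y ∈ U) : y ∈ piece R A (!i) ↔ f y ≤ 0 := by
  have hneg : ∀ y ∈ U, f y < 0 → y ∈ piece R A (!i) := by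
    intro y hy hfy
    have h1 : y ∉ piece R A i := fun h2 => absurd ((h.mem_iff y hy).1 h2) (not_le.2 hfy)
    have hyR : y ∈ R := interior_subset (hU hy)
    cases i
    · exact by_contra fun h2 => h1 (subset_closure ⟨hyR, h2⟩)
    · exact subset_closure ⟨hyR, h1⟩
  constructor
  · intro hmem
    by_contra hf
    have hint := h.mem_interior hy (not_le.1 hf)
    cases i
    · -- Near `y`, points of `A` form an open set, which cannot meet the closure of `R \ A`.
      obtain ⟨O, hO, rfl⟩ := hA
      have hmem' : y ∈ closure (O ∩ R) := hmem
      obtain ⟨a, ⟨ha1, ha2⟩, haO, haR⟩ := mem_closure_iff.1 hmem'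
        (interior (piece R (O ∩ R) false) ∩ U) (isOpen_interior.inter h.isOpen) ⟨hint, hy⟩
      have ha3 : a ∈ closure (R \ closure (O ∩ R)) := interior_subset ha1
      obtain ⟨b, ⟨hb1, hb2⟩, hb3, hb4⟩ := mem_closure_iff.1 ha3 (O ∩ U) (hO.inter h.isOpen)
        ⟨haO, ha2⟩
      exact hb4 (subset_closure ⟨hb1, hb3⟩)
    · have hmem' : y ∈ closure (R \ closure A) := hmem
      obtain ⟨b, hb1, hb2, hb3⟩ := mem_closure_iff.1 hmem' _ isOpen_interior hint
      exact hb3 (interior_subset hb1)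
  · intro hf
    rcases hf.lt_or_eq with hf | hf
    · exact hneg y hy hf
    · exact (isClosed_piece R A (!i)).closure_subset_iff.2 (fun z hz => hneg z hz.1 hz.2)
        (h.mem_closure_neg hy hf)

theorem differential_neg (f : M → ℝ) (x : M) (w : TangentSpace (𝓡 (d + 1)) x) :
    differential (-f) x w = -differential f x w := by
  rw [differential, differential, mfderiv_neg]
  rfl

theorem BoundaryChart.neg {g : Metric d M} {R A U : Set M}
    (hA : ∃ O : Set M, IsOpen O ∧ A = O ∩ R) {i : Bool} {f : M → ℝ}
    {N : ∀ x : M, TangentSpace (𝓡 (d + 1)) x} (h : BoundaryChart g (piece R A i) U f N)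
    (hU : U ⊆ interior R) : BoundaryChart g (piece R A (!i)) U (-f) (fun x => -N x) where
  isOpen := h.isOpen
  smooth := h.smooth.neg
  mem_iff y hy := by
    rw [h.mem_piece_not_iff hA hU hy, Pi.neg_apply, neg_nonneg]
  smooth_normal y hy := by
    have h1 := (contMDiffAt_velocity_combination (ζ₀ := ⟨y, N y⟩) (a := fun _ => (-1 : ℝ))
      (b := fun _ => 0) contMDiffAt_const contMDiffAt_const (h.smooth_normal y hy)).comp y
        (h.smooth_normal y hy)
    refine h1.congr_of_eventuallyEq (Eventually.of_forall fun x => ?_)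
    have h2 : -N x = (-1 : ℝ) • N x + (0 : ℝ) • N x := by module
    exact congrArg (fun v => (⟨x, v⟩ : TangentBundle (𝓡 (d + 1)) M)) h2
  norm y hy := by
    rw [Metric.inner_neg_left, Metric.inner_neg_right, neg_neg, h.norm y hy]
  gradient y hy := by
    obtain ⟨c, hc, hdf⟩ := h.gradient y hy
    refine ⟨c, hc, fun w => ?_⟩
    rw [differential_neg, hdf, Metric.inner_neg_left, mul_neg]

/-- At the refracting boundary, the inward normals of the two components are opposite. -/
theorem IsRegular.not {g : Metric d M} {R A : Set M} (hA : ∃ O : Set M, IsOpen O ∧ A = O ∩ R)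
    {i : Bool} {x : M} {ν : TangentSpace (𝓡 (d + 1)) x} (h : IsRegular g R A i x ν)
    (hx : x ∈ piece R A (!i)) : IsRegular g R A (!i) x (-ν) := by
  obtain ⟨U, f, N, hc, hxU, hf, rfl⟩ := h.1.exists_boundaryChart
  have hc' := (hc.mono (hc.isOpen.inter isOpen_interior) inter_subset_left).neg hA
    inter_subset_right
  exact ⟨hc'.isInwardNormal ⟨hxU, h.2 hx⟩ (by simp [hf]), fun _ => h.2 hx⟩

/-- The square of the normal velocity after a refraction (if it is positive). -/
def refractedSq (g : Metric d M) (R A : Set M) (m C : ℝ) (z : State d M) : ℝ :=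
  normalSpeed g (piece R A z.1) z.2 ^ 2 - 2 / m * (potential C (!z.1) - potential C z.1)

/-- The transverse states over the refracting boundary that are refracted if their velocity, which
points inwards, is regarded as the outcome of a reflection. -/
def refracting (g : Metric d M) (R A : Set M) (m C E : ℝ) : Set (State d M) :=
  {z | z ∈ transverse g R A m C E ∧ z.2.proj ∈ piece R A (!z.1) ∧ 0 < refractedSq g R A m C z}

open Classical in
/-- The passage between the two copies of the refracting boundary. The normal component, which is
replaced by `-√b`, is taken with respect to the normal of the old piece, so that the new velocity
points into the other piece. -/
def refract (g : Metric d M) (R A : Set M) (m C E : ℝ) (z : State d M) : State d M :=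
  if z ∈ refracting g R A m C E then
    (!z.1, changeVelocity g (piece R A z.1) 1 (-normalSpeed g (piece R A z.1) z.2
      - Real.sqrt (refractedSq g R A m C z)) z.2)
  else z

theorem refract_mem_and_refract_refract {g : Metric d M} {R A : Set M} {m C E : ℝ} (hm : 0 < m)
    (hA : ∃ O : Set M, IsOpen O ∧ A = O ∩ R) {z : State d M}
    (hz : z ∈ refracting g R A m C E) :
    refract g R A m C E z ∈ refracting g R A m C E ∧
      refract g R A m C E (refract g R A m C E z) = z := by
  obtain ⟨hreg, hpos⟩ := isRegular_of_mem_transverse hz.1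
  have hreg' := hreg.not hA hz.2.1
  have hn := hreg'.1.inwardNormal_eq
  have hb := hz.2.2
  have h1 : refract g R A m C E z = (!z.1, changeVelocity g (piece R A z.1) 1
    (-normalSpeed g (piece R A z.1) z.2 - Real.sqrt (refractedSq g R A m C z)) z.2) := if_pos hz
  set a := normalSpeed g (piece R A z.1) z.2 with ha
  set b := refractedSq g R A m C z with hbdef
  set z' := refract g R A m C E z with hz'
  have hbeq : b = a ^ 2 - 2 / m * (potential C (!z.1) - potential C z.1) := rfl
  have h2 : normalSpeed g (piece R A (!z.1)) z'.2 = Real.sqrt b := by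
    rw [h1]
    simp only
    rw [normalSpeed_of_neg (D := piece R A z.1)
      (ζ := changeVelocity g (piece R A z.1) 1 (-a - Real.sqrt b) z.2) hn, normalSpeed_changeVelocity hreg.1, ← ha]
    ring
  have hsq := Real.sq_sqrt hb.le
  have hproj : z'.2.proj = z.2.proj := by rw [h1]; rfl
  have hb' : refractedSq g R A m C z' = a ^ 2 := by
    have h3 : z'.1 = !z.1 := by rw [h1]
    rw [refractedSq, h3, h2, hsq, hbeq, Bool.not_not]
    ring
  have hmem : z' ∈ refracting g R A m C E := by
    refine ⟨⟨?_, ?_⟩, ?_, ?_⟩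
    · have h3 : 0 < normalSpeed g (piece R A (!z.1)) z'.2 := by
        rw [h2]
        exact Real.sqrt_pos.2 hb
      rw [h1] at h3 ⊢
      refine ⟨-inwardNormal g (piece R A z.1) z.2.proj, hreg', ?_⟩
      simp only [normalSpeed, changeVelocity] at h3
      rw [hn] at h3
      exact h3
    · rw [h1]
      simp only
      rw [inner_self_changeVelocity hreg.1, hz.1.2, ← ha]
      field_simp at hbeq ⊢
      nlinarith
    · have h3 : z.2.proj ∈ piece R A z.1 :=
        (isClosed_piece R A z.1).frontier_subset hreg.1.mem_frontier
      rw [h1]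
      simp only [Bool.not_not]
      exact h3
    · rw [hb']
      positivity
  refine ⟨hmem, ?_⟩
  rw [refract, if_pos hmem, hb', Real.sqrt_sq hpos.le]
  rw [h1] at h2 ⊢
  simp only [Bool.not_not] at h2 ⊢
  refine Prod.ext rfl ?_
  simp only
  rw [h2, changeVelocity_of_neg (D := piece R A z.1)
    (ζ := changeVelocity g (piece R A z.1) 1 (-a - Real.sqrt b) z.2) hn, changeVelocity_changeVelocity]
  convert changeVelocity_one_zero g (piece R A z.1) z.2 using 2 <;> ring

theorem eventually_refracting {g : Metric d M} {R A : Set M} {m C E : ℝ}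
    (hA : ∃ O : Set M, IsOpen O ∧ A = O ∩ R) {z : State d M}
    (hz : z ∈ refracting g R A m C E) :
    ∃ (U : Set M) (f : M → ℝ) (N : ∀ x : M, TangentSpace (𝓡 (d + 1)) x),
      BoundaryChart g (piece R A z.1) U f N ∧ z.2.proj ∈ U ∧ ∀ᶠ ζ in 𝓝 z.2, ζ.proj ∈ U ∧
      ((z.1, ζ) ∈ transverse g R A m C E → (z.1, ζ) ∈ refracting g R A m C E) := by
  obtain ⟨U, f, N, hc, hx, hf, hpos, hreg⟩ := exists_boundaryChart_of_mem_transverse hz.1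
  have hint : z.2.proj ∈ interior R := (isRegular_of_mem_transverse hz.1).1.2 hz.2.1
  have hc' := hc.mono (hc.isOpen.inter isOpen_interior) (inter_subset_left (t := interior R))
  refine ⟨_, f, N, hc', ⟨hx, hint⟩, ?_⟩
  have hcont : ContinuousAt (fun ζ : TangentBundle (𝓡 (d + 1)) M =>
      g.inner ζ.proj (N ζ.proj) ζ.snd ^ 2
        - 2 / m * (potential C (!z.1) - potential C z.1)) z.2 :=
    ((hc.contMDiffAt_inner_normal hx).continuousAt.pow 2).sub continuousAt_const
  have hb : 0 < g.inner z.2.proj (N z.2.proj) z.2.snd ^ 2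
        - 2 / m * (potential C (!z.1) - potential C z.1) := by
    have := hz.2.2
    rwa [refractedSq, normalSpeed_eq (hreg _ hx hf).1] at this
  filter_upwards [hc'.eventually_mem (⟨hx, hint⟩ : z.2.proj ∈ U ∩ interior R),
    hcont.eventually (lt_mem_nhds hb)] with ζ h1 h2
  refine ⟨h1, fun hζ => ⟨hζ, ?_, ?_⟩⟩
  · exact (hc'.mem_piece_not_iff hA inter_subset_right h1).2
      (hc'.eq_normal h1 (isRegular_of_mem_transverse hζ).1.1).1.le
  · have h3 := (hc'.eq_normal h1 (isRegular_of_mem_transverse hζ).1.1).1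
    rw [refractedSq, normalSpeed_eq (hc'.isInwardNormal h1 h3)]
    exact h2

theorem liouvilleInvolution_refract {g : Metric d M} {R A : Set M} {m C E : ℝ} (hm : 0 < m)
    (hA : ∃ O : Set M, IsOpen O ∧ A = O ∩ R) :
    LiouvilleInvolution g R A m C E (refracting g R A m C E) (refract g R A m C E) where
  subset _ hz := hz.1
  maps _ hz := (refract_mem_and_refract_refract hm hA hz).1
  involutive _ hz := (refract_mem_and_refract_refract hm hA hz).2
  eq_off z hz := if_neg hz
  smooth z hz := by
    obtain ⟨U, f, N, hc, hx, hev⟩ := eventually_refracting hA hz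
    have hb : 0 < g.inner z.2.proj (N z.2.proj) z.2.snd ^ 2
        - 2 / m * (potential C (!z.1) - potential C z.1) := by
      have h1 := hz.2.2
      have h2 := (isRegular_of_mem_transverse hz.1).1.1
      rwa [refractedSq, normalSpeed_eq (hc.isInwardNormal hx (hc.eq_normal hx h2).1)] at h1
    have h1 := hc.contMDiffAt_inner_normal hx
    have h2 : ContMDiffAt (𝓡 (d + 1)).tangent 𝓘(ℝ, ℝ) ∞
        (fun ζ : TangentBundle (𝓡 (d + 1)) M => -g.inner ζ.proj (N ζ.proj) ζ.snd -
          Real.sqrt (g.inner ζ.proj (N ζ.proj) ζ.snd ^ 2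
        - 2 / m * (potential C (!z.1) - potential C z.1))) z.2 := by
      have h3 : ContDiffAt ℝ ∞ (fun a : ℝ => -a - Real.sqrt (a ^ 2
          - 2 / m * (potential C (!z.1) - potential C z.1)))
          (g.inner z.2.proj (N z.2.proj) z.2.snd) :=
        contDiffAt_id.neg.sub (((contDiffAt_id.pow 2).sub contDiffAt_const).sqrt hb.ne')
      exact ContMDiffAt.comp z.2 (contMDiffAt_iff_contDiffAt.2 h3) h1
    refine ⟨!z.1, _, hc.contMDiffAt_changeVelocity hx 1 h2, ?_⟩
    filter_upwards [hev] with ζ hU hζ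
    refine ⟨hU.2 hζ, ?_⟩
    have hn := hc.isInwardNormal hU.1 (hc.eq_normal hU.1 (isRegular_of_mem_transverse hζ).1.1).1
    rw [refract, if_pos (hU.2 hζ)]
    simp only [refractedSq]
    rw [changeVelocity_eq hn, normalSpeed_eq hn]
  density i j ψ φ u hev := by
    refine liouvilleDensity_changeVelocity (D := piece R A i) (.inl rfl)
      (β := fun ζ => -normalSpeed g (piece R A i) ζ
        - Real.sqrt (refractedSq g R A m C (i, ζ))) ?_
    filter_upwards [hev] with u' h
    obtain ⟨h1, -, h2, h3⟩ := h
    refine ⟨h1, (isRegular_of_mem_transverse h2.1).1.1, ?_⟩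
    rw [refract, if_pos h2] at h3
    exact (congrArg Prod.snd h3).symm

variable [T2Space M]

/-! ### Hitting times -/

theorem GeodesicReaches.reaches_flow {g : Metric d M} {t : ℝ} {ζ w : TangentBundle (𝓡 (d + 1)) M}
    (h : GeodesicReaches g t ζ w) : GeodesicReaches g t ζ (geodesicFlow g t ζ) := by
  rwa [geodesicFlow_eq h]

theorem GeodesicReaches.continuousAt_flow {g : Metric d M} {t : ℝ}
    {ζ w : TangentBundle (𝓡 (d + 1)) M} (h : GeodesicReaches g t ζ w) :
    ContinuousAt (fun p : ℝ × TangentBundle (𝓡 (d + 1)) M => geodesicFlow g p.1 p.2) (t, ζ) :=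
  h.eventually.self_of_nhds.2.continuousAt

theorem GeodesicReaches.eventually_stateAt {g : Metric d M} {t : ℝ}
    {ζ w : TangentBundle (𝓡 (d + 1)) M} (h : GeodesicReaches g t ζ w) :
    ∃ γ : ℝ → M, MDifferentiableAt 𝓘(ℝ, ℝ) (𝓡 (d + 1)) γ t ∧ stateAt γ t = w ∧
      ∀ᶠ r in 𝓝 t, geodesicFlow g r ζ = stateAt γ r := by
  obtain ⟨γ, a, b, h0, ht, hγ, rfl, rfl⟩ := h
  refine ⟨γ, (hγ.contMDiffAt isOpen_Ioo ht).mdifferentiableAt (by simp), rfl, ?_⟩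
  filter_upwards [isOpen_Ioo.mem_nhds ht] with r hr
  exact geodesicFlow_eq (hγ.reaches h0 hr)

theorem GeodesicReaches.hasDerivAt_comp_flow {g : Metric d M} {t : ℝ}
    {ζ w : TangentBundle (𝓡 (d + 1)) M} (h : GeodesicReaches g t ζ w) {f : M → ℝ}
    (hf : MDifferentiableAt (𝓡 (d + 1)) 𝓘(ℝ, ℝ) f w.proj) :
    HasDerivAt (fun r => f (geodesicFlow g r ζ).proj) (differential f w.proj w.snd) t := by
  obtain ⟨γ, hγ, rfl, hev⟩ := h.eventually_stateAt
  let v : ℝ →L[ℝ] TangentSpace (𝓡 (d + 1)) (γ t) := mfderiv 𝓘(ℝ, ℝ) (𝓡 (d + 1)) γ t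
  have h1 : HasMFDerivAt 𝓘(ℝ, ℝ) 𝓘(ℝ, ℝ) (f ∘ γ) t ((differential f (γ t)).comp v) :=
    HasMFDerivAt.comp t (f := γ) (g := f) hf.hasMFDerivAt hγ.hasMFDerivAt
  have h2 : HasFDerivAt (f ∘ γ) ((differential f (γ t)).comp v) t :=
    hasMFDerivAt_iff_hasFDerivAt.1 h1
  refine HasDerivAt.congr_of_eventuallyEq h2.hasDerivAt ?_
  filter_upwards [hev] with r hr
  rw [hr]
  rfl

/-- Near a time at which a geodesic meets a boundary chart, the defining function changes
along the neighbouring geodesics at a rate of the sign of the normal component of the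
velocity. -/
theorem BoundaryChart.eventually_hasDerivAt {g : Metric d M} {D U : Set M} {f : M → ℝ}
    {N : ∀ x : M, TangentSpace (𝓡 (d + 1)) x} (hc : BoundaryChart g D U f N) {t₀ : ℝ}
    {ζ₀ w₀ : TangentBundle (𝓡 (d + 1)) M} (h : GeodesicReaches g t₀ ζ₀ w₀) (hw : w₀.proj ∈ U) :
    ∀ᶠ p in 𝓝 (t₀, ζ₀), (geodesicFlow g p.1 p.2).proj ∈ U ∧
      GeodesicReaches g p.1 p.2 (geodesicFlow g p.1 p.2) ∧
      ∃ c > 0, HasDerivAt (fun r => f (geodesicFlow g r p.2).proj)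
        (c * g.inner (geodesicFlow g p.1 p.2).proj (N (geodesicFlow g p.1 p.2).proj)
          (geodesicFlow g p.1 p.2).snd) p.1 := by
  have hw' : (geodesicFlow g (t₀, ζ₀).1 (t₀, ζ₀).2).proj ∈ U := by
    rwa [show geodesicFlow g (t₀, ζ₀).1 (t₀, ζ₀).2 = w₀ from geodesicFlow_eq h]
  filter_upwards [h.eventually, h.continuousAt_flow.eventually (hc.eventually_mem hw')]
    with p h1 h2
  obtain ⟨⟨w, h1⟩, -⟩ := h1
  obtain ⟨c, hc0, hdf⟩ := hc.gradient _ h2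
  refine ⟨h2, h1.reaches_flow, c, hc0, ?_⟩
  rw [← hdf]
  exact h1.reaches_flow.hasDerivAt_comp_flow (hc.mdifferentiableAt h2)

/-- Functions with positive derivatives near `(t₀, x₀)` are strictly increasing on an interval that
does not depend on the parameter `x`. -/
theorem eventually_strictMonoOn {X : Type*} [TopologicalSpace X] {F : ℝ → X → ℝ} {P : ℝ × X → Prop}
    {t₀ : ℝ} {x₀ : X}
    (h : ∀ᶠ p in 𝓝 (t₀, x₀), P p ∧ ∃ c > 0, HasDerivAt (fun r => F r p.2) c p.1) :
    ∃ δ > 0, ∀ᶠ x in 𝓝 x₀, StrictMonoOn (fun r => F r x) (Ioo (t₀ - δ) (t₀ + δ)) ∧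
      ∀ r ∈ Ioo (t₀ - δ) (t₀ + δ), P (r, x) := by
  rw [nhds_prod_eq, Filter.eventually_prod_iff] at h
  obtain ⟨pa, ha, pb, hb, hab⟩ := h
  obtain ⟨δ, hδ, hball⟩ := Metric.eventually_nhds_iff_ball.1 ha
  refine ⟨δ, hδ, hb.mono fun x hx => ?_⟩
  rw [← Real.ball_eq_Ioo]
  refine ⟨?_, fun r hr => (hab (hball r hr) hx).1⟩
  refine strictMonoOn_of_deriv_pos (convex_ball t₀ δ) (fun r hr => ?_) fun r hr => ?_
  · obtain ⟨-, c, -, hc⟩ := hab (hball r hr) hx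
    exact hc.continuousAt.continuousWithinAt
  · obtain ⟨-, c, hc0, hc⟩ := hab (hball r (interior_subset hr)) hx
    rwa [hc.deriv]

/-- The time at which the geodesics hit a transverse boundary piece is a smooth function of
the initial state. -/
theorem BoundaryChart.exists_hittingTime {g : Metric d M} {D U : Set M} {f : M → ℝ}
    {N : ∀ x : M, TangentSpace (𝓡 (d + 1)) x} (hc : BoundaryChart g D U f N) {t₀ : ℝ}
    {ζ₀ w₀ : TangentBundle (𝓡 (d + 1)) M} (h : GeodesicReaches g t₀ ζ₀ w₀) (hw : w₀.proj ∈ U)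
    (hf : f w₀.proj = 0) (hN : g.inner w₀.proj (N w₀.proj) w₀.snd ≠ 0) :
    ∃ τ : TangentBundle (𝓡 (d + 1)) M → ℝ, τ ζ₀ = t₀ ∧
      ContMDiffAt (𝓡 (d + 1)).tangent 𝓘(ℝ, ℝ) ∞ τ ζ₀ ∧
      ∀ᶠ ζ in 𝓝 ζ₀, f (geodesicFlow g (τ ζ) ζ).proj = 0 := by
  set p := ζ₀.proj with hp
  have hs : ζ₀.proj ∈ (extChartAt (𝓡 (d + 1)) p).source := mem_extChartAt_source p
  have hz : (stateCoord p ζ₀).1 ∈ (extChartAt (𝓡 (d + 1)) p).target :=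
    (extChartAt (𝓡 (d + 1)) p).map_source hs
  have hch : chartState p (stateCoord p ζ₀) = ζ₀ := chartState_stateCoord hs
  let G : (Model d × Model d) × ℝ → ℝ := fun v => f (geodesicFlow g v.2 (chartState p v.1)).proj
  set u : (Model d × Model d) × ℝ := (stateCoord p ζ₀, t₀) with hu
  have hcont : ContinuousAt (fun v : (Model d × Model d) × ℝ => (v.2, chartState p v.1)) u :=
    continuousAt_snd.prodMk (ContinuousAt.comp (g := chartState p)
      (f := fun v : (Model d × Model d) × ℝ => v.1)
      (contMDiffAt_chartState hz).continuousAt continuousAt_fst)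
  have hu' : (fun v : (Model d × Model d) × ℝ => (v.2, chartState p v.1)) u = (t₀, ζ₀) :=
    Prod.ext rfl hch
  have hG : ∀ᶠ v in 𝓝 u, ContDiffAt ℝ ∞ G v := by
    have h1 : ∀ᶠ v in 𝓝 u, v.1.1 ∈ (extChartAt (𝓡 (d + 1)) p).target :=
      (continuous_fst.comp continuous_fst).continuousAt.eventually
        ((isOpen_extChartAt_target (I := 𝓡 (d + 1)) p).mem_nhds hz)
    have h2 := h.eventually
    have h3 := hc.eventually_hasDerivAt h hw
    rw [← hu'] at h2 h3
    filter_upwards [h1, hcont.eventually h2, hcont.eventually h3] with v e1 e2 e3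
    rw [← contMDiffAt_iff_contDiffAt]
    have e4 : ContMDiffAt 𝓘(ℝ, (Model d × Model d) × ℝ) (𝓘(ℝ, ℝ).prod (𝓡 (d + 1)).tangent) ∞
        (fun v : (Model d × Model d) × ℝ => (v.2, chartState p v.1)) v := by
      refine ContMDiffAt.prodMk (contMDiffAt_iff_contDiffAt.2 contDiffAt_snd) ?_
      exact ContMDiffAt.comp v (g := chartState p) (f := fun v : (Model d × Model d) × ℝ => v.1)
        (contMDiffAt_chartState e1) (contMDiffAt_iff_contDiffAt.2 contDiffAt_fst)
    have e5 := ContMDiffAt.comp v (f := fun v : (Model d × Model d) × ℝ => (v.2, chartState p v.1))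
      (g := fun p : ℝ × TangentBundle (𝓡 (d + 1)) M => geodesicFlow g p.1 p.2) e2.2 e4
    have e6 := (Bundle.contMDiff_proj (n := ∞) (IB := 𝓡 (d + 1)) (F := Model d)
      (TangentSpace (𝓡 (d + 1)) : M → Type _)).contMDiffAt.comp v e5
    exact ContMDiffAt.comp v (g := f)
      (f := fun v : (Model d × Model d) × ℝ => (geodesicFlow g v.2 (chartState p v.1)).proj)
      (hc.smooth.contMDiffAt (hc.isOpen.mem_nhds e3.1)) e6
  obtain ⟨c, hc0, hdf⟩ := hc.gradient _ hw
  have hne : c * g.inner w₀.proj (N w₀.proj) w₀.snd ≠ 0 := mul_ne_zero hc0.ne' hN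
  -- The time derivative of the defining function is nonzero, as the geodesic arrives transversally.
  have hinv : (fderiv ℝ G u ∘L .inr ℝ (Model d × Model d) ℝ).IsInvertible := by
    refine ⟨ContinuousLinearEquiv.unitsEquivAut ℝ (Units.mk0 _ hne), ?_⟩
    ext
    have h1 := (h.hasDerivAt_comp_flow (hc.mdifferentiableAt hw))
    rw [hdf] at h1
    have h2 := HasFDerivAt.comp_hasDerivAt t₀ (l := G)
      (f := fun r : ℝ => (stateCoord p ζ₀, r))
      (hG.self_of_nhds.differentiableAt (by simp)).hasFDerivAt
      ((hasDerivAt_const t₀ (stateCoord p ζ₀)).prodMk (hasDerivAt_id' t₀))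
    have h3 : (G ∘ fun r : ℝ => (stateCoord p ζ₀, r)) =
        fun r => f (geodesicFlow g r ζ₀).proj := by
      ext r
      simp only [G, Function.comp_apply, hch]
    rw [h3] at h2
    have h4 := h1.unique h2
    simpa using h4
  obtain ⟨θ, hθ0, hθ, hθG, -⟩ := exists_smooth_implicitFunction hG hinv
  have hcoord := contMDiffAt_stateCoord (p := p) (ζ := ζ₀) hs
  refine ⟨fun ζ => θ (stateCoord p ζ), hθ0, ?_, ?_⟩
  · exact ContMDiffAt.comp ζ₀ (g := θ) (f := stateCoord p)
      (contMDiffAt_iff_contDiffAt.2 hθ.self_of_nhds) hcoord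
  · have hGu : G u = 0 := by
      simp only [G, hu, hch]
      rw [geodesicFlow_eq h, hf]
    filter_upwards [hcoord.continuousAt.eventually hθG, (isOpen_proj_preimage_source p).mem_nhds hs]
      with ζ h1 h2
    rw [hGu] at h1
    simp only [G] at h1
    rwa [chartState_stateCoord h2] at h1

/-! ### Free flight -/

theorem Flight.exists_reaches {g : Metric d M} {D : Set M} {ζ w : TangentBundle (𝓡 (d + 1)) M}
    (h : Flight g D ζ w) : ∃ t > 0, GeodesicReaches g t ζ w ∧
      (∀ r ∈ Ioo 0 t, GeodesicReaches g r ζ (geodesicFlow g r ζ) ∧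
        (geodesicFlow g r ζ).proj ∈ interior D) ∧ w.proj ∈ frontier D := by
  obtain ⟨γ, t, ε, ht, hε, hγ, rfl, rfl, hint, hfr⟩ := h
  have h0 : (0 : ℝ) ∈ Ioo (-ε) (t + ε) := ⟨by linarith, by linarith⟩
  refine ⟨t, ht, hγ.reaches h0 ⟨by linarith, by linarith⟩, fun r hr => ?_, hfr⟩
  have h1 := hγ.reaches h0 (t := r) ⟨by linarith [hr.1], by linarith [hr.2]⟩
  refine ⟨h1.reaches_flow, ?_⟩
  rw [geodesicFlow_eq h1]
  exact hint r hr

theorem GeodesicReaches.flight {g : Metric d M} {D : Set M} {t : ℝ}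
    {ζ w : TangentBundle (𝓡 (d + 1)) M} (h : GeodesicReaches g t ζ w) (ht : 0 < t)
    (hint : ∀ r ∈ Ioo 0 t, (geodesicFlow g r ζ).proj ∈ interior D) (hw : w.proj ∈ frontier D) :
    Flight g D ζ w := by
  obtain ⟨γ, a, b, h0, hb, hγ, rfl, rfl⟩ := h
  refine ⟨γ, t, min (-a) (b - t), ht, lt_min (by linarith [h0.1]) (by linarith [hb.2]),
    hγ.mono (Ioo_subset_Ioo ?_ ?_), rfl, rfl, fun r hr => ?_, hw⟩
  · linarith [min_le_left (-a) (b - t)]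
  · linarith [min_le_right (-a) (b - t)]
  · have h1 := hint r hr
    rwa [geodesicFlow_eq (hγ.reaches h0 ⟨h0.1.trans hr.1, hr.2.trans hb.2⟩)] at h1

theorem Flight.unique {g : Metric d M} {D : Set M} {ζ w w' : TangentBundle (𝓡 (d + 1)) M}
    (h : Flight g D ζ w) (h' : Flight g D ζ w') : w = w' := by
  obtain ⟨t, ht, hr, hint, hw⟩ := h.exists_reaches
  obtain ⟨t', ht', hr', hint', hw'⟩ := h'.exists_reaches
  rcases lt_trichotomy t t' with hlt | rfl | hlt
  · have h1 := (hint' t ⟨ht, hlt⟩).2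
    rw [geodesicFlow_eq hr] at h1
    exact absurd h1 hw.2
  · exact hr.unique hr'
  · have h1 := (hint t' ⟨ht', hlt⟩).2
    rw [geodesicFlow_eq hr'] at h1
    exact absurd h1 hw'.2

/-- Time reversal of states. -/
def reverse (ζ : TangentBundle (𝓡 (d + 1)) M) : TangentBundle (𝓡 (d + 1)) M := ⟨ζ.proj, -ζ.snd⟩

theorem reverse_reverse (ζ : TangentBundle (𝓡 (d + 1)) M) : reverse (reverse ζ) = ζ :=
  congrArg (fun v => (⟨ζ.proj, v⟩ : TangentBundle (𝓡 (d + 1)) M)) (neg_neg ζ.snd)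

theorem Flight.reverse {g : Metric d M} {D : Set M} {ζ w : TangentBundle (𝓡 (d + 1)) M}
    (h : Flight g D ζ w) (hζ : ζ.proj ∈ frontier D) :
    Flight g D (reverse w) (reverse ζ) := by
  obtain ⟨γ, t, ε, ht, hε, hγ, rfl, rfl, hint, hfr⟩ := h
  have hmd : ∀ r ∈ Ioo (-ε) (t + ε), MDifferentiableAt 𝓘(ℝ, ℝ) (𝓡 (d + 1)) γ r := fun r hr =>
    (hγ.contMDiffAt isOpen_Ioo hr).mdifferentiableAt (by simp)
  have hst : ∀ r s, t + -1 * r = s → s ∈ Ioo (-ε) (t + ε) →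
      stateAt (d := d) (fun r => γ (t + -1 * r)) r = LensedBilliard.reverse (stateAt γ s) := by
    rintro r s rfl hs
    rw [stateAt_comp_affine t (-1) r (hmd _ hs)]
    exact congrArg (fun v => (⟨γ (t + -1 * r), v⟩ : TangentBundle (𝓡 (d + 1)) M))
      (neg_one_smul ℝ _)
  refine ⟨fun r => γ (t + -1 * r), t, ε, ht, hε, (hγ.comp_affine t (-1)).mono fun r hr => ?_,
    hst 0 t (by ring) ⟨by linarith, by linarith⟩, hst t 0 (by ring) ⟨by linarith, by linarith⟩,
    fun r hr => hint _ ⟨by linarith [hr.2], by linarith [hr.1]⟩, ?_⟩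
  · exact ⟨by linarith [hr.2], by linarith [hr.1]⟩
  · have h1 : t + -1 * t = 0 := by ring
    simp only [h1]
    exact hζ

/-- The transverse states from which the boundary is reached transversally at a regular
point. -/
def flying (g : Metric d M) (R A : Set M) (m C E : ℝ) : Set (State d M) :=
  {z | z ∈ transverse g R A m C E ∧ ∃ w, Flight g (piece R A z.1) z.2 w ∧
    ∃ ν, IsRegular g R A z.1 w.proj ν ∧ g.inner w.proj ν w.snd < 0}

/-- Free flight from the states near a given one: it lasts for a time that depends smoothly
on the state. -/
theorem exists_hittingTime_of_mem_flying {g : Metric d M} {R A : Set M} {m C E : ℝ}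
    {z : State d M} (hz : z ∈ flying g R A m C E) :
    ∃ (τ : TangentBundle (𝓡 (d + 1)) M → ℝ) (w : TangentBundle (𝓡 (d + 1)) M),
      GeodesicReaches g (τ z.2) z.2 w ∧
      ContMDiffAt (𝓡 (d + 1)).tangent 𝓘(ℝ, ℝ) ∞ τ z.2 ∧
      ∀ᶠ ζ in 𝓝 z.2, (z.1, ζ) ∈ transverse g R A m C E →
        GeodesicReaches g (τ ζ) ζ (geodesicFlow g (τ ζ) ζ) ∧
        Flight g (piece R A z.1) ζ (geodesicFlow g (τ ζ) ζ) ∧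
        (z.1, ζ) ∈ flying g R A m C E := by
  obtain ⟨hzt, w₀, hfl, ν, hν, hνneg⟩ := hz
  obtain ⟨U₀, f₀, N₀, hc₀, hU₀, hf₀, hpos, hreg₀⟩ := exists_boundaryChart_of_mem_transverse hzt
  obtain ⟨U₁, f₁, N₁, hc₁, hU₁, hf₁, rfl, hreg₁⟩ := hν.exists_boundaryChart
  obtain ⟨t₀, ht₀, hr, hint, hfr⟩ := hfl.exists_reaches
  obtain ⟨τ, hτ0, hτ, hτf⟩ := hc₁.exists_hittingTime hr hU₁ hf₁ hνneg.ne
  refine ⟨τ, w₀, by rwa [hτ0], hτ, ?_⟩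
  have hr0 : GeodesicReaches g 0 z.2 z.2 := by
    obtain ⟨⟨w, h1⟩, -⟩ := (eventually_geodesicFlow_zero g z.2).self_of_nhds
    have h2 := GeodesicReaches.reaches_flow (t := 0) (ζ := z.2) h1
    rwa [geodesicFlow_zero] at h2
  -- The defining function increases at the start and decreases at the end of the flight.
  obtain ⟨δ₀, hδ₀, hstart⟩ := eventually_strictMonoOn
    (F := fun r ζ => f₀ (geodesicFlow g r ζ).proj)
    (P := fun p => (geodesicFlow g p.1 p.2).proj ∈ U₀) (t₀ := 0) (x₀ := z.2) (by
      have h1 : ContinuousAt (fun p : ℝ × TangentBundle (𝓡 (d + 1)) M =>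
          g.inner (geodesicFlow g p.1 p.2).proj (N₀ (geodesicFlow g p.1 p.2).proj)
            (geodesicFlow g p.1 p.2).snd) (0, z.2) := by
        refine ContinuousAt.comp_of_eq (hc₀.contMDiffAt_inner_normal hU₀).continuousAt
          hr0.continuousAt_flow ?_
        exact geodesicFlow_zero g z.2
      have hpos' : 0 < g.inner (geodesicFlow g 0 z.2).proj (N₀ (geodesicFlow g 0 z.2).proj)
          (geodesicFlow g 0 z.2).snd := by
        rwa [geodesicFlow_zero]
      have h2 := h1.eventually (lt_mem_nhds hpos')
      filter_upwards [hc₀.eventually_hasDerivAt hr0 hU₀, h2] with p h3 h4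
      obtain ⟨e1, -, c, hc, e2⟩ := h3
      exact ⟨e1, _, mul_pos hc h4, e2⟩)
  have hcont₁ : ContinuousAt (fun p : ℝ × TangentBundle (𝓡 (d + 1)) M =>
      g.inner (geodesicFlow g p.1 p.2).proj (N₁ (geodesicFlow g p.1 p.2).proj)
        (geodesicFlow g p.1 p.2).snd) (t₀, z.2) := by
    refine ContinuousAt.comp_of_eq (hc₁.contMDiffAt_inner_normal hU₁).continuousAt
      hr.continuousAt_flow ?_
    exact geodesicFlow_eq hr
  have hneg : g.inner (geodesicFlow g t₀ z.2).proj (N₁ (geodesicFlow g t₀ z.2).proj)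
      (geodesicFlow g t₀ z.2).snd < 0 := by
    rwa [geodesicFlow_eq hr]
  have hneg₁ := hcont₁.eventually (gt_mem_nhds hneg)
  obtain ⟨δ₁, hδ₁, hend⟩ := eventually_strictMonoOn
    (F := fun r ζ => -f₁ (geodesicFlow g r ζ).proj)
    (P := fun p => (geodesicFlow g p.1 p.2).proj ∈ U₁) (t₀ := t₀) (x₀ := z.2) (by
      filter_upwards [hc₁.eventually_hasDerivAt hr hU₁, hneg₁] with p h3 h4
      obtain ⟨e1, -, c, hc, e2⟩ := h3
      exact ⟨e1, _, neg_pos.2 (mul_neg_of_pos_of_neg hc h4), e2.neg⟩)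
  -- In between, the flight stays away from the boundary.
  have hmid : ∀ᶠ ζ in 𝓝 z.2, ∀ r ∈ Icc (δ₀ / 2) (t₀ - δ₁ / 2),
      (geodesicFlow g r ζ).proj ∈ interior (piece R A z.1) := by
    refine isCompact_Icc.eventually_forall_of_forall_eventually fun r hr' => ?_
    have h1 := hint r ⟨by linarith [hr'.1], by linarith [hr'.2]⟩
    have h2 : ∀ᶠ p in 𝓝 (r, z.2), (geodesicFlow g p.1 p.2).proj ∈ interior (piece R A z.1) :=
      (continuous_stateProj.continuousAt.comp h1.1.continuousAt_flow).eventually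
        (isOpen_interior.mem_nhds h1.2)
    exact (continuous_swap.tendsto (z.2, r)).eventually h2
  have hτpair : Tendsto (fun ζ => (τ ζ, ζ)) (𝓝 z.2) (𝓝 (t₀, z.2)) := by
    have := hτ.continuousAt.prodMk continuousAt_id
    rw [ContinuousAt, hτ0] at this
    exact this
  have hτmem : ∀ᶠ ζ in 𝓝 z.2, τ ζ ∈ Ioo (t₀ - δ₁) (t₀ + δ₁) ∧ 0 < τ ζ := by
    have h1 := hτ.continuousAt
    rw [ContinuousAt, hτ0] at h1
    exact (h1.eventually (Ioo_mem_nhds (by linarith) (by linarith))).and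
      (h1.eventually (lt_mem_nhds ht₀))
  filter_upwards [hstart, hend, hmid, hτmem, hτf, hτpair.eventually hneg₁,
    hτpair.eventually (hc₁.eventually_hasDerivAt hr hU₁), hc₀.eventually_mem hU₀]
    with ζ h1 h2 h3 h4 h5 h6 h7 h8 hζ
  obtain ⟨hU, hreach, -⟩ := h7
  have hfζ := (hc₀.eq_normal h8 (isRegular_of_mem_transverse hζ).1.1).1
  have hflight : Flight g (piece R A z.1) ζ (geodesicFlow g (τ ζ) ζ) := by
    refine hreach.flight h4.2 (fun r hr' => ?_) ((hc₁.mem_frontier_iff hU).2 h5)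
    rcases lt_or_ge r δ₀ with h9 | h9
    · have hm0 : (0 : ℝ) ∈ Ioo (0 - δ₀) (0 + δ₀) := ⟨by linarith, by linarith⟩
      have hmr : r ∈ Ioo (0 - δ₀) (0 + δ₀) := ⟨by linarith [hr'.1], by linarith⟩
      have h10 := h1.1 hm0 hmr hr'.1
      simp only [geodesicFlow_zero] at h10
      rw [hfζ] at h10
      exact hc₀.mem_interior (h1.2 r hmr) h10
    · rcases lt_or_ge (t₀ - δ₁) r with h11 | h11
      · have hmr : r ∈ Ioo (t₀ - δ₁) (t₀ + δ₁) := ⟨h11, hr'.2.trans h4.1.2⟩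
        have h10 := h2.1 hmr h4.1 hr'.2
        simp only at h10
        rw [h5] at h10
        exact hc₁.mem_interior (h2.2 r hmr) (by linarith)
      · exact h3 r ⟨by linarith, by linarith⟩
  exact ⟨hreach, hflight, hζ, _, hflight, _, hreg₁ _ hU h5, h6⟩

/-! ### Flight followed by time reversal -/

open Classical in
/-- The state in which a free flight reaches the boundary, with junk value the initial state if
there is no such flight. -/
def arrival (g : Metric d M) (D : Set M) (ζ : TangentBundle (𝓡 (d + 1)) M) :
    TangentBundle (𝓡 (d + 1)) M :=
  if h : ∃ w, Flight g D ζ w then h.choose else ζ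

theorem Flight.arrival_eq {g : Metric d M} {D : Set M} {ζ w : TangentBundle (𝓡 (d + 1)) M}
    (h : Flight g D ζ w) : arrival g D ζ = w := by
  have hex : ∃ w, Flight g D ζ w := ⟨w, h⟩
  rw [arrival, dif_pos hex]
  exact hex.choose_spec.unique h

open Classical in
/-- Free flight to the next collision, followed by the reversal of the velocity. -/
def flightReversal (g : Metric d M) (R A : Set M) (m C E : ℝ) (z : State d M) : State d M :=
  if z ∈ flying g R A m C E then (z.1, reverse (arrival g (piece R A z.1) z.2)) else z

theorem flightReversal_eq {g : Metric d M} {R A : Set M} {m C E : ℝ} {z : State d M}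
    (hz : z ∈ flying g R A m C E) {w : TangentBundle (𝓡 (d + 1)) M}
    (hw : Flight g (piece R A z.1) z.2 w) :
    flightReversal g R A m C E z = (z.1, reverse w) := by
  rw [flightReversal, if_pos hz, hw.arrival_eq]

theorem contMDiff_reverse :
    ContMDiff (𝓡 (d + 1)).tangent (𝓡 (d + 1)).tangent ∞
      (reverse : TangentBundle (𝓡 (d + 1)) M → TangentBundle (𝓡 (d + 1)) M) := by
  intro ζ
  have h1 := contMDiffAt_velocity_combination (ζ₀ := ζ) (a := fun _ => (-1 : ℝ)) (b := fun _ => 0)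
    (N := fun x => (0 : TangentSpace (𝓡 (d + 1)) x)) contMDiffAt_const contMDiffAt_const
    (Bundle.contMDiff_zeroSection ℝ (TangentSpace (𝓡 (d + 1)) : M → Type _)).contMDiffAt
  refine h1.congr_of_eventuallyEq (Eventually.of_forall fun ζ => ?_)
  have h2 : -ζ.snd = (-1 : ℝ) • ζ.snd + (0 : ℝ) • (0 : TangentSpace (𝓡 (d + 1)) ζ.proj) := by
    module
  exact congrArg (fun v => (⟨ζ.proj, v⟩ : TangentBundle (𝓡 (d + 1)) M)) h2

theorem flightReversal_mem {g : Metric d M} {R A : Set M} {m C E : ℝ} {z : State d M}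
    (hz : z ∈ flying g R A m C E) :
    flightReversal g R A m C E z ∈ flying g R A m C E ∧
      flightReversal g R A m C E (flightReversal g R A m C E z) = z := by
  obtain ⟨hzt, w, hfl, ν, hν, hneg⟩ := id hz
  obtain ⟨⟨ν₀, hν₀, hpos⟩, hs⟩ := id hzt
  obtain ⟨t, -, hr, -, -⟩ := hfl.exists_reaches
  have hback : Flight g (piece R A z.1) (reverse w) (reverse z.2) :=
    hfl.reverse hν₀.1.mem_frontier
  have hmem : (z.1, reverse w) ∈ flying g R A m C E := by
    refine ⟨⟨⟨ν, hν, ?_⟩, ?_⟩, reverse z.2, hback, ν₀, hν₀, ?_⟩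
    · change 0 < g.inner w.proj ν (-w.snd)
      rw [Metric.inner_neg_right]
      linarith
    · change g.inner w.proj (-w.snd) (-w.snd) = _
      rw [Metric.inner_neg_right, Metric.inner_neg_left, neg_neg, hr.speed_eq, hs]
    · change g.inner z.2.proj ν₀ (-z.2.snd) < 0
      rw [Metric.inner_neg_right]
      linarith
  rw [flightReversal_eq hz hfl]
  refine ⟨hmem, ?_⟩
  rw [flightReversal_eq hmem hback, reverse_reverse]

section

variable {F : Type*} [NormedAddCommGroup F] [NormedSpace ℝ F]

theorem mfderiv_flow_family {g : Metric d M} {T : F → ℝ} {ζ : F → TangentBundle (𝓡 (d + 1)) M}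
    {u : F} {w : TangentBundle (𝓡 (d + 1)) M} (h : GeodesicReaches g (T u) (ζ u) w)
    (hζ : ContMDiffAt 𝓘(ℝ, F) (𝓡 (d + 1)).tangent ∞ ζ u) (hT : DifferentiableAt ℝ T u) (e : F) :
    mfderiv 𝓘(ℝ, F) (𝓡 (d + 1)) (fun u' => (geodesicFlow g (T u') (ζ u')).proj) u e =
      fderiv ℝ T u e • (geodesicFlow g (T u) (ζ u)).snd +
        mfderiv 𝓘(ℝ, F) (𝓡 (d + 1)) (fun u' => (geodesicFlow g (T u) (ζ u')).proj) u e := by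
  let X : ℝ × F → M := fun q => (geodesicFlow g q.1 (ζ q.2)).proj
  have hX : MDifferentiableAt 𝓘(ℝ, ℝ × F) (𝓡 (d + 1)) X (T u, u) :=
    mdifferentiableAt_proj (h.contMDiffAt_family hζ)
  let L : ℝ × F →L[ℝ] TangentSpace (𝓡 (d + 1)) (X (T u, u)) :=
    mfderiv 𝓘(ℝ, ℝ × F) (𝓡 (d + 1)) X (T u, u)
  have h1 : mfderiv 𝓘(ℝ, F) (𝓡 (d + 1)) (fun u' => (geodesicFlow g (T u') (ζ u')).proj) u e =
      L (fderiv ℝ T u e, e) := by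
    have h2 : HasMFDerivAt 𝓘(ℝ, F) 𝓘(ℝ, ℝ × F) (fun u' => (T u', u')) u
        ((fderiv ℝ T u).prod (ContinuousLinearMap.id ℝ F)) :=
      (hT.hasFDerivAt.prodMk (hasFDerivAt_id u)).hasMFDerivAt
    have h3 := (HasMFDerivAt.comp u (g := X) (f := fun u' => (T u', u')) hX.hasMFDerivAt
      h2).mfderiv
    exact congrArg (fun A => A e) h3
  have h4 : mfderiv 𝓘(ℝ, F) (𝓡 (d + 1)) (fun u' => (geodesicFlow g (T u) (ζ u')).proj) u e =
      L (0, e) := by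
    have h2 : HasMFDerivAt 𝓘(ℝ, F) 𝓘(ℝ, ℝ × F) (fun u' => (T u, u')) u
        (ContinuousLinearMap.inr ℝ ℝ F) :=
      (hasFDerivAt_prodMk_right (𝕜 := ℝ) (T u) u).hasMFDerivAt
    have h3 := (HasMFDerivAt.comp u (g := X) (f := fun u' => (T u, u')) hX.hasMFDerivAt
      h2).mfderiv
    exact congrArg (fun A => A e) h3
  have h5 : (geodesicFlow g (T u) (ζ u)).snd = L (1, 0) := by
    obtain ⟨γ, hγ, hγw, hev⟩ := h.eventually_stateAt
    have h2 : HasMFDerivAt 𝓘(ℝ, ℝ) 𝓘(ℝ, ℝ × F) (fun r : ℝ => (r, u)) (T u)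
        (ContinuousLinearMap.inl ℝ ℝ F) :=
      (hasFDerivAt_prodMk_left (𝕜 := ℝ) (T u) u).hasMFDerivAt
    have h3 := (HasMFDerivAt.comp (T u) (g := X) (f := fun r : ℝ => (r, u)) hX.hasMFDerivAt
      h2).mfderiv
    have h6 : (fun r => X (r, u)) =ᶠ[𝓝 (T u)] γ := by
      filter_upwards [hev] with r hr
      exact congrArg Bundle.TotalSpace.proj hr
    have h7 : stateAt (d := d) (fun r => X (r, u)) (T u) = geodesicFlow g (T u) (ζ u) :=
      (stateAt_congr h6).trans (hγw.trans (geodesicFlow_eq h).symm)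
    have h8 : (geodesicFlow g (T u) (ζ u)).snd =
        mfderiv 𝓘(ℝ, ℝ) (𝓡 (d + 1)) (fun r => X (r, u)) (T u) (1 : ℝ) :=
      (eq_of_heq (Bundle.TotalSpace.mk.inj h7).2).symm
    rw [h8]
    exact congrArg (fun A => A (1 : ℝ)) h3
  rw [h1, h4, h5]
  have h9 : ((fderiv ℝ T u e, e) : ℝ × F) = fderiv ℝ T u e • ((1 : ℝ), (0 : F)) + (0, e) := by
    simp
  rw [h9, map_add, map_smul]

end

/-- Flight followed by time reversal turns the canonical one-form `θ` into `-(θ + |v|² dτ)`,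
where `τ` is the time of flight. -/
theorem pullbackForm_reverse_flow {g : Metric d M} {T : Coord d → ℝ}
    {ψ : Coord d → TangentBundle (𝓡 (d + 1)) M} {u : Coord d}
    {w : TangentBundle (𝓡 (d + 1)) M} (h : GeodesicReaches g (T u) (ψ u) w)
    (hψ : ∀ᶠ u' in 𝓝 u, ContMDiffAt 𝓘(ℝ, Coord d) (𝓡 (d + 1)).tangent ∞ ψ u')
    (hT : DifferentiableAt ℝ T u) {K : ℝ}
    (hK : ∀ᶠ u' in 𝓝 u, g.inner (ψ u').proj (ψ u').snd (ψ u').snd = K) (a : Fin d ⊕ Fin d) :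
    pullbackForm g (fun u' => reverse (geodesicFlow g (T u') (ψ u'))) a u =
      -1 * (pullbackForm g ψ a u + K * fderiv ℝ T u (Pi.single a 1)) := by
  have h1 := h.inner_variation hψ hK (Pi.single a 1)
  have h2 := mfderiv_flow_family h hψ.self_of_nhds hT (Pi.single a 1)
  have h3 := h.reaches_flow.speed_eq
  rw [hK.self_of_nhds] at h3
  change g.inner (geodesicFlow g (T u) (ψ u)).proj (-(geodesicFlow g (T u) (ψ u)).snd)
    (mfderiv 𝓘(ℝ, Coord d) (𝓡 (d + 1)) (fun u' => (geodesicFlow g (T u') (ψ u')).proj) u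
      (Pi.single a 1)) = _
  rw [Metric.inner_neg_left, h2, Metric.inner_add_right, Metric.inner_smul_right, h3, h1,
    pullbackForm]
  ring

/-- Smoothness comes from the smooth hitting time, and the density is preserved since `θ` changes
to `-(θ + d(|v|² τ))`, with `|v|²` constant on the phase space over the piece. -/
theorem liouvilleInvolution_flightReversal (g : Metric d M) (R A : Set M) (m C E : ℝ) :
    LiouvilleInvolution g R A m C E (flying g R A m C E) (flightReversal g R A m C E) where
  subset _ hz := hz.1
  maps _ hz := (flightReversal_mem hz).1
  involutive _ hz := (flightReversal_mem hz).2
  eq_off z hz := if_neg hz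
  smooth z hz := by
    obtain ⟨τ, w, hr, hτ, hev⟩ := exists_hittingTime_of_mem_flying hz
    refine ⟨z.1, fun ζ => reverse (geodesicFlow g (τ ζ) ζ), ?_, ?_⟩
    · have h1 : ContMDiffAt (𝓡 (d + 1)).tangent (𝓘(ℝ, ℝ).prod (𝓡 (d + 1)).tangent) ∞
          (fun ζ => (τ ζ, ζ)) z.2 := hτ.prodMk contMDiffAt_id
      have h2 := ContMDiffAt.comp z.2 (f := fun ζ => (τ ζ, ζ))
        (g := fun p : ℝ × TangentBundle (𝓡 (d + 1)) M => geodesicFlow g p.1 p.2)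
        hr.eventually.self_of_nhds.2 h1
      exact contMDiff_reverse.contMDiffAt.comp z.2 h2
    · filter_upwards [hev] with ζ h1 h2
      obtain ⟨-, h3, h4⟩ := h1 h2
      exact ⟨h4, flightReversal_eq h4 h3⟩
  density i j ψ φ u hev := by
    have hz : (i, ψ u) ∈ flying g R A m C E := hev.self_of_nhds.2.2.1
    obtain ⟨τ, w, hr, hτ, hτev⟩ := exists_hittingTime_of_mem_flying hz
    have hψ := hev.self_of_nhds.1
    have hT : ContDiffAt ℝ ∞ (fun u' => τ (ψ u')) u :=
      contMDiffAt_iff_contDiffAt.1 (ContMDiffAt.comp u (g := τ) (f := ψ) hτ hψ)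
    have hT2 : ContDiffAt ℝ 2 (fun u' => τ (ψ u')) u := hT.of_le ENat.LEInfty.out
    have hTd : ∀ᶠ u' in 𝓝 u, DifferentiableAt ℝ (fun u' => τ (ψ u')) u' :=
      (hT2.eventually (by simp)).mono fun u' h => h.differentiableAt (by simp)
    have hφ : ∀ᶠ u' in 𝓝 u, φ u' = reverse (geodesicFlow g (τ (ψ u')) (ψ u')) ∧
        GeodesicReaches g (τ (ψ u')) (ψ u') (geodesicFlow g (τ (ψ u')) (ψ u')) := by
      filter_upwards [hev, hψ.continuousAt.eventually hτev] with u' h1 h2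
      obtain ⟨h3, h4, -⟩ := h2 h1.2.2.1.1
      have h5 := h1.2.2.2
      rw [flightReversal_eq h1.2.2.1 h4] at h5
      exact ⟨(congrArg Prod.snd h5).symm, h3⟩
    have hK : ∀ᶠ u' in 𝓝 u, g.inner (ψ u').proj (ψ u').snd (ψ u').snd =
        2 * (E - potential C i) / m := hev.mono fun u' h => h.2.2.1.1.2
    refine liouvilleDensity_eq g (.inr rfl)
      (T := fun u' => 2 * (E - potential C i) / m * τ (ψ u')) (contDiffAt_const.mul hT2)
      (hev.mono fun u' h => h.1) fun a => ?_
    filter_upwards [hφ, hφ.eventually_nhds, hTd, hK.eventually_nhds,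
      (hev.mono fun u' h => h.1).eventually_nhds] with u' h1 h2 h3 h4 h5
    rw [pullbackForm_congr g (h2.mono fun u'' h => h.1) a,
      pullbackForm_reverse_flow (T := fun u' => τ (ψ u')) h1.2 h5 h3 h4, fderiv_const_mul h3]
    rfl

/-! ### The lensed billiard map -/

/-- The transverse states over the reflecting boundary, or away from the critical angle over the
refracting boundary. The billiard map is defined where free flight and reflection lead to such a
state. -/
def noncritical (g : Metric d M) (R A : Set M) (m C E : ℝ) : Set (State d M) :=
  {z | z ∈ transverse g R A m C E ∧ (z.2.proj ∉ piece R A (!z.1) ∨ refractedSq g R A m C z ≠ 0)}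

theorem measurableSet_noncritical (g : Metric d M) (R A : Set M) (m C E : ℝ) :
    MeasurableSet (noncritical g R A m C E) := by
  refine measurableSet_of_eventually (measurableSet_transverse g R A m C E) (fun z hz => hz.1)
    fun z hz => eventually_state_iff.2 ?_
  obtain ⟨U, f, N, hc, hx, hf, hpos, hreg⟩ := exists_boundaryChart_of_mem_transverse hz.1
  rcases hz.2 with h | h
  · filter_upwards [((isClosed_piece R A (!z.1)).isOpen_compl.preimage
      continuous_stateProj).mem_nhds h] with ζ h1 h2
    exact ⟨h2, .inl h1⟩
  · have hcont : ContinuousAt (fun ζ : TangentBundle (𝓡 (d + 1)) M =>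
        g.inner ζ.proj (N ζ.proj) ζ.snd ^ 2
          - 2 / m * (potential C (!z.1) - potential C z.1)) z.2 :=
      ((hc.contMDiffAt_inner_normal hx).continuousAt.pow 2).sub continuousAt_const
    rw [refractedSq, normalSpeed_eq (hreg _ hx hf).1] at h
    filter_upwards [hc.eventually_mem hx, hcont.eventually_ne h] with ζ h1 h2 h3
    refine ⟨h3, .inr ?_⟩
    have h4 := (hc.eq_normal h1 (isRegular_of_mem_transverse h3).1.1).1
    rw [refractedSq, normalSpeed_eq (hc.isInwardNormal h1 h4)]
    exact h2

/-- The two reversals of the tangential part cancel, and what remains is the usual reflection. -/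
theorem reflect_flightReversal {g : Metric d M} {R A : Set M} {m C E : ℝ} {z : State d M}
    (hz : z ∈ flying g R A m C E) {w : TangentBundle (𝓡 (d + 1)) M}
    (hw : Flight g (piece R A z.1) z.2 w) {ν : TangentSpace (𝓡 (d + 1)) w.proj}
    (hν : IsRegular g R A z.1 w.proj ν) :
    reflect g R A m C E (flightReversal g R A m C E z) =
      (z.1, ⟨w.proj, w.snd - (2 * g.inner w.proj ν w.snd) • ν⟩) := by
  have h1 := (flightReversal_mem hz).1.1
  have hn := hν.1.inwardNormal_eq
  rw [flightReversal_eq hz hw] at h1 ⊢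
  rw [reflect, if_pos h1]
  simp only
  have h2 : normalSpeed g (piece R A z.1) (reverse w) = -g.inner w.proj ν w.snd := by
    change g.inner w.proj (inwardNormal g (piece R A z.1) w.proj) (-w.snd) = _
    rw [hn, Metric.inner_neg_right]
  rw [h2]
  have h3 : (-1 : ℝ) • (-w.snd) + (2 * -g.inner w.proj ν w.snd) •
      inwardNormal g (piece R A z.1) w.proj = w.snd - (2 * g.inner w.proj ν w.snd) • ν := by
    rw [hn]
    module
  exact congrArg (fun v => (z.1, (⟨w.proj, v⟩ : TangentBundle (𝓡 (d + 1)) M))) h3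

/-- A step of the billiard map is free flight with time reversal, followed by a reflection (with
time reversal) and by the passage through the refracting boundary. -/
theorem step_iff {g : Metric d M} {R A : Set M} {m C E : ℝ} (hm : 0 < m) (hE : 0 < E)
    (hCE : C < E) {z z' : State d M} :
    Step g R A m C E z z' ↔ z ∈ flying g R A m C E ∧
      reflect g R A m C E (flightReversal g R A m C E z) ∈ noncritical g R A m C E ∧
      z' = refract g R A m C E (reflect g R A m C E (flightReversal g R A m C E z)) := by
  -- The outcome of a collision, in terms of the reflected state `q`. Its inward normal component is
  -- `-a`, so that its refracted square is the number `b` of the collision.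
  have key : ∀ (hz : z ∈ flying g R A m C E) (w : TangentBundle (𝓡 (d + 1)) M)
      (_ : Flight g (piece R A z.1) z.2 w) (ν : TangentSpace (𝓡 (d + 1)) w.proj)
      (_ : IsRegular g R A z.1 w.proj ν),
      Collision g R A m C z.1 w.proj ν w.snd z' ↔
        reflect g R A m C E (flightReversal g R A m C E z) ∈ noncritical g R A m C E ∧
        z' = refract g R A m C E (reflect g R A m C E (flightReversal g R A m C E z)) := by
    intro hz w hw ν hν
    have hn := hν.1.inwardNormal_eq
    have ht : reflect g R A m C E (flightReversal g R A m C E z) ∈ transverse g R A m C E :=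
      (liouvilleInvolution_reflect g R A m C E).maps _ (flightReversal_mem hz).1.1
    have hq := reflect_flightReversal hz hw hν
    set q := reflect g R A m C E (flightReversal g R A m C E z) with hqdef
    set a := g.inner w.proj ν w.snd with ha
    have hνν : g.inner w.proj ν ν = 1 := hν.1.1
    have hq1 : q.1 = z.1 := by rw [hq]
    have hns : normalSpeed g (piece R A z.1) q.2 = -a := by
      rw [hq]
      change g.inner w.proj (inwardNormal g (piece R A z.1) w.proj) (w.snd - (2 * a) • ν) = _
      rw [hn, Metric.inner_sub_right, Metric.inner_smul_right, hνν, ← ha]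
      ring
    have hb : refractedSq g R A m C q = a ^ 2 - 2 / m * (potential C (!z.1) - potential C z.1) := by
      rw [refractedSq, hq1, hns]
      ring
    have hy : q.2.proj ∈ piece R A (!q.1) ↔ w.proj ∈ piece R A (!z.1) := by rw [hq]
    set b := a ^ 2 - 2 / m * (potential C (!z.1) - potential C z.1) with hbdef
    have hcol : Collision g R A m C z.1 w.proj ν w.snd z' ↔
        ((w.proj ∉ piece R A (!z.1) ∨ b < 0) ∧
          z' = (z.1, (⟨w.proj, w.snd - (2 * a) • ν⟩ : TangentBundle (𝓡 (d + 1)) M))) ∨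
        ((w.proj ∈ piece R A (!z.1) ∧ 0 < b) ∧ z' = (!z.1,
          (⟨w.proj, (w.snd - a • ν) + Real.sqrt b • (-ν)⟩ : TangentBundle (𝓡 (d + 1)) M))) :=
      Iff.rfl
    have hnon : q ∈ noncritical g R A m C E ↔ (w.proj ∉ piece R A (!z.1) ∨ b ≠ 0) := by
      rw [← hb, ← hy]
      exact and_iff_right ht
    have hrefr : q ∈ refracting g R A m C E ↔ (w.proj ∈ piece R A (!z.1) ∧ 0 < b) := by
      rw [← hb, ← hy]
      exact and_iff_right ht
    rw [hcol, hnon, ← hq]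
    by_cases hcase : w.proj ∈ piece R A (!z.1) ∧ 0 < b
    · have h1 : refract g R A m C E q = (!z.1,
          (⟨w.proj, (w.snd - a • ν) + Real.sqrt b • (-ν)⟩ : TangentBundle (𝓡 (d + 1)) M)) := by
        rw [refract, if_pos (hrefr.2 hcase), hb, hq1, hns, hq]
        have h2 : (1 : ℝ) • (w.snd - (2 * a) • ν) + (- -a - Real.sqrt b) •
            inwardNormal g (piece R A z.1) w.proj = (w.snd - a • ν) + Real.sqrt b • (-ν) := by
          rw [hn]
          module
        exact congrArg (fun v => (!z.1, (⟨w.proj, v⟩ : TangentBundle (𝓡 (d + 1)) M))) h2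
      rw [h1]
      constructor
      · rintro (⟨h2 | h2, -⟩ | h2)
        · exact absurd hcase.1 h2
        · exact absurd hcase.2 h2.not_gt
        · exact ⟨.inr hcase.2.ne', h2.2⟩
      · exact fun h2 => .inr ⟨hcase, h2.2⟩
    · have h1 : refract g R A m C E q = q := if_neg fun h2 => hcase (hrefr.1 h2)
      rw [h1]
      constructor
      · rintro (⟨h2 | h2, h3⟩ | h2)
        · exact ⟨.inl h2, h3⟩
        · exact ⟨.inr h2.ne, h3⟩
        · exact absurd h2.1 hcase
      · rintro ⟨h2, h3⟩
        refine .inl ⟨?_, h3⟩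
        by_cases h4 : w.proj ∈ piece R A (!z.1)
        · exact .inr (((h2.resolve_left (not_not.2 h4)).lt_or_gt).resolve_right
            fun h5 => hcase ⟨h4, h5⟩)
        · exact .inl h4
  constructor
  · rintro ⟨hph, hpos, w, hw, ν, hν, hneg, hcol⟩
    have hz : z ∈ flying g R A m C E :=
      ⟨mem_transverse_of_mem_phaseSpace hm hE hCE hph hpos, w, hw, ν, hν, hneg⟩
    exact ⟨hz, (key hz w hw ν hν).1 hcol⟩
  · rintro ⟨hz, h⟩
    obtain ⟨hzt, w, hw, ν, hν, hneg⟩ := id hz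
    exact ⟨transverse_subset_phaseSpace g R A m C E hzt, hzt.1, w, hw, ν, hν, hneg,
      (key hz w hw ν hν).2 h⟩

/-- The billiard map preserves the Liouville measure, being almost everywhere a composition of
three involutions that do. -/
theorem measurePreserving_billiardMap {g : Metric d M} {R A : Set M}
    (hA : ∃ O : Set M, IsOpen O ∧ A = O ∩ R) {m C E : ℝ} (hm : 0 < m) (hE : 0 < E) (hCE : C < E)
    (hdom : ∀ᵐ z ∂(liouvilleMeasure g R A m C E), z ∈ billiardDomain g R A m C E) :
    MeasurePreserving (billiardMap g R A m C E) (liouvilleMeasure g R A m C E)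
      (liouvilleMeasure g R A m C E) := by
  classical
  let Φ : State d M → State d M := fun z =>
    refract g R A m C E (reflect g R A m C E (flightReversal g R A m C E z))
  have hσ := (liouvilleInvolution_flightReversal g R A m C E)
  have hJ := (liouvilleInvolution_reflect g R A m C E)
  have hK := (liouvilleInvolution_refract (g := g) (C := C) (E := E) hm hA)
  have hΦ : MeasurePreserving Φ (liouvilleMeasure g R A m C E) (liouvilleMeasure g R A m C E) :=
    (hK.measurePreserving hm hE hCE).comp
      ((hJ.measurePreserving hm hE hCE).comp (hσ.measurePreserving hm hE hCE))
  have hmeas : MeasurableSet (billiardDomain g R A m C E) := by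
    have h1 : billiardDomain g R A m C E = flying g R A m C E ∩
        (fun z => reflect g R A m C E (flightReversal g R A m C E z)) ⁻¹'
          noncritical g R A m C E := by
      ext z
      constructor
      · rintro ⟨z', hz'⟩
        have h2 := (step_iff hm hE hCE).1 hz'
        exact ⟨h2.1, h2.2.1⟩
      · exact fun hz => ⟨Φ z, (step_iff hm hE hCE).2 ⟨hz.1, hz.2, rfl⟩⟩
    rw [h1]
    exact hσ.measurableSet.inter
      ((hJ.measurable.comp hσ.measurable) (measurableSet_noncritical g R A m C E))
  have hΦeq : ∀ z ∈ billiardDomain g R A m C E, billiardMap g R A m C E z = Φ z := by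
    intro z hz
    have h1 : ∃ z', Step g R A m C E z z' := hz
    rw [billiardMap, dif_pos h1]
    exact ((step_iff hm hE hCE).1 h1.choose_spec).2.2
  have hT : billiardMap g R A m C E =
      fun z => if z ∈ billiardDomain g R A m C E then Φ z else z := by
    ext1 z
    split_ifs with hz
    · exact hΦeq z hz
    · exact dif_neg hz
  refine ⟨?_, ?_⟩
  · rw [hT]
    exact Measurable.ite hmeas hΦ.measurable measurable_id
  · exact (Measure.map_congr (hdom.mono hΦeq)).trans hΦ.map_eq

end LensedBilliard

end

theorem theorem3p1 {d : ℕ} {M : Type*} [TopologicalSpace M] [T2Space M]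
    [SecondCountableTopology M] [ChartedSpace (EuclideanSpace ℝ (Fin (d + 1))) M]
    [IsManifold (𝓡 (d + 1)) ∞ M]
    (g : Bundle.ContMDiffRiemannianMetric (𝓡 (d + 1)) ∞ (EuclideanSpace ℝ (Fin (d + 1)))
      (fun x : M => TangentSpace (𝓡 (d + 1)) x))
    (R A : Set M) (hR : IsClosed R) (hRreg : closure (interior R) = R)
    (hA : ∃ O : Set M, IsOpen O ∧ A = O ∩ R)
    (m C E : ℝ) (hm : 0 < m) (hE : 0 < E) (hCE : C < E)
    (hdom : ∀ᵐ z ∂(LensedBilliard.liouvilleMeasure g R A m C E),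
      z ∈ LensedBilliard.billiardDomain g R A m C E) :
    MeasurePreserving (LensedBilliard.billiardMap g R A m C E)
      (LensedBilliard.liouvilleMeasure g R A m C E)
      (LensedBilliard.liouvilleMeasure g R A m C E) :=
  LensedBilliard.measurePreserving_billiardMap hA hm hE hCE hdom
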